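/- **Setting.** Let $\Omega$ be a Polish space with its Borel $\sigma$-algebra and a probability measure $\mu$. Let $(\kappa_t)_{t\ge 0}$ be the transition kernels of a time-homogeneous Markov process $(Z_t)_{t\ge0}$ on $\Omega$ (Markov kernels with $\kappa_0(z,\cdot)=\delta_z$ and the Chapman–Kolmogorov property), and let $(P_tf)(z)=\mathbb E[f(Z_t)\mid Z_0=z]=\int f\,d\kappa_t(z,\cdot)$. Assume that * $\mu$ is stationary; * the semigroup is reversible: $\mathbb E_\mu[(P_tf)g]=\mathbb E_\mu[f(P_tg)]$ for all $t\ge 0$ and all real $f,g\in L_2(\mu)$; * the semigroup is ergodic: $P_tf\to\mathbb E_\mu f$ in $L_2(\mu)$ as $t\to\infty$ for all real $f\in L_2(\mu)$. The generator is $(\mathcal Lf)(z)=\lim_{t\downarrow0}t^{-1}\big((P_tf)(z)-f(z)\big)$ (set to $0$ where the limit does not exist); it and $\mathbb E_\mu$ act on matrix-valued functions entrywise. Fix an algebra $\mathcal A$ of *suitable* functions: a complex algebra of measurable functions $\Omega\to\mathbb C$ that contains the constants, is closed under complex conjugation, consists of functions in $L_2(\mu)$, is stable under every $P_t$ and under $\mathcal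 L$, and is such that for each of its members the limit defining $\mathcal L$ exists $\mu$-almost everywhere and also holds in $L_2(\mu)$. (Members of $\mathcal A$ need not be bounded.) For $d\ge1$, let $\mathbb H_d$ be the set of $d\times d$ complex Hermitian matrices; a function $f:\Omega\to\mathbb H_d$ is suitable if all of its entries belong to $\mathcal A$. Write $$\Gamma(f,g)=\tfrac12\big[\mathcal L(fg)-f\mathcal L(g)-\mathcal L(f)g\big],\qquad \Gamma_2(f,g)=\tfrac12\big[\mathcal L\Gamma(f,g)-\Gamma(f,\mathcal Lg)-\Gamma(\mathcal Lf,g)\big],$$ with $\Gamma(f)=\Gamma(f,f)$ and $\Gamma_2(f)=\Gamma_2(f,f)$. Assume that the Bakry–Émery criterion holds with a constant $c>0$: $\Gamma(f)\preccurlyeq c\,\Gamma_2(f)$ $\mu$-almost everywhere, in the positive-semidefinite order, for every suitable $f:\Omega\to\mathbb H_d$. Let $\bar{\mathrm{tr}}=d^{-1}\mathrm{tr}$. For suitable $f:\Omega\to\mathbb H_d$ put $$r_f(\beta)=\frac1\beta\log\mathbb E_\mu\,\bar{\mathrm{tr}}\,e^{\beta\Gamma(f)}\in[0,+\infty]\quad(\beta>0),\qquad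 v_f=\big\|\,\|\Gamma(f)\|\,\big\|_{L_\infty(\mu)}\in[0,+\infty],$$ where $\|\cdot\|$ is the $\ell_2$ operator norm. **Theorem (Exponential moments).** For every suitable $f:\Omega\to\mathbb H_d$, every $\beta>0$ and every $\theta\in(-\sqrt{\beta/c},\sqrt{\beta/c})$, $$\log\mathbb E_\mu\,\bar{\mathrm{tr}}\,e^{\theta(f-\mathbb E_\mu f)}\le\frac{c\,\theta^2\,r_f(\beta)}{2(1-c\theta^2/\beta)},$$ where $0\cdot(+\infty)=0$; in particular, the left side is finite whenever $r_f(\beta)$ is. Moreover, if $v_f<+\infty$, then for every $\theta\in\mathbb R$, $$\log\mathbb E_\mu\,\bar{\mathrm{tr}}\,e^{\theta(f-\mathbb E_\mu f)}\le\frac{c\,v_f\,\theta^2}{2}.$$ -/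

import Mathlib

open MeasureTheory ProbabilityTheory Filter Topology
open scoped NNReal ENNReal ComplexOrder

namespace MatrixMarkov

variable {Ω : Type*} [MeasurableSpace Ω] {d : ℕ}

/-- `κ t z` is the law of `Z_t` given `Z_0 = z`, for a time-homogeneous Markov process `Z`:
Markov kernels with `κ 0 = id` that satisfy the Chapman--Kolmogorov equations. -/
structure IsMarkovSemigroup (κ : ℝ≥0 → Kernel Ω Ω) : Prop where
  markov : ∀ t, IsMarkovKernel (κ t)
  zero : κ 0 = Kernel.id
  add : ∀ s t, κ (s + t) = κ t ∘ₖ κ s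

/-- The semigroup `(P_t f)(z) = 𝔼[f(Z_t) | Z_0 = z]`. -/
noncomputable def semigroup {E : Type*} [NormedAddCommGroup E] [NormedSpace ℝ E]
    (κ : ℝ≥0 → Kernel Ω Ω) (t : ℝ≥0) (f : Ω → E) (z : Ω) : E :=
  ∫ y, f y ∂(κ t z)

/-- `μ` is stationary: if `Z_0 ∼ μ` then `Z_t ∼ μ` for every `t`. -/
def IsStationary (κ : ℝ≥0 → Kernel Ω Ω) (μ : Measure Ω) : Prop :=
  ∀ t, μ.bind (κ t) = μ

/-- Each `P_t` is symmetric on (real) `L₂(μ)`. -/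
def IsReversible (κ : ℝ≥0 → Kernel Ω Ω) (μ : Measure Ω) : Prop :=
  ∀ (t : ℝ≥0) (f g : Ω → ℝ), MemLp f 2 μ → MemLp g 2 μ →
    ∫ z, semigroup κ t f z * g z ∂μ = ∫ z, f z * semigroup κ t g z ∂μ

/-- `P_t f → 𝔼_μ f` in `L₂(μ)` as `t → ∞`, for every real `f` in `L₂(μ)`. -/
def IsErgodic (κ : ℝ≥0 → Kernel Ω Ω) (μ : Measure Ω) : Prop :=
  ∀ f : Ω → ℝ, MemLp f 2 μ →
    Tendsto (fun t : ℝ≥0 => eLpNorm (fun z => semigroup κ t f z - ∫ y, f y ∂μ) 2 μ)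
      atTop (𝓝 0)

/-- The difference quotient `((P_t f)(z) - f(z)) / t`. -/
noncomputable def diffQuot (κ : ℝ≥0 → Kernel Ω Ω) (f : Ω → ℂ) (t : ℝ≥0) (z : Ω) : ℂ :=
  (semigroup κ t f z - f z) / ((t : ℝ) : ℂ)

open Classical in
/-- The infinitesimal generator on scalar functions,
`(𝓛 f)(z) = lim_{t ↓ 0} ((P_t f)(z) - f(z)) / t`, with value `0` where the limit does not exist. -/
noncomputable def generator (κ : ℝ≥0 → Kernel Ω Ω) (f : Ω → ℂ) (z : Ω) : ℂ :=
  if h : ∃ a : ℂ, Tendsto (fun t : ℝ≥0 => diffQuot κ f t z) (𝓝[>] 0) (𝓝 a) then h.choose else 0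

/-- An algebra of suitable functions for the semigroup: an algebra `𝒜` of complex functions on `Ω`
that contains the constants and is closed under complex conjugation (this is part of
`StarSubalgebra`), consists of square-integrable functions in the domain of the generator, and is
stable under the semigroup and the generator. -/
structure IsSuitableAlgebra (κ : ℝ≥0 → Kernel Ω Ω) (μ : Measure Ω)
    (𝒜 : StarSubalgebra ℂ (Ω → ℂ)) : Prop where
  measurable : ∀ f ∈ 𝒜, Measurable f
  memLp : ∀ f ∈ 𝒜, MemLp f 2 μ
  semigroup_mem : ∀ f ∈ 𝒜, ∀ t, semigroup κ t f ∈ 𝒜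
  generator_mem : ∀ f ∈ 𝒜, generator κ f ∈ 𝒜
  /-- the limit that defines `𝓛 f` exists almost everywhere -/
  tendsto_ae : ∀ f ∈ 𝒜, ∀ᵐ z ∂μ,
    Tendsto (fun t : ℝ≥0 => diffQuot κ f t z) (𝓝[>] 0) (𝓝 (generator κ f z))
  /-- the limit that defines `𝓛 f` also holds in `L₂(μ)` -/
  tendsto_L2 : ∀ f ∈ 𝒜,
    Tendsto (fun t : ℝ≥0 => eLpNorm (fun z => diffQuot κ f t z - generator κ f z) 2 μ)
      (𝓝[>] 0) (𝓝 0)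

/-- A suitable function `f : Ω → ℍ_d`: Hermitian values, entries in `𝒜`. -/
def IsSuitable (𝒜 : StarSubalgebra ℂ (Ω → ℂ)) (f : Ω → Matrix (Fin d) (Fin d) ℂ) : Prop :=
  (∀ z, (f z).IsHermitian) ∧ ∀ i j, (fun z => f z i j) ∈ 𝒜

/-- The generator on matrix-valued functions, which acts entry by entry. -/
noncomputable def matGenerator (κ : ℝ≥0 → Kernel Ω Ω) (f : Ω → Matrix (Fin d) (Fin d) ℂ) :
    Ω → Matrix (Fin d) (Fin d) ℂ :=
  fun z => Matrix.of fun i j => generator κ (fun y => f y i j) z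

/-- The matrix carré du champ
`Γ(f, g) = ½ [𝓛(f g) - f 𝓛(g) - 𝓛(f) g]`. -/
noncomputable def carre (κ : ℝ≥0 → Kernel Ω Ω) (f g : Ω → Matrix (Fin d) (Fin d) ℂ) :
    Ω → Matrix (Fin d) (Fin d) ℂ :=
  (1 / 2 : ℂ) • (matGenerator κ (f * g) - f * matGenerator κ g - matGenerator κ f * g)

/-- The iterated carré du champ
`Γ₂(f, g) = ½ [𝓛Γ(f, g) - Γ(f, 𝓛 g) - Γ(𝓛 f, g)]`. -/
noncomputable def carre₂ (κ : ℝ≥0 → Kernel Ω Ω) (f g : Ω → Matrix (Fin d) (Fin d) ℂ) :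
    Ω → Matrix (Fin d) (Fin d) ℂ :=
  (1 / 2 : ℂ) •
    (matGenerator κ (carre κ f g) - carre κ f (matGenerator κ g) - carre κ (matGenerator κ f) g)

/-- The matrix Bakry--Émery criterion in dimension `d`: `Γ(f) ≼ c · Γ₂(f)` almost everywhere, for
all suitable `f : Ω → ℍ_d`. -/
def BakryEmery (κ : ℝ≥0 → Kernel Ω Ω) (μ : Measure Ω) (𝒜 : StarSubalgebra ℂ (Ω → ℂ)) (d : ℕ)
    (c : ℝ) : Prop :=
  ∀ f : Ω → Matrix (Fin d) (Fin d) ℂ, IsSuitable 𝒜 f →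
    ∀ᵐ z ∂μ, ((c : ℂ) • carre₂ κ f f z - carre κ f f z).PosSemidef

/-- The entrywise expectation `𝔼_μ f` of a matrix-valued function. -/
noncomputable def matMean (μ : Measure Ω) (f : Ω → Matrix (Fin d) (Fin d) ℂ) :
    Matrix (Fin d) (Fin d) ℂ :=
  Matrix.of fun i j => ∫ z, f z i j ∂μ

/-- The normalized trace `d⁻¹ tr A` (real part; it is used for Hermitian `A`). -/
noncomputable def normTrace (A : Matrix (Fin d) (Fin d) ℂ) : ℝ :=
  A.trace.re / d

/-- `𝔼_μ tr̄ e^{g}` for a Hermitian-valued `g`, as an element of `[0, ∞]`. -/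
noncomputable def expMoment (μ : Measure Ω) (g : Ω → Matrix (Fin d) (Fin d) ℂ) : ℝ≥0∞ :=
  ∫⁻ z, ENNReal.ofReal (normTrace (NormedSpace.exp (g z))) ∂μ

/-- The logarithm `log 𝔼_μ tr̄ e^{θ (f - 𝔼_μ f)}` of the normalized trace mgf. -/
noncomputable def logTraceMgf (μ : Measure Ω) (f : Ω → Matrix (Fin d) (Fin d) ℂ) (θ : ℝ) : EReal :=
  ENNReal.log (expMoment μ fun z => (θ : ℂ) • (f z - matMean μ f))

/-- The exponential mean `r_f(β) = β⁻¹ log 𝔼_μ tr̄ e^{β Γ(f)}` of the carré du champ, which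
is `+∞` if the expectation is infinite. -/
noncomputable def expMean (κ : ℝ≥0 → Kernel Ω Ω) (μ : Measure Ω)
    (f : Ω → Matrix (Fin d) (Fin d) ℂ) (β : ℝ) : EReal :=
  ((β⁻¹ : ℝ) : EReal) * ENNReal.log (expMoment μ fun z => (β : ℂ) • carre κ f f z)

/-- The variance proxy `v_f = ‖ ‖Γ(f)‖ ‖_{L_∞(μ)}` in `[0, ∞]`, with the `ℓ₂` operator norm
inside. -/
noncomputable def varianceProxy (κ : ℝ≥0 → Kernel Ω Ω) (μ : Measure Ω)
    (f : Ω → Matrix (Fin d) (Fin d) ℂ) : ℝ≥0∞ :=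
  eLpNorm (fun z => ‖Matrix.toEuclideanCLM (𝕜 := ℂ) (carre κ f f z)‖) ∞ μ

end MatrixMarkov

/-! Let `f` be centred and suitable, `φ` a scalar function and `C s = 𝔼 tr [f(Z_s) φ(f(Z_0))]`. By
reversibility the pair `(Z_0, Z_t)` is exchangeable, so with `G = P_s f`
`C s - C (s + t) = ½ 𝔼 tr [(G(Z_t) - G(Z_0)) (φ(f(Z_t)) - φ(f(Z_0)))]`,
and a mean value inequality for traces bounds `-C'` by the averages of `Γ(f)` and `Γ(P_s f)` against
a weight `ψ(f)`, where `ψ` plays the part of `|φ'|`. Duhamel's interpolation `r ↦ P_{s-r} Γ(P_r f)`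
turns the Bakry–Émery criterion into `Γ(P_s f) ≼ e^{-2s/c} P_s Γ(f)`, and `C` vanishes at infinity
by ergodicity. Integrating over `s` shows `C 0 ≤ c sup_s 𝔼 tr [Γ(f)(Z_s) ψ(f(Z_0))]`.

For `φ(x) = e^{θx}` and `ψ = θφ`, the Gibbs variational principle trades each of these expectations
for `r_f(β)` and the entropy of `e^{θf}`. The result is a differential inequality in `θ` for
`log 𝔼 tr e^{θf}`, which integrates to the first bound; the second is its limit as `β → ∞`, because
`r_f(β) ≤ v_f`. The members of `𝒜` may be unbounded, hence the truncation of the exponential to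
`e^{θ min(x, N)}`, with `N → ∞` at the very end.
-/

namespace MatrixMarkov

section Kernel

variable {Ω E : Type*} [MeasurableSpace Ω] {μ : Measure Ω} {η : Kernel Ω Ω}

theorem IsReversible.kernel_isReversible {κ : ℝ≥0 → Kernel Ω Ω} [IsFiniteMeasure μ]
    (h : IsReversible κ μ) (t : ℝ≥0) [IsMarkovKernel (κ t)] : (κ t).IsReversible μ := by
  have integral_eq_flow : ∀ {A B : Set Ω}, MeasurableSet A → MeasurableSet B →
      ∫ z, A.indicator (1 : Ω → ℝ) z * semigroup κ t (B.indicator 1) z ∂μ =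
        (∫⁻ z in A, κ t z B ∂μ).toReal := by
    intro A B hA hB
    rw [← integral_toReal ((κ t).measurable_coe hB).aemeasurable
      (ae_of_all _ fun z => measure_lt_top _ _), ← integral_indicator hA]
    refine integral_congr_ae (ae_of_all _ fun z => ?_)
    by_cases hz : z ∈ A <;> simp [semigroup, integral_indicator_one hB, hz, Measure.real]
  have flow_ne_top : ∀ A B : Set Ω, ∫⁻ z in A, κ t z B ∂μ ≠ ∞ := fun A B =>
    ne_top_of_le_ne_top (measure_ne_top μ A)
      ((lintegral_mono fun z => prob_le_one).trans_eq (by simp))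
  intro A B hA hB
  have symmetric := h t (A.indicator 1) (B.indicator 1)
    (memLp_indicator_const 2 hA 1 (Or.inr (measure_ne_top _ _)))
    (memLp_indicator_const 2 hB 1 (Or.inr (measure_ne_top _ _)))
  simp_rw [mul_comm (semigroup _ _ _ _)] at symmetric
  rw [integral_eq_flow hA hB, integral_eq_flow hB hA] at symmetric
  exact (ENNReal.toReal_eq_toReal_iff' (flow_ne_top _ _) (flow_ne_top _ _)).1 symmetric.symm

theorem integral_comp_measurePreserving {Ω' : Type*} [MeasurableSpace Ω'] {ν : Measure Ω'}
    [NormedAddCommGroup E] [NormedSpace ℝ E] {a : Ω' → Ω} (ha : MeasurePreserving a ν μ)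
    {u : Ω → E} (hu : AEStronglyMeasurable u μ) : ∫ p, u (a p) ∂ν = ∫ z, u z ∂μ := by
  have integral_map := integral_map (f := u) ha.aemeasurable (by rwa [ha.map_eq])
  rw [← integral_map, ha.map_eq]

theorem measurePreserving_fst_compProd [SFinite μ] [IsMarkovKernel η] :
    MeasurePreserving Prod.fst (μ ⊗ₘ η) μ :=
  ⟨measurable_fst, Measure.fst_compProd μ η⟩

theorem measurePreserving_snd_compProd [SFinite μ] [IsSFiniteKernel η] (h : η.Invariant μ) :
    MeasurePreserving Prod.snd (μ ⊗ₘ η) μ :=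
  ⟨measurable_snd, (Measure.snd_compProd μ η).trans h⟩

theorem measurePreserving_swap_compProd [IsFiniteMeasure μ] [IsFiniteKernel η]
    (h : η.IsReversible μ) :
    MeasurePreserving Prod.swap (μ ⊗ₘ η) (μ ⊗ₘ η) := by
  refine ⟨measurable_swap, (Measure.ext_prod fun {A B} hA hB => ?_).symm⟩
  rw [Measure.map_apply measurable_swap (hA.prod hB), Set.preimage_swap_prod,
    Measure.compProd_apply_prod hA hB, Measure.compProd_apply_prod hB hA, h hA hB]

theorem ae_ae_of_invariant (h : η.Invariant μ) {p : Ω → Prop} (hp : ∀ᵐ z ∂μ, p z) :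
    ∀ᵐ z ∂μ, ∀ᵐ y ∂η z, p y :=
  Measure.ae_ae_of_ae_comp (by rwa [h.def])

variable [NormedAddCommGroup E]

theorem ae_integrable_of_invariant (h : η.Invariant μ) {f : Ω → E} (hf : Integrable f μ) :
    ∀ᵐ z ∂μ, Integrable f (η z) :=
  ((Measure.integrable_comp_iff (by rw [h.def]; exact hf.1)).1 (by rwa [h.def])).1

variable [NormedSpace ℝ E]

theorem aestronglyMeasurable_integral_kernel [SFinite μ] [IsSFiniteKernel η] (h : η.Invariant μ)
    {f : Ω → E} (hf : AEStronglyMeasurable f μ) :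
    AEStronglyMeasurable (fun z => ∫ y, f y ∂η z) μ := by
  have hmk := hf.stronglyMeasurable_mk
  refine (hmk.integral_kernel (κ := η)).aestronglyMeasurable.congr ?_
  filter_upwards [ae_ae_of_invariant h hf.ae_eq_mk] with z hz
  exact (integral_congr_ae hz).symm

theorem eLpNorm_integral_kernel_le [IsMarkovKernel η] (h : η.Invariant μ) {p : ℝ≥0∞}
    (hp : 1 ≤ p) {f : Ω → E} (hf : AEStronglyMeasurable f μ) :
    eLpNorm (fun z => ∫ y, f y ∂η z) p μ ≤ eLpNorm f p μ := by
  have jensen : ∀ᵐ z ∂μ, ‖∫ y, f y ∂η z‖ₑ ≤ eLpNorm f p (η z) := by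
    filter_upwards [ae_ae_of_invariant h hf.ae_eq_mk] with z hz
    exact ((enorm_integral_le_lintegral_enorm f).trans_eq eLpNorm_one_eq_lintegral_enorm.symm).trans
      (eLpNorm_le_eLpNorm_of_exponent_le hp ⟨hf.mk f, hf.stronglyMeasurable_mk, hz⟩)
  rcases eq_or_ne p ∞ with rfl | hp_top
  · refine eLpNormEssSup_le_of_ae_enorm_bound ?_
    filter_upwards [jensen, ae_ae_of_invariant h (ae_le_eLpNormEssSup (f := f) (μ := μ))]
      with z hz hbound
    exact hz.trans (eLpNormEssSup_le_of_ae_enorm_bound hbound)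
  have hp_pos : 0 < p.toReal := ENNReal.toReal_pos (by positivity) hp_top
  simp only [eLpNorm_eq_lintegral_rpow_enorm_toReal (by positivity : p ≠ 0) hp_top]
  refine ENNReal.rpow_le_rpow ?_ (by positivity)
  calc ∫⁻ z, ‖∫ y, f y ∂η z‖ₑ ^ p.toReal ∂μ
      ≤ ∫⁻ z, ∫⁻ y, ‖f y‖ₑ ^ p.toReal ∂η z ∂μ := by
        refine lintegral_mono_ae (jensen.mono fun z hz => ?_)
        rwa [eLpNorm_eq_lintegral_rpow_enorm_toReal (by positivity) hp_top,
          one_div, ENNReal.le_rpow_inv_iff hp_pos] at hz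
    _ = ∫⁻ z, ‖f z‖ₑ ^ p.toReal ∂μ.bind η :=
        (Measure.lintegral_bind (Kernel.aemeasurable η)
          (by rw [h.def]; exact hf.enorm.pow_const _)).symm
    _ = ∫⁻ z, ‖f z‖ₑ ^ p.toReal ∂μ := by rw [h.def]

theorem memLp_integral_kernel [SFinite μ] [IsMarkovKernel η] (h : η.Invariant μ) {p : ℝ≥0∞}
    (hp : 1 ≤ p) {f : Ω → E} (hf : MemLp f p μ) : MemLp (fun z => ∫ y, f y ∂η z) p μ :=
  ⟨aestronglyMeasurable_integral_kernel h hf.1,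
    (eLpNorm_integral_kernel_le h hp hf.1).trans_lt hf.2⟩

variable [IsFiniteMeasure μ] [IsMarkovKernel η]

theorem norm_toLp_integral_kernel_le (h : η.Invariant μ) {p : ℝ≥0∞} (hp : 1 ≤ p)
    (f : Lp E p μ) : ‖(memLp_integral_kernel h hp (Lp.memLp f)).toLp _‖ ≤ ‖f‖ := by
  rw [Lp.norm_toLp]
  exact ENNReal.toReal_mono (Lp.eLpNorm_ne_top f)
    (eLpNorm_integral_kernel_le h hp (Lp.aestronglyMeasurable f))

/-- The Markov operator `f ↦ (z ↦ ∫ f dη(z, ·))` of a kernel with invariant measure `μ`, as a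
contraction of `L_p(μ)`. -/
noncomputable def kernelLp (h : η.Invariant μ) (p : ℝ≥0∞) [hp : Fact (1 ≤ p)] :
    Lp E p μ →L[ℝ] Lp E p μ :=
  LinearMap.mkContinuous
    { toFun := fun f => (memLp_integral_kernel h hp.out (Lp.memLp f)).toLp _
      map_add' := fun f g => by
        rw [← MemLp.toLp_add, MemLp.toLp_eq_toLp_iff]
        filter_upwards [ae_ae_of_invariant h (Lp.coeFn_add f g),
          ae_integrable_of_invariant h ((Lp.memLp f).integrable hp.out),
          ae_integrable_of_invariant h ((Lp.memLp g).integrable hp.out)] with z hz hf hg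
        exact (integral_congr_ae hz).trans (integral_add hf hg)
      map_smul' := fun a f => by
        rw [RingHom.id_apply, ← MemLp.toLp_const_smul, MemLp.toLp_eq_toLp_iff]
        filter_upwards [ae_ae_of_invariant h (Lp.coeFn_smul a f)] with z hz
        exact (integral_congr_ae hz).trans (integral_smul a _) }
    1 fun f => by
      rw [one_mul]
      exact norm_toLp_integral_kernel_le h hp.out f

variable {p : ℝ≥0∞} [hp : Fact (1 ≤ p)]

theorem norm_kernelLp_apply_le (h : η.Invariant μ) (f : Lp E p μ) :
    ‖kernelLp h p f‖ ≤ ‖f‖ :=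
  norm_toLp_integral_kernel_le h hp.out f

theorem kernelLp_toLp (h : η.Invariant μ) {f : Ω → E} (hf : MemLp f p μ) :
    kernelLp h p (hf.toLp f) = (memLp_integral_kernel h hp.out hf).toLp _ := by
  refine MemLp.toLp_congr (memLp_integral_kernel h hp.out (Lp.memLp _)) _ ?_
  filter_upwards [ae_ae_of_invariant h hf.coeFn_toLp] with z hz
  exact integral_congr_ae hz

end Kernel

section ContractionSemigroup

variable {E : Type*} [NormedAddCommGroup E] [NormedSpace ℝ E] {T : ℝ≥0 → E →L[ℝ] E} {x y : E}

/-- A one-parameter semigroup of contractions. Strong continuity is not part of the definition; it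
is assumed vector by vector, as continuity of the orbit `t ↦ T t x`. -/
structure IsContractionSemigroup (T : ℝ≥0 → E →L[ℝ] E) : Prop where
  zero_apply : ∀ x, T 0 x = x
  add_apply : ∀ s t x, T (s + t) x = T s (T t x)
  norm_apply_le : ∀ t x, ‖T t x‖ ≤ ‖x‖

/-- `x` lies in the domain of the infinitesimal generator of `T`, which maps it to `y`. -/
def HasGenerator (T : ℝ≥0 → E →L[ℝ] E) (x y : E) : Prop :=
  Tendsto (fun t : ℝ≥0 => (t : ℝ)⁻¹ • (T t x - x)) (𝓝[>] 0) (𝓝 y)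

theorem tendsto_toNNReal_sub_nhdsGT (s : ℝ) :
    Tendsto (fun r => (r - s).toNNReal) (𝓝[>] s) (𝓝[>] 0) := by
  refine tendsto_nhdsWithin_iff.2 ⟨?_, ?_⟩
  · have : Tendsto (fun r => (r - s).toNNReal) (𝓝 s) (𝓝 (s - s).toNNReal) :=
      (continuous_real_toNNReal.comp (continuous_id.sub continuous_const)).tendsto s
    rw [sub_self, Real.toNNReal_zero] at this
    exact this.mono_left nhdsWithin_le_nhds
  · filter_upwards [self_mem_nhdsWithin] with r hr
    exact Real.toNNReal_pos.2 (sub_pos.2 hr)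

namespace HasGenerator

theorem unique (h : HasGenerator T x y) {y' : E} (h' : HasGenerator T x y') : y = y' :=
  tendsto_nhds_unique h h'

theorem add (h : HasGenerator T x y) {x' y' : E} (h' : HasGenerator T x' y') :
    HasGenerator T (x + x') (y + y') :=
  (Tendsto.add h h').congr fun t => by
    rw [map_add, ← smul_add]
    abel_nf

theorem const_smul (h : HasGenerator T x y) (a : ℝ) : HasGenerator T (a • x) (a • y) :=
  (Tendsto.const_smul h a).congr fun t => by
    rw [map_smul, ← smul_sub, smul_comm]

theorem map {F : Type*} [NormedAddCommGroup F] [NormedSpace ℝ F] {S : ℝ≥0 → F →L[ℝ] F}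
    (h : HasGenerator T x y) (A : E →L[ℝ] F) (hA : ∀ t, A (T t x) = S t (A x)) :
    HasGenerator S (A x) (A y) :=
  ((A.continuous.tendsto y).comp h).congr fun t => by
    simp only [Function.comp_apply, map_smul, map_sub, hA]

end HasGenerator

namespace IsContractionSemigroup

theorem commute_apply (hT : IsContractionSemigroup T) (s t : ℝ≥0) (x : E) :
    T s (T t x) = T t (T s x) := by
  rw [← hT.add_apply, ← hT.add_apply, add_comm]

theorem hasGenerator_apply (hT : IsContractionSemigroup T) (h : HasGenerator T x y) (t : ℝ≥0) :
    HasGenerator T (T t x) (T t y) :=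
  h.map (T t) fun s => hT.commute_apply t s x

theorem norm_apply_sub_apply_le_of_le (hT : IsContractionSemigroup T) {s t : ℝ≥0} (hst : s ≤ t) :
    ‖T s x - T t x‖ ≤ ‖T (t - s) x - x‖ := by
  calc ‖T s x - T t x‖ = ‖T s (x - T (t - s) x)‖ := by
        rw [map_sub, ← hT.add_apply, add_tsub_cancel_of_le hst]
    _ ≤ ‖x - T (t - s) x‖ := hT.norm_apply_le _ _
    _ = ‖T (t - s) x - x‖ := norm_sub_rev _ _

theorem norm_apply_sub_apply_le (hT : IsContractionSemigroup T) (s t : ℝ≥0) :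
    ‖T s x - T t x‖ ≤ ‖T (nndist s t) x - x‖ := by
  rcases le_total s t with hst | hst
  · rw [nndist_comm, NNReal.nndist_eq, tsub_eq_zero_of_le hst, max_eq_left zero_le]
    exact hT.norm_apply_sub_apply_le_of_le hst
  · rw [norm_sub_rev, NNReal.nndist_eq, tsub_eq_zero_of_le hst, max_eq_left zero_le]
    exact hT.norm_apply_sub_apply_le_of_le hst

theorem continuous_orbit_of_tendsto (hT : IsContractionSemigroup T)
    (hx : Tendsto (fun t => T t x) (𝓝[>] 0) (𝓝 x)) : Continuous fun t => T t x := by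
  have at_zero : Tendsto (fun t => T t x) (𝓝 0) (𝓝 x) := by
    have : ContinuousWithinAt (fun t => T t x) (Set.Ioi 0) 0 := by
      rwa [ContinuousWithinAt, hT.zero_apply]
    rwa [continuousWithinAt_Ioi_iff_Ici, ← bot_eq_zero, Set.Ici_bot, continuousWithinAt_univ,
      ContinuousAt, bot_eq_zero, hT.zero_apply] at this
  refine continuous_iff_continuousAt.2 fun t => tendsto_iff_norm_sub_tendsto_zero.2 ?_
  have dist_to_t : Tendsto (fun s => nndist s t) (𝓝 t) (𝓝 0) :=
    (continuous_id.nndist continuous_const).tendsto' t 0 (nndist_self t)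
  exact squeeze_zero (fun _ => norm_nonneg _) (fun s => hT.norm_apply_sub_apply_le s t)
    ((tendsto_iff_norm_sub_tendsto_zero.1 at_zero).comp dist_to_t)

theorem continuous_orbit (hT : IsContractionSemigroup T) (h : HasGenerator T x y) :
    Continuous fun t => T t x := by
  refine hT.continuous_orbit_of_tendsto ?_
  have time : Tendsto (fun t : ℝ≥0 => (t : ℝ)) (𝓝[>] 0) (𝓝 0) :=
    (NNReal.continuous_coe.tendsto' 0 0 NNReal.coe_zero).mono_left nhdsWithin_le_nhds
  have limit := (time.smul h).add_const x
  rw [zero_smul, zero_add] at limit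
  refine limit.congr' ?_
  filter_upwards [self_mem_nhdsWithin] with t ht
  rw [smul_inv_smul₀ (NNReal.coe_ne_zero.2 (ne_of_gt ht)), sub_add_cancel]

theorem tendsto_apply {ι : Type*} {l : Filter ι} {r : ι → ℝ≥0} {r₀ : ℝ≥0} {q : ι → E}
    (hT : IsContractionSemigroup T) (hx : Continuous fun t => T t x)
    (hr : Tendsto r l (𝓝 r₀)) (hq : Tendsto q l (𝓝 x)) :
    Tendsto (fun i => T (r i) (q i)) l (𝓝 (T r₀ x)) := by
  have perturbation : Tendsto (fun i => T (r i) (q i - x)) l (𝓝 0) :=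
    squeeze_zero_norm (fun i => hT.norm_apply_le _ _) (tendsto_iff_norm_sub_tendsto_zero.1 hq)
  simpa using perturbation.add ((hx.tendsto r₀).comp hr)

theorem hasDerivWithinAt_orbit (hT : IsContractionSemigroup T) (h : HasGenerator T x y) {s : ℝ}
    (hs : 0 ≤ s) :
    HasDerivWithinAt (fun r : ℝ => T r.toNNReal x) (T s.toNNReal y) (Set.Ici s) s := by
  rw [← hasDerivWithinAt_Ioi_iff_Ici, hasDerivWithinAt_iff_tendsto_slope' Set.self_notMem_Ioi]
  refine ((hT.hasGenerator_apply h s.toNNReal).comp (tendsto_toNNReal_sub_nhdsGT s)).congr' ?_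
  filter_upwards [self_mem_nhdsWithin] with r hr
  rw [Function.comp_apply, slope_def_module, ← hT.add_apply,
    ← Real.toNNReal_add (sub_pos.2 hr).le hs, sub_add_cancel,
    Real.coe_toNNReal _ (sub_pos.2 hr).le]

theorem norm_apply_sub_self_le (hT : IsContractionSemigroup T) (h : HasGenerator T x y)
    (t : ℝ≥0) : ‖T t x - x‖ ≤ t * ‖y‖ := by
  have := norm_image_sub_le_of_norm_deriv_right_le_segment (a := 0) (b := t) (C := ‖y‖)
    ((hT.continuous_orbit h).comp continuous_real_toNNReal).continuousOn
    (fun s hs => hT.hasDerivWithinAt_orbit h hs.1) (fun s _ => hT.norm_apply_le _ _) t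
    (Set.right_mem_Icc.2 t.2)
  simpa [hT.zero_apply, mul_comm] using this

theorem hasDerivWithinAt_duhamel (hT : IsContractionSemigroup T) {q : ℝ → E} {q' a : E}
    {s t : ℝ} (hst : s < t) (hq : HasDerivWithinAt q q' (Set.Ici s) s)
    (ha : HasGenerator T (q s) a) (hcont : Continuous fun r => T r (q' - a)) :
    HasDerivWithinAt (fun r => T (t - r).toNNReal (q r)) (T (t - s).toNNReal (q' - a))
      (Set.Ici s) s := by
  rw [← hasDerivWithinAt_Ioi_iff_Ici,
    hasDerivWithinAt_iff_tendsto_slope' Set.self_notMem_Ioi] at hq ⊢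
  have time : Tendsto (fun r => (t - r).toNNReal) (𝓝[>] s) (𝓝 (t - s).toNNReal) :=
    ((continuous_real_toNNReal.comp (continuous_const.sub continuous_id)).tendsto s).mono_left
      nhdsWithin_le_nhds
  refine (hT.tendsto_apply hcont time
    (hq.sub (ha.comp (tendsto_toNNReal_sub_nhdsGT s)))).congr' ?_
  filter_upwards [Ioo_mem_nhdsGT hst] with r ⟨hsr, hrt⟩
  have split_time : (t - s).toNNReal = (t - r).toNNReal + (r - s).toNNReal := by
    rw [← Real.toNNReal_add (sub_pos.2 hrt).le (sub_pos.2 hsr).le, sub_add_sub_cancel]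
  rw [Function.comp_apply, slope_def_module, slope_def_module, split_time, hT.add_apply,
    Real.coe_toNNReal _ (sub_pos.2 hsr).le, ← smul_sub, sub_sub_sub_cancel_right, map_smul,
    map_sub]

end IsContractionSemigroup

end ContractionSemigroup

section SeminormBounded

variable {V F : Type*} [AddCommGroup V] [Module ℝ V] [NormedAddCommGroup F] [NormedSpace ℝ F]
  {B : V →ₗ[ℝ] V →ₗ[ℝ] F} {N : Seminorm ℝ V}

theorem tendsto_bilin_of_seminorm {ι : Type*} {l : Filter ι} {u v : ι → V} {u₀ v₀ : V}
    (hB : ∀ u v, ‖B u v‖ ≤ N u * N v) (hu : Tendsto (fun i => N (u i - u₀)) l (𝓝 0))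
    (hv : Tendsto (fun i => N (v i - v₀)) l (𝓝 0)) :
    Tendsto (fun i => B (u i) (v i)) l (𝓝 (B u₀ v₀)) := by
  rw [tendsto_iff_norm_sub_tendsto_zero]
  have decompose : ∀ i, B (u i) (v i) - B u₀ v₀ =
      B (u i - u₀) (v i - v₀) + (B (u i - u₀) v₀ + B u₀ (v i - v₀)) := fun i => by
    simp only [map_sub, LinearMap.sub_apply]
    abel
  refine squeeze_zero (fun _ => norm_nonneg _)
    (g := fun i => N (u i - u₀) * N (v i - v₀) + (N (u i - u₀) * N v₀ + N u₀ * N (v i - v₀)))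
    (fun i => ?_) ?_
  · rw [decompose]
    exact norm_add_le_of_le (hB _ _) (norm_add_le_of_le (hB _ _) (hB _ _))
  · simpa using (hu.mul hv).add ((hu.mul_const (N v₀)).add (hv.const_mul (N u₀)))

theorem hasDerivWithinAt_bilin_of_seminorm {u v : ℝ → V} {u' v' : V} {s : ℝ}
    (hB : ∀ u v, ‖B u v‖ ≤ N u * N v)
    (hu : Tendsto (fun r => N (slope u s r - u')) (𝓝[>] s) (𝓝 0))
    (hv : Tendsto (fun r => N (slope v s r - v')) (𝓝[>] s) (𝓝 0))
    (hv₀ : Tendsto (fun r => N (v r - v s)) (𝓝[>] s) (𝓝 0)) :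
    HasDerivWithinAt (fun r => B (u r) (v r)) (B u' (v s) + B (u s) v') (Set.Ici s) s := by
  rw [← hasDerivWithinAt_Ioi_iff_Ici, hasDerivWithinAt_iff_tendsto_slope' Set.self_notMem_Ioi]
  refine ((tendsto_bilin_of_seminorm hB hu hv₀).add
    (tendsto_bilin_of_seminorm (u := fun _ => u s) hB (by simp) hv)).congr fun r => ?_
  simp only [slope_def_module, map_smul, LinearMap.smul_apply, map_sub, LinearMap.sub_apply,
    ← smul_add]
  abel_nf

end SeminormBounded

section Increment

variable {Ω E : Type*} [MeasurableSpace Ω] {μ : Measure Ω} [IsFiniteMeasure μ] {η : Kernel Ω Ω}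
  [IsMarkovKernel η]

/-- The increment `(z, y) ↦ f y - f z` along one step `(z, y) ∼ μ ⊗ₘ η` of a Markov chain with
invariant measure `μ`, as an operator from `L_p(μ)` to `L_p` of the joint law. -/
noncomputable def incrementLp [NormedAddCommGroup E] [NormedSpace ℝ E] (h : η.Invariant μ)
    (p : ℝ≥0∞) [Fact (1 ≤ p)] : Lp E p μ →L[ℝ] Lp E p (μ ⊗ₘ η) :=
  (Lp.compMeasurePreservingₗᵢ ℝ Prod.snd
      (measurePreserving_snd_compProd h)).toContinuousLinearMap -
    (Lp.compMeasurePreservingₗᵢ ℝ Prod.fst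
      measurePreserving_fst_compProd).toContinuousLinearMap

theorem coeFn_incrementLp_toLp [NormedAddCommGroup E] [NormedSpace ℝ E] (h : η.Invariant μ)
    {p : ℝ≥0∞} [Fact (1 ≤ p)] {f : Ω → E} (hf : MemLp f p μ) :
    incrementLp h p (hf.toLp f) =ᵐ[μ ⊗ₘ η] fun x => f x.2 - f x.1 := by
  have hsnd := measurePreserving_snd_compProd h
  have hfst := measurePreserving_fst_compProd (μ := μ) (η := η)
  refine (Lp.coeFn_sub (Lp.compMeasurePreserving Prod.snd hsnd (hf.toLp f))
    (Lp.compMeasurePreserving Prod.fst hfst (hf.toLp f))).trans ?_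
  rw [Lp.toLp_compMeasurePreserving hf hsnd, Lp.toLp_compMeasurePreserving hf hfst]
  exact (hf.comp_measurePreserving hsnd).coeFn_toLp.sub
    (hf.comp_measurePreserving hfst).coeFn_toLp

variable [NormedAddCommGroup E] [InnerProductSpace ℝ E] [CompleteSpace E]

theorem inner_compMeasurePreserving_fst_snd (h : η.Invariant μ) (f g : Lp E 2 μ) :
    inner ℝ (Lp.compMeasurePreserving Prod.fst measurePreserving_fst_compProd f)
      (Lp.compMeasurePreserving Prod.snd (measurePreserving_snd_compProd h) g) =
        inner ℝ f (kernelLp h 2 g) := by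
  have hsnd := measurePreserving_snd_compProd h
  have hfst := measurePreserving_fst_compProd (μ := μ) (η := η)
  have pointwise : (fun x => inner ℝ (Lp.compMeasurePreserving Prod.fst hfst f x)
      (Lp.compMeasurePreserving Prod.snd hsnd g x)) =ᵐ[μ ⊗ₘ η]
        fun x => inner ℝ (f x.1) (g x.2) := by
    filter_upwards [Lp.coeFn_compMeasurePreserving f hfst,
      Lp.coeFn_compMeasurePreserving g hsnd] with x hf hg
    rw [hf, hg, Function.comp_apply, Function.comp_apply]
  calc _ = ∫ x, inner ℝ (f x.1) (g x.2) ∂(μ ⊗ₘ η) := integral_congr_ae pointwise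
    _ = ∫ z, ∫ y, inner ℝ (f z) (g y) ∂η z ∂μ :=
        Measure.integral_compProd ((L2.integrable_inner _ _).congr pointwise)
    _ = inner ℝ f (kernelLp h 2 g) := by
        refine integral_congr_ae ?_
        filter_upwards [ae_integrable_of_invariant h ((Lp.memLp g).integrable one_le_two),
          (memLp_integral_kernel h one_le_two (Lp.memLp g)).coeFn_toLp] with z hg hkernel
        exact (integral_inner hg (f z)).trans (congrArg (inner ℝ (f z)) hkernel.symm)

theorem norm_incrementLp_sq (h : η.Invariant μ) (f : Lp E 2 μ) :
    ‖incrementLp h 2 f‖ ^ 2 = 2 * inner ℝ f (f - kernelLp h 2 f) := by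
  calc ‖incrementLp h 2 f‖ ^ 2
      = ‖Lp.compMeasurePreserving Prod.fst measurePreserving_fst_compProd f -
          Lp.compMeasurePreserving Prod.snd (measurePreserving_snd_compProd h) f‖ ^ 2 :=
        congrArg (· ^ 2) (norm_sub_rev _ _)
    _ = ‖f‖ ^ 2 - 2 * inner ℝ f (kernelLp h 2 f) + ‖f‖ ^ 2 := by
        rw [norm_sub_sq_real, inner_compMeasurePreserving_fst_snd,
          Lp.norm_compMeasurePreserving, Lp.norm_compMeasurePreserving]
    _ = 2 * inner ℝ f (f - kernelLp h 2 f) := by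
        rw [inner_sub_right, real_inner_self_eq_norm_sq]
        ring

theorem norm_incrementLp_sq_le (h : η.Invariant μ) (f : Lp E 2 μ) :
    ‖incrementLp h 2 f‖ ^ 2 ≤ 2 * (‖f‖ * ‖kernelLp h 2 f - f‖) := by
  rw [norm_incrementLp_sq, norm_sub_rev]
  exact mul_le_mul_of_nonneg_left (real_inner_le_norm _ _) zero_le_two

end Increment

section LpSemigroup

variable {Ω E : Type*} [MeasurableSpace Ω] [NormedAddCommGroup E] [NormedSpace ℝ E]
  {κ : ℝ≥0 → Kernel Ω Ω} {μ : Measure Ω} [IsFiniteMeasure μ]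

/-- The transition operators of a Markov semigroup with invariant measure `μ`, on `L_p(μ)`. -/
noncomputable def lpSemigroup (hκ : IsMarkovSemigroup κ) (hμ : ∀ t, (κ t).Invariant μ) (p : ℝ≥0∞)
    [Fact (1 ≤ p)] (t : ℝ≥0) : Lp E p μ →L[ℝ] Lp E p μ :=
  haveI := hκ.markov t
  kernelLp (hμ t) p

theorem isContractionSemigroup_lpSemigroup [CompleteSpace E] (hκ : IsMarkovSemigroup κ)
    (hμ : ∀ t, (κ t).Invariant μ) (p : ℝ≥0∞) [hp : Fact (1 ≤ p)] :
    IsContractionSemigroup (lpSemigroup (E := E) hκ hμ p) where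
  zero_apply f := by
    have := hκ.markov 0
    refine Lp.ext ((memLp_integral_kernel (hμ 0) hp.out (Lp.memLp f)).coeFn_toLp.trans
      (ae_of_all _ fun z => ?_))
    simp only [hκ.zero, Kernel.id_apply]
    exact integral_dirac' _ z (Lp.stronglyMeasurable f)
  add_apply s t f := by
    have := hκ.markov s
    have := hκ.markov t
    have := hκ.markov (s + t)
    refine MemLp.toLp_congr (memLp_integral_kernel (hμ (s + t)) hp.out (Lp.memLp f))
      (memLp_integral_kernel (hμ s) hp.out (Lp.memLp _)) ?_
    filter_upwards [ae_integrable_of_invariant (hμ (s + t)) ((Lp.memLp f).integrable hp.out),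
      ae_ae_of_invariant (hμ s)
        (memLp_integral_kernel (hμ t) hp.out (Lp.memLp f)).coeFn_toLp] with z integrable hz
    rw [hκ.add]
    rw [hκ.add] at integrable
    exact (Kernel.integral_comp integrable).trans (integral_congr_ae hz).symm
  norm_apply_le t f := by
    have := hκ.markov t
    exact norm_kernelLp_apply_le (hμ t) f

end LpSemigroup

variable {Ω : Type*} [MeasurableSpace Ω] {κ : ℝ≥0 → Kernel Ω Ω} {μ : Measure Ω}
  {𝒜 : StarSubalgebra ℂ (Ω → ℂ)}

section Product

variable {α : Type*} [MeasurableSpace α] {ν : Measure α}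

/-- The product `L₂(ν) × L₂(ν) → L₁(ν)`. -/
noncomputable def mulLp (ν : Measure α) : Lp ℂ 2 ν →L[ℝ] Lp ℂ 2 ν →L[ℝ] Lp ℂ 1 ν :=
  (ContinuousLinearMap.mul ℝ ℂ).holderL ν 2 2 1

theorem norm_mulLp_le (f g : Lp ℂ 2 ν) : ‖mulLp ν f g‖ ≤ ‖f‖ * ‖g‖ := by
  have holder := (ContinuousLinearMap.mul ℝ ℂ).norm_holder_apply_apply_le f g (r := 1)
  rwa [ContinuousLinearMap.opNorm_mul, one_mul] at holder

theorem coeFn_mulLp (f g : Lp ℂ 2 ν) : mulLp ν f g =ᵐ[ν] fun z => f z * g z :=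
  (ContinuousLinearMap.mul ℝ ℂ).coeFn_holder f g

end Product

/-- A reversible Markov semigroup together with an algebra of suitable functions. -/
structure ReversibleAlgebra (κ : ℝ≥0 → Kernel Ω Ω) (μ : Measure Ω)
    (𝒜 : StarSubalgebra ℂ (Ω → ℂ)) : Prop where
  markovSemigroup : IsMarkovSemigroup κ
  reversible : IsReversible κ μ
  suitable : IsSuitableAlgebra κ μ 𝒜

namespace ReversibleAlgebra

section Basic

theorem measurable (h : ReversibleAlgebra κ μ 𝒜) (u : 𝒜) : Measurable (u : Ω → ℂ) :=
  h.suitable.measurable u u.2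

theorem isMarkovKernel (h : ReversibleAlgebra κ μ 𝒜) (t : ℝ≥0) : IsMarkovKernel (κ t) :=
  h.markovSemigroup.markov t

theorem isReversible [IsFiniteMeasure μ] (h : ReversibleAlgebra κ μ 𝒜) (t : ℝ≥0) :
    (κ t).IsReversible μ :=
  haveI := h.isMarkovKernel t
  h.reversible.kernel_isReversible t

theorem invariant [IsFiniteMeasure μ] (h : ReversibleAlgebra κ μ 𝒜) (t : ℝ≥0) :
    (κ t).Invariant μ :=
  haveI := h.isMarkovKernel t
  (h.isReversible t).invariant

/-- The transition operator `P_t` as a self-map of the algebra of suitable functions. It is linear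
only up to `μ`-null sets. -/
noncomputable def evolve (h : ReversibleAlgebra κ μ 𝒜) (t : ℝ≥0) (u : 𝒜) : 𝒜 :=
  ⟨semigroup κ t u, h.suitable.semigroup_mem u u.2 t⟩

/-- The generator `𝓛` as a self-map of the algebra of suitable functions. It is linear only up to
`μ`-null sets. -/
noncomputable def gen (h : ReversibleAlgebra κ μ 𝒜) (u : 𝒜) : 𝒜 :=
  ⟨generator κ u, h.suitable.generator_mem u u.2⟩

theorem evolve_zero (h : ReversibleAlgebra κ μ 𝒜) (u : 𝒜) : h.evolve 0 u = u := by
  refine Subtype.ext (funext fun z => ?_)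
  simp only [evolve, semigroup, h.markovSemigroup.zero, Kernel.id_apply]
  exact integral_dirac' _ z (h.measurable u).stronglyMeasurable

end Basic

variable [IsProbabilityMeasure μ]

theorem memLp (h : ReversibleAlgebra κ μ 𝒜) {p : ℝ≥0∞} (hp : p ≤ 2) (u : 𝒜) :
    MemLp (u : Ω → ℂ) p μ :=
  (h.suitable.memLp u u.2).mono_exponent hp

theorem integrable (h : ReversibleAlgebra κ μ 𝒜) (u : 𝒜) : Integrable (u : Ω → ℂ) μ :=
  memLp_one_iff_integrable.1 (h.memLp one_le_two u)

section Lp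

variable {p : ℝ≥0∞}

/-- The class in `L_p(μ)`, `p ≤ 2`, of a suitable function. -/
noncomputable def toLp (h : ReversibleAlgebra κ μ 𝒜) (hp : p ≤ 2) : 𝒜 →ₗ[ℝ] Lp ℂ p μ where
  toFun u := (h.memLp hp u).toLp u
  map_add' u v := (h.memLp hp u).toLp_add (h.memLp hp v)
  map_smul' a u := (h.memLp hp u).toLp_const_smul a

theorem coeFn_toLp (h : ReversibleAlgebra κ μ 𝒜) (hp : p ≤ 2) (u : 𝒜) :
    h.toLp hp u =ᵐ[μ] (u : Ω → ℂ) :=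
  (h.memLp hp u).coeFn_toLp

variable [Fact (1 ≤ p)]

theorem toLp_evolve (h : ReversibleAlgebra κ μ 𝒜) (hp : p ≤ 2) (t : ℝ≥0) (u : 𝒜) :
    h.toLp hp (h.evolve t u) =
      lpSemigroup h.markovSemigroup h.invariant p t (h.toLp hp u) :=
  haveI := h.isMarkovKernel t
  (kernelLp_toLp (h.invariant t) (h.memLp hp u)).symm

theorem hasGenerator_toLp (h : ReversibleAlgebra κ μ 𝒜) (hp : p ≤ 2) (u : 𝒜) :
    HasGenerator (lpSemigroup h.markovSemigroup h.invariant p) (h.toLp hp u)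
      (h.toLp hp (h.gen u)) := by
  have quotient_eq : ∀ t : ℝ≥0, (t : ℝ)⁻¹ • (lpSemigroup h.markovSemigroup h.invariant p t
      (h.toLp hp u) - h.toLp hp u) = h.toLp hp ((t : ℝ)⁻¹ • (h.evolve t u - u)) := fun t => by
    rw [← toLp_evolve, map_smul, map_sub]
  simp only [HasGenerator, quotient_eq]
  refine (Lp.tendsto_Lp_iff_tendsto_eLpNorm'' _ (fun t => h.memLp hp _) _ (h.memLp hp _)).2 ?_
  refine tendsto_of_tendsto_of_tendsto_of_le_of_le tendsto_const_nhds
    (h.suitable.tendsto_L2 u u.2) (fun _ => zero_le) fun t => ?_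
  refine (eLpNorm_le_eLpNorm_of_exponent_le hp
    (h.measurable (_ - h.gen u)).aestronglyMeasurable).trans_eq ?_
  congr 1
  funext z
  simp [diffQuot, evolve, gen, div_eq_inv_mul]

/-- The generator as a linear map from the algebra of suitable functions to `L_p(μ)`, `p ≤ 2`. -/
noncomputable def genLp (h : ReversibleAlgebra κ μ 𝒜) (hp : p ≤ 2) : 𝒜 →ₗ[ℝ] Lp ℂ p μ where
  toFun u := h.toLp hp (h.gen u)
  map_add' u v := (h.hasGenerator_toLp hp (u + v)).unique <| by
    rw [map_add]
    exact (h.hasGenerator_toLp hp u).add (h.hasGenerator_toLp hp v)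
  map_smul' a u := (h.hasGenerator_toLp hp (a • u)).unique <| by
    rw [map_smul]
    exact (h.hasGenerator_toLp hp u).const_smul a

theorem toLp_gen (h : ReversibleAlgebra κ μ 𝒜) (hp : p ≤ 2) (u : 𝒜) :
    h.toLp hp (h.gen u) = h.genLp hp u :=
  rfl

theorem isContractionSemigroup (h : ReversibleAlgebra κ μ 𝒜) (p : ℝ≥0∞) [Fact (1 ≤ p)] :
    IsContractionSemigroup (lpSemigroup (E := ℂ) h.markovSemigroup h.invariant p) :=
  isContractionSemigroup_lpSemigroup _ _ p

theorem genLp_evolve (h : ReversibleAlgebra κ μ 𝒜) (hp : p ≤ 2) (t : ℝ≥0) (u : 𝒜) :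
    h.genLp hp (h.evolve t u) =
      lpSemigroup h.markovSemigroup h.invariant p t (h.genLp hp u) :=
  (h.hasGenerator_toLp hp (h.evolve t u)).unique <| by
    rw [toLp_evolve]
    exact (h.isContractionSemigroup p).hasGenerator_apply (h.hasGenerator_toLp hp u) t

theorem continuous_lpSemigroup_toLp (h : ReversibleAlgebra κ μ 𝒜) (hp : p ≤ 2) (u : 𝒜) :
    Continuous fun t => lpSemigroup h.markovSemigroup h.invariant p t (h.toLp hp u) :=
  (h.isContractionSemigroup p).continuous_orbit (h.hasGenerator_toLp hp u)

end Lp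

section Carre

theorem toLp_mul (h : ReversibleAlgebra κ μ 𝒜) (u v : 𝒜) :
    h.toLp one_le_two (u * v) = mulLp μ (h.toLp le_rfl u) (h.toLp le_rfl v) := by
  refine Lp.ext ?_
  filter_upwards [h.coeFn_toLp one_le_two (u * v), coeFn_mulLp (h.toLp le_rfl u) (h.toLp le_rfl v),
    h.coeFn_toLp le_rfl u, h.coeFn_toLp le_rfl v] with z huv hmul hu hv
  rw [huv, hmul, hu, hv]
  rfl

/-- The carré du champ `Γ(u, v)` of scalar suitable functions. -/
noncomputable def gamma (h : ReversibleAlgebra κ μ 𝒜) (u v : 𝒜) : 𝒜 :=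
  (1 / 2 : ℝ) • (h.gen (u * v) - u * h.gen v - h.gen u * v)

/-- The carré du champ as a bilinear map into `L₁(μ)`. -/
noncomputable def gammaLp (h : ReversibleAlgebra κ μ 𝒜) : 𝒜 →ₗ[ℝ] 𝒜 →ₗ[ℝ] Lp ℂ 1 μ :=
  (1 / 2 : ℝ) • ((LinearMap.mul ℝ 𝒜).compr₂ (h.genLp one_le_two) -
    (mulLp μ).toLinearMap₁₂.compl₁₂ (h.toLp le_rfl) (h.genLp le_rfl) -
    (mulLp μ).toLinearMap₁₂.compl₁₂ (h.genLp le_rfl) (h.toLp le_rfl))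

theorem toLp_gamma (h : ReversibleAlgebra κ μ 𝒜) (u v : 𝒜) :
    h.toLp one_le_two (h.gamma u v) = h.gammaLp u v := by
  simp only [gamma, map_smul, map_sub, toLp_mul, toLp_gen]
  rfl

/-- The iterated carré du champ `Γ₂(u, v)` of scalar suitable functions. -/
noncomputable def gamma₂ (h : ReversibleAlgebra κ μ 𝒜) (u v : 𝒜) : 𝒜 :=
  (1 / 2 : ℝ) • (h.gen (h.gamma u v) - h.gamma u (h.gen v) - h.gamma (h.gen u) v)

theorem toLp_gamma₂ (h : ReversibleAlgebra κ μ 𝒜) (u v : 𝒜) :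
    h.toLp one_le_two (h.gamma₂ u v) = (1 / 2 : ℝ) • (h.genLp one_le_two (h.gamma u v) -
      h.gammaLp u (h.gen v) - h.gammaLp (h.gen u) v) := by
  simp only [gamma₂, map_smul, map_sub, toLp_gamma, toLp_gen]

end Carre

end ReversibleAlgebra

namespace ReversibleAlgebra

variable {Ω : Type*} [MeasurableSpace Ω] {κ : ℝ≥0 → Kernel Ω Ω} {μ : Measure Ω}
  [IsProbabilityMeasure μ] {𝒜 : StarSubalgebra ℂ (Ω → ℂ)}

section Increment

/-- The conditional expectation of `(u(Z_t) - u(Z_0)) (v(Z_t) - v(Z_0))` given `Z_0`, written with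
the transition operators. -/
noncomputable def condIncrement (h : ReversibleAlgebra κ μ 𝒜) (t : ℝ≥0) (u v : 𝒜) : 𝒜 :=
  (h.evolve t (u * v) - u * v) - u * (h.evolve t v - v) - (h.evolve t u - u) * v

theorem condIncrement_ae_eq (h : ReversibleAlgebra κ μ 𝒜) (t : ℝ≥0) (u v : 𝒜) :
    (h.condIncrement t u v : Ω → ℂ) =ᵐ[μ] fun z =>
      ∫ y, ((u : Ω → ℂ) y - (u : Ω → ℂ) z) * ((v : Ω → ℂ) y - (v : Ω → ℂ) z) ∂κ t z := by
  have := h.isMarkovKernel t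
  filter_upwards [ae_integrable_of_invariant (h.invariant t) (h.integrable u),
    ae_integrable_of_invariant (h.invariant t) (h.integrable v),
    ae_integrable_of_invariant (h.invariant t) (h.integrable (u * v))] with z hu hv huv
  symm
  calc ∫ y, ((u : Ω → ℂ) y - (u : Ω → ℂ) z) * ((v : Ω → ℂ) y - (v : Ω → ℂ) z) ∂κ t z
      = ∫ y, ((((u * v : 𝒜) : Ω → ℂ) y - (u : Ω → ℂ) z * (v : Ω → ℂ) y) -
          (u : Ω → ℂ) y * (v : Ω → ℂ) z + (u : Ω → ℂ) z * (v : Ω → ℂ) z) ∂κ t z := by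
        refine integral_congr_ae (ae_of_all _ fun y => ?_)
        simp only [MulMemClass.coe_mul, Pi.mul_apply]
        ring
    _ = (h.condIncrement t u v : Ω → ℂ) z := by
        rw [integral_add ((huv.sub' (hv.const_mul _)).sub' (hu.mul_const _)) (integrable_const _),
          integral_sub (huv.sub' (hv.const_mul _)) (hu.mul_const _),
          integral_sub huv (hv.const_mul _), integral_const_mul, integral_mul_const]
        simp only [condIncrement, evolve, semigroup, AddSubgroupClass.coe_sub, MulMemClass.coe_mul,
          Pi.sub_apply, Pi.mul_apply, integral_const, probReal_univ, one_smul]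
        ring

theorem memLp_increment (h : ReversibleAlgebra κ μ 𝒜) (t : ℝ≥0) (u : 𝒜) :
    MemLp (fun p : Ω × Ω => (u : Ω → ℂ) p.2 - (u : Ω → ℂ) p.1) 2 (μ ⊗ₘ κ t) :=
  haveI := h.isMarkovKernel t
  ((h.memLp le_rfl u).comp_measurePreserving (measurePreserving_snd_compProd (h.invariant t))).sub
    ((h.memLp le_rfl u).comp_measurePreserving measurePreserving_fst_compProd)

theorem norm_toLp_condIncrement_le (h : ReversibleAlgebra κ μ 𝒜) (t : ℝ≥0) (u v : 𝒜) :
    haveI := h.isMarkovKernel t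
    ‖h.toLp one_le_two (h.condIncrement t u v)‖ ≤
      ‖incrementLp (h.invariant t) 2 (h.toLp le_rfl u)‖ *
        ‖incrementLp (h.invariant t) 2 (h.toLp le_rfl v)‖ := by
  have := h.isMarkovKernel t
  have integrable : Integrable (fun p : Ω × Ω => ((u : Ω → ℂ) p.2 - (u : Ω → ℂ) p.1) *
      ((v : Ω → ℂ) p.2 - (v : Ω → ℂ) p.1)) (μ ⊗ₘ κ t) :=
    (h.memLp_increment t u).integrable_mul (h.memLp_increment t v)
  calc ‖h.toLp one_le_two (h.condIncrement t u v)‖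
      = ∫ z, ‖(h.condIncrement t u v : Ω → ℂ) z‖ ∂μ := by
        rw [L1.norm_eq_integral_norm]
        exact integral_congr_ae ((h.coeFn_toLp one_le_two _).fun_comp norm)
    _ ≤ ∫ z, ∫ y, ‖((u : Ω → ℂ) y - (u : Ω → ℂ) z) * ((v : Ω → ℂ) y - (v : Ω → ℂ) z)‖
          ∂κ t z ∂μ := by
        refine integral_mono_ae (h.integrable _).norm integrable.norm.integral_compProd ?_
        filter_upwards [h.condIncrement_ae_eq t u v] with z hz
        rw [hz]
        exact norm_integral_le_integral_norm _
    _ = ∫ p, ‖((u : Ω → ℂ) p.2 - (u : Ω → ℂ) p.1) * ((v : Ω → ℂ) p.2 - (v : Ω → ℂ) p.1)‖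
          ∂(μ ⊗ₘ κ t) := (Measure.integral_compProd integrable.norm).symm
    _ = ‖mulLp _ (incrementLp (h.invariant t) 2 (h.toLp le_rfl u))
          (incrementLp (h.invariant t) 2 (h.toLp le_rfl v))‖ := by
        rw [L1.norm_eq_integral_norm]
        refine integral_congr_ae ?_
        filter_upwards [coeFn_mulLp (incrementLp (h.invariant t) 2 (h.toLp le_rfl u))
          (incrementLp (h.invariant t) 2 (h.toLp le_rfl v)),
          coeFn_incrementLp_toLp (h.invariant t) (h.memLp le_rfl u),
          coeFn_incrementLp_toLp (h.invariant t) (h.memLp le_rfl v)] with p hmul hu hv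
        rw [hmul, ← hu, ← hv]
        rfl
    _ ≤ _ := norm_mulLp_le _ _

theorem toLp_condIncrement (h : ReversibleAlgebra κ μ 𝒜) (t : ℝ≥0) (u v : 𝒜) :
    h.toLp one_le_two (h.condIncrement t u v) =
      (h.toLp one_le_two (h.evolve t (u * v)) - h.toLp one_le_two (u * v)) -
        mulLp μ (h.toLp le_rfl u) (h.toLp le_rfl (h.evolve t v) - h.toLp le_rfl v) -
        mulLp μ (h.toLp le_rfl (h.evolve t u) - h.toLp le_rfl u) (h.toLp le_rfl v) := by
  simp only [condIncrement, map_sub, toLp_mul]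

theorem tendsto_condIncrement (h : ReversibleAlgebra κ μ 𝒜) (u v : 𝒜) :
    Tendsto (fun t : ℝ≥0 => (2 * t : ℝ)⁻¹ • h.toLp one_le_two (h.condIncrement t u v)) (𝓝[>] 0)
      (𝓝 (h.gammaLp u v)) := by
  have mul_right := ((mulLp μ (h.toLp le_rfl u)).continuous.tendsto _).comp
    (h.hasGenerator_toLp le_rfl v)
  have mul_left := (((mulLp μ).flip (h.toLp le_rfl v)).continuous.tendsto _).comp
    (h.hasGenerator_toLp le_rfl u)
  refine ((((h.hasGenerator_toLp one_le_two (u * v)).sub mul_right).sub mul_left).const_smul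
    (1 / 2 : ℝ)).congr fun t => ?_
  simp only [Function.comp_apply, toLp_condIncrement, toLp_evolve, mul_inv, mul_smul, smul_sub,
    map_smul, map_sub, ContinuousLinearMap.flip_apply, sub_apply, one_div]

end Increment

section GraphSeminorm

/-- The graph norm of the generator in `L₂(μ)`, which makes the carré du champ continuous. -/
noncomputable def graphSeminorm (h : ReversibleAlgebra κ μ 𝒜) : Seminorm ℝ 𝒜 :=
  (normSeminorm ℝ (Lp ℂ 2 μ)).comp (h.toLp le_rfl) +
    (normSeminorm ℝ (Lp ℂ 2 μ)).comp (h.genLp le_rfl)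

theorem graphSeminorm_apply (h : ReversibleAlgebra κ μ 𝒜) (u : 𝒜) :
    h.graphSeminorm u = ‖h.toLp le_rfl u‖ + ‖h.genLp le_rfl u‖ :=
  rfl

theorem norm_incrementLp_le_graphSeminorm (h : ReversibleAlgebra κ μ 𝒜) (t : ℝ≥0) (u : 𝒜) :
    haveI := h.isMarkovKernel t
    ‖incrementLp (h.invariant t) 2 (h.toLp le_rfl u)‖ ≤ √(2 * t) * h.graphSeminorm u := by
  have := h.isMarkovKernel t
  refine abs_le_of_sq_le_sq' ?_ (by positivity) |>.2
  calc ‖incrementLp (h.invariant t) 2 (h.toLp le_rfl u)‖ ^ 2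
      ≤ 2 * (‖h.toLp le_rfl u‖ * ‖kernelLp (h.invariant t) 2 (h.toLp le_rfl u) -
          h.toLp le_rfl u‖) := norm_incrementLp_sq_le _ _
    _ ≤ 2 * (‖h.toLp le_rfl u‖ * (t * ‖h.genLp le_rfl u‖)) := by
        gcongr
        exact (h.isContractionSemigroup 2).norm_apply_sub_self_le (h.hasGenerator_toLp le_rfl u) t
    _ = 2 * t * (‖h.toLp le_rfl u‖ * ‖h.genLp le_rfl u‖) := by ring
    _ ≤ 2 * t * h.graphSeminorm u ^ 2 := by
        gcongr
        rw [graphSeminorm_apply, sq]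
        gcongr
        · exact le_add_of_nonneg_right (norm_nonneg _)
        · exact le_add_of_nonneg_left (norm_nonneg _)
    _ = (√(2 * t) * h.graphSeminorm u) ^ 2 := by rw [mul_pow, Real.sq_sqrt (by positivity)]

theorem norm_gammaLp_le (h : ReversibleAlgebra κ μ 𝒜) (u v : 𝒜) :
    ‖h.gammaLp u v‖ ≤ h.graphSeminorm u * h.graphSeminorm v := by
  refine le_of_tendsto (h.tendsto_condIncrement u v).norm ?_
  filter_upwards [self_mem_nhdsWithin] with t ht
  have := h.isMarkovKernel t
  have two_t_pos : (0 : ℝ) < 2 * t := mul_pos two_pos (NNReal.coe_pos.2 ht)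
  rw [norm_smul, norm_inv, Real.norm_of_nonneg two_t_pos.le, inv_mul_le_iff₀ two_t_pos]
  calc ‖h.toLp one_le_two (h.condIncrement t u v)‖
      ≤ ‖incrementLp (h.invariant t) 2 (h.toLp le_rfl u)‖ *
          ‖incrementLp (h.invariant t) 2 (h.toLp le_rfl v)‖ := h.norm_toLp_condIncrement_le t u v
    _ ≤ √(2 * t) * h.graphSeminorm u * (√(2 * t) * h.graphSeminorm v) := by
        gcongr <;> exact h.norm_incrementLp_le_graphSeminorm t _
    _ = 2 * t * (h.graphSeminorm u * h.graphSeminorm v) := by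
        rw [mul_mul_mul_comm, Real.mul_self_sqrt two_t_pos.le]

theorem genLp_gen_evolve (h : ReversibleAlgebra κ μ 𝒜) {p : ℝ≥0∞} [Fact (1 ≤ p)] (hp : p ≤ 2)
    (t : ℝ≥0) (u : 𝒜) :
    h.genLp hp (h.gen (h.evolve t u)) =
      lpSemigroup h.markovSemigroup h.invariant p t (h.genLp hp (h.gen u)) :=
  (h.hasGenerator_toLp hp (h.gen (h.evolve t u))).unique <| by
    rw [toLp_gen, genLp_evolve]
    exact (h.isContractionSemigroup p).hasGenerator_apply (h.hasGenerator_toLp hp (h.gen u)) t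

theorem tendsto_graphSeminorm_evolve_sub (h : ReversibleAlgebra κ μ 𝒜) (u : 𝒜) (s : ℝ) :
    Tendsto (fun r : ℝ => h.graphSeminorm (h.evolve r.toNNReal u - h.evolve s.toNNReal u)) (𝓝 s)
      (𝓝 0) := by
  have orbit : ∀ v : 𝒜, Tendsto (fun r : ℝ => ‖lpSemigroup h.markovSemigroup h.invariant 2
      r.toNNReal (h.toLp le_rfl v) - lpSemigroup h.markovSemigroup h.invariant 2 s.toNNReal
        (h.toLp le_rfl v)‖) (𝓝 s) (𝓝 0) := fun v =>
    tendsto_iff_norm_sub_tendsto_zero.1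
      (((h.continuous_lpSemigroup_toLp le_rfl v).comp continuous_real_toNNReal).tendsto s)
  simp only [graphSeminorm_apply, map_sub, toLp_evolve, genLp_evolve]
  simpa [toLp_gen] using (orbit u).add (orbit (h.gen u))

theorem tendsto_graphSeminorm_slope_evolve_sub (h : ReversibleAlgebra κ μ 𝒜) (u : 𝒜) {s : ℝ}
    (hs : 0 ≤ s) :
    Tendsto (fun r : ℝ => h.graphSeminorm
      (slope (fun r : ℝ => h.evolve r.toNNReal u) s r - h.gen (h.evolve s.toNNReal u)))
      (𝓝[>] s) (𝓝 0) := by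
  have orbit : ∀ v : 𝒜, Tendsto (fun r : ℝ => ‖slope (fun r : ℝ =>
      lpSemigroup h.markovSemigroup h.invariant 2 r.toNNReal (h.toLp le_rfl v)) s r -
        lpSemigroup h.markovSemigroup h.invariant 2 s.toNNReal (h.toLp le_rfl (h.gen v))‖)
      (𝓝[>] s) (𝓝 0) := fun v =>
    tendsto_iff_norm_sub_tendsto_zero.1 <|
      (hasDerivWithinAt_iff_tendsto_slope' Set.self_notMem_Ioi).1 <|
        ((h.isContractionSemigroup 2).hasDerivWithinAt_orbit
          (h.hasGenerator_toLp le_rfl v) hs).Ioi_of_Ici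
  simp only [graphSeminorm_apply, map_sub, slope_def_module, map_smul, toLp_evolve, genLp_evolve,
    toLp_gen, genLp_gen_evolve] at orbit ⊢
  simpa [toLp_gen] using (orbit u).add (orbit (h.gen u))

end GraphSeminorm

section Interpolation

/-- The interpolation `s ↦ P_{t-s} Γ(P_s u, P_s v)` between `P_t Γ(u, v)` and `Γ(P_t u, P_t v)`. -/
noncomputable def interpolation (h : ReversibleAlgebra κ μ 𝒜) (t : ℝ≥0) (u v : 𝒜) (s : ℝ) :
    Lp ℂ 1 μ :=
  lpSemigroup h.markovSemigroup h.invariant 1 (t - s).toNNReal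
    (h.gammaLp (h.evolve s.toNNReal u) (h.evolve s.toNNReal v))

theorem continuous_interpolation (h : ReversibleAlgebra κ μ 𝒜) (t : ℝ≥0) (u v : 𝒜) :
    Continuous (h.interpolation t u v) := by
  refine continuous_iff_continuousAt.2 fun s => (h.isContractionSemigroup 1).tendsto_apply ?_
    ((continuous_real_toNNReal.comp (continuous_const.sub continuous_id)).tendsto s)
    (tendsto_bilin_of_seminorm h.norm_gammaLp_le (h.tendsto_graphSeminorm_evolve_sub u s)
      (h.tendsto_graphSeminorm_evolve_sub v s))
  rw [← toLp_gamma]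
  exact h.continuous_lpSemigroup_toLp one_le_two _

theorem hasDerivWithinAt_interpolation (h : ReversibleAlgebra κ μ 𝒜) {t : ℝ≥0} (u v : 𝒜) {s : ℝ}
    (hs : 0 ≤ s) (hst : s < t) :
    HasDerivWithinAt (h.interpolation t u v)
      (lpSemigroup h.markovSemigroup h.invariant 1 (t - s).toNNReal (h.toLp one_le_two
        ((-2 : ℝ) • h.gamma₂ (h.evolve s.toNNReal u) (h.evolve s.toNNReal v)))) (Set.Ici s) s := by
  set u' := h.evolve s.toNNReal u
  set v' := h.evolve s.toNNReal v
  have generator_sub : h.toLp one_le_two ((-2 : ℝ) • h.gamma₂ u' v') =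
      h.gammaLp (h.gen u') v' + h.gammaLp u' (h.gen v') - h.genLp one_le_two (h.gamma u' v') := by
    rw [map_smul, toLp_gamma₂]
    module
  have carre_deriv := hasDerivWithinAt_bilin_of_seminorm h.norm_gammaLp_le
    (h.tendsto_graphSeminorm_slope_evolve_sub u hs) (h.tendsto_graphSeminorm_slope_evolve_sub v hs)
    ((h.tendsto_graphSeminorm_evolve_sub v s).mono_left nhdsWithin_le_nhds)
  have carre_generator := h.hasGenerator_toLp one_le_two (h.gamma u' v')
  rw [toLp_gamma, toLp_gen] at carre_generator
  have orbit := h.continuous_lpSemigroup_toLp one_le_two ((-2 : ℝ) • h.gamma₂ u' v')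
  rw [generator_sub] at orbit ⊢
  exact (h.isContractionSemigroup 1).hasDerivWithinAt_duhamel hst carre_deriv carre_generator
    orbit

end Interpolation

end ReversibleAlgebra

variable {n : Type*} [Fintype n] [DecidableEq n] {A B C : Matrix n n ℂ}

section MixedCoordinates

theorem cfc_eq_mul_diagonal_mul_star (hA : A.IsHermitian) (φ : ℝ → ℝ) :
    cfc φ A = (hA.eigenvectorUnitary : Matrix n n ℂ) *
      Matrix.diagonal (fun j => (φ (hA.eigenvalues j) : ℂ)) *
        star (hA.eigenvectorUnitary : Matrix n n ℂ) := by
  rw [hA.cfc_eq, Matrix.IsHermitian.cfc, Unitary.conjStarAlgAut_apply]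
  rfl

/-- The matrix `X` in the eigenbases of the Hermitian matrices `A` (rows) and `B` (columns). In
these coordinates left multiplication by `φ(A)` and right multiplication by `φ(B)` are diagonal. -/
noncomputable def mixed (hA : A.IsHermitian) (hB : B.IsHermitian) (X : Matrix n n ℂ) :
    Matrix n n ℂ :=
  star (hA.eigenvectorUnitary : Matrix n n ℂ) * X * (hB.eigenvectorUnitary : Matrix n n ℂ)

theorem mixed_cfc_mul (hA : A.IsHermitian) (hB : B.IsHermitian) (φ : ℝ → ℝ) (X : Matrix n n ℂ)
    (j k : n) :
    mixed hA hB (cfc φ A * X) j k = φ (hA.eigenvalues j) * mixed hA hB X j k := by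
  rw [← Matrix.diagonal_mul (fun j => (φ (hA.eigenvalues j) : ℂ))]
  simp only [mixed, cfc_eq_mul_diagonal_mul_star hA, ← mul_assoc, Unitary.coe_star_mul_self,
    one_mul]

theorem mixed_mul_cfc (hA : A.IsHermitian) (hB : B.IsHermitian) (φ : ℝ → ℝ) (X : Matrix n n ℂ)
    (j k : n) :
    mixed hA hB (X * cfc φ B) j k = mixed hA hB X j k * φ (hB.eigenvalues k) := by
  rw [← Matrix.mul_diagonal (fun k => (φ (hB.eigenvalues k) : ℂ))]
  simp only [mixed, cfc_eq_mul_diagonal_mul_star hB, mul_assoc, Unitary.coe_star_mul_self, mul_one]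

theorem mixed_cfc_sub_cfc (hA : A.IsHermitian) (hB : B.IsHermitian) (φ : ℝ → ℝ) (j k : n) :
    mixed hA hB (cfc φ A - cfc φ B) j k =
      (φ (hA.eigenvalues j) - φ (hB.eigenvalues k) : ℝ) * mixed hA hB 1 j k := by
  have left := mixed_cfc_mul hA hB φ 1 j k
  have right := mixed_mul_cfc hA hB φ 1 j k
  rw [mul_one] at left
  rw [one_mul] at right
  calc mixed hA hB (cfc φ A - cfc φ B) j k
      = mixed hA hB (cfc φ A) j k - mixed hA hB (cfc φ B) j k := by
        simp only [mixed, mul_sub, sub_mul, Matrix.sub_apply]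
    _ = (φ (hA.eigenvalues j) - φ (hB.eigenvalues k) : ℝ) * mixed hA hB 1 j k := by
        rw [left, right]
        push_cast
        ring

theorem mixed_sub (hA : A.IsHermitian) (hB : B.IsHermitian) (j k : n) :
    mixed hA hB (A - B) j k =
      (hA.eigenvalues j - hB.eigenvalues k : ℝ) * mixed hA hB 1 j k := by
  simpa only [cfc_id ℝ A hA.isSelfAdjoint, cfc_id ℝ B hB.isSelfAdjoint, id_eq] using
    mixed_cfc_sub_cfc hA hB id j k

theorem trace_mul_eq_sum_mixed (hA : A.IsHermitian) (hB : B.IsHermitian) (hC : C.IsHermitian)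
    (X : Matrix n n ℂ) :
    (C * X).trace = ∑ j, ∑ k, star (mixed hA hB C j k) * mixed hA hB X j k := by
  set U := (hA.eigenvectorUnitary : Matrix n n ℂ)
  set V := (hB.eigenvectorUnitary : Matrix n n ℂ)
  calc (C * X).trace = (star V * (C * X) * V).trace := by
        have unitary : V * star V = 1 := Unitary.coe_mul_star_self _
        rw [Matrix.trace_mul_comm (star V * _), ← mul_assoc, unitary, one_mul]
    _ = (star (mixed hA hB C) * mixed hA hB X).trace := by
        have unitary : U * star U = 1 := Unitary.coe_mul_star_self _
        rw [mixed, mixed, star_mul, star_mul, star_star, hC.isSelfAdjoint.star_eq]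
        simp only [mul_assoc]
        rw [← mul_assoc U, unitary, one_mul]
    _ = ∑ j, ∑ k, star (mixed hA hB C j k) * mixed hA hB X j k := by
        simp only [Matrix.trace, Matrix.diag_apply, Matrix.mul_apply, Matrix.star_apply]
        exact Finset.sum_comm

theorem re_trace_mul_eq_sum_mixed (hA : A.IsHermitian) (hB : B.IsHermitian) (hC : C.IsHermitian)
    (X : Matrix n n ℂ) :
    (C * X).trace.re = ∑ j, ∑ k, (star (mixed hA hB C j k) * mixed hA hB X j k).re := by
  simp only [trace_mul_eq_sum_mixed hA hB hC, Complex.re_sum]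

theorem re_trace_cfc_mul_cfc (hA : A.IsHermitian) (hB : B.IsHermitian) (p q : ℝ → ℝ) :
    (cfc p A * cfc q B).trace.re =
      ∑ j, ∑ k, p (hA.eigenvalues j) * q (hB.eigenvalues k) * ‖mixed hA hB 1 j k‖ ^ 2 := by
  rw [re_trace_mul_eq_sum_mixed hA hB (cfc_predicate p A)]
  refine Finset.sum_congr rfl fun j _ => Finset.sum_congr rfl fun k _ => ?_
  have left := mixed_cfc_mul hA hB p 1 j k
  have right := mixed_mul_cfc hA hB q 1 j k
  rw [mul_one] at left
  rw [one_mul] at right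
  rw [left, right, ← Complex.ofReal_re (_ * _ * ‖_‖ ^ 2)]
  push_cast
  rw [← Complex.conj_mul', star_mul', Complex.star_def, Complex.conj_ofReal]
  ring_nf

end MixedCoordinates

section TraceInequalities

theorem re_trace_cfc (hA : A.IsHermitian) (φ : ℝ → ℝ) :
    (cfc φ A).trace.re = ∑ j, φ (hA.eigenvalues j) := by
  rw [cfc_eq_mul_diagonal_mul_star hA, Matrix.trace_mul_comm, ← mul_assoc,
    Unitary.coe_star_mul_self, one_mul, Matrix.trace_diagonal, Complex.re_sum]
  simp only [Complex.ofReal_re]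

theorem re_trace_mul_cfc_self (hA : A.IsHermitian) (φ : ℝ → ℝ) :
    (A * cfc φ A).trace.re = (cfc (fun x => x * φ x) A).trace.re := by
  have finite := A.finite_real_spectrum.continuousOn φ
  rw [cfc_mul (fun x => x) φ A continuousOn_id finite, cfc_id' ℝ A hA.isSelfAdjoint]

theorem re_trace_cfc_mul_cfc_le (hA : A.IsHermitian) (hB : B.IsHermitian) {p q r s : ℝ → ℝ}
    (hpq : ∀ a b, p a * q b ≤ r a + s b) :
    (cfc p A * cfc q B).trace.re ≤ (cfc r A).trace.re + (cfc s B).trace.re := by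
  have left := re_trace_cfc_mul_cfc hA hB r fun _ => 1
  have right := re_trace_cfc_mul_cfc hA hB (fun _ => 1) s
  rw [cfc_const_one ℝ B hB.isSelfAdjoint, mul_one] at left
  rw [cfc_const_one ℝ A hA.isSelfAdjoint, one_mul] at right
  rw [re_trace_cfc_mul_cfc hA hB, left, right]
  simp only [← Finset.sum_add_distrib, ← add_mul, mul_one, one_mul]
  gcongr
  exact hpq _ _

theorem re_trace_sq_mul_cfc_add (hA : A.IsHermitian) (hB : B.IsHermitian) (hC : C.IsHermitian)
    (ψ : ℝ → ℝ) :
    (C * C * cfc ψ A).trace.re + (C * C * cfc ψ B).trace.re =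
      ∑ j, ∑ k, (ψ (hA.eigenvalues j) + ψ (hB.eigenvalues k)) * ‖mixed hA hB C j k‖ ^ 2 := by
  have cyclic : (C * C * cfc ψ A).trace = (C * (cfc ψ A * C)).trace := by
    rw [Matrix.trace_mul_comm, ← mul_assoc, Matrix.trace_mul_comm]
  rw [cyclic, mul_assoc C C, re_trace_mul_eq_sum_mixed hA hB hC,
    re_trace_mul_eq_sum_mixed hA hB hC]
  simp only [← Finset.sum_add_distrib]
  refine Finset.sum_congr rfl fun j _ => Finset.sum_congr rfl fun k _ => ?_
  rw [mixed_cfc_mul, mixed_mul_cfc, ← Complex.add_re, ← Complex.ofReal_re (_ * ‖_‖ ^ 2)]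
  push_cast
  rw [← Complex.conj_mul', Complex.star_def]
  ring_nf

theorem re_trace_mul_cfc_sub_cfc_le (hA : A.IsHermitian) (hB : B.IsHermitian)
    (hC : C.IsHermitian) {φ ψ : ℝ → ℝ} (hψ : ∀ a, 0 ≤ ψ a)
    (hφ : ∀ a b, |φ a - φ b| ≤ |a - b| * ((ψ a + ψ b) / 2)) {σ : ℝ} (hσ : 0 < σ) :
    (C * (cfc φ A - cfc φ B)).trace.re ≤
      σ / 4 * (((A - B) * (A - B) * cfc ψ A).trace.re +
        ((A - B) * (A - B) * cfc ψ B).trace.re) +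
      σ⁻¹ / 4 * ((C * C * cfc ψ A).trace.re + (C * C * cfc ψ B).trace.re) := by
  rw [re_trace_sq_mul_cfc_add hA hB (hA.sub hB), re_trace_sq_mul_cfc_add hA hB hC,
    re_trace_mul_eq_sum_mixed hA hB hC]
  simp only [Finset.mul_sum, ← Finset.sum_add_distrib]
  refine Finset.sum_le_sum fun j _ => Finset.sum_le_sum fun k _ => ?_
  rw [mixed_cfc_sub_cfc, mixed_sub]
  set a := hA.eigenvalues j
  set b := hB.eigenvalues k
  set x := ‖mixed hA hB C j k‖
  set w := ‖mixed hA hB 1 j k‖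
  have weight_nonneg : 0 ≤ (ψ a + ψ b) / 2 := by linarith [hψ a, hψ b]
  have young : x * (|a - b| * w) ≤ σ / 2 * (|a - b| * w) ^ 2 + σ⁻¹ / 2 * x ^ 2 := by
    have square : 0 ≤ σ / 2 * (|a - b| * w - σ⁻¹ * x) ^ 2 := by positivity
    refine sub_nonneg.1 (square.trans_eq ?_)
    field_simp
    ring
  calc (star (mixed hA hB C j k) * (((φ a - φ b : ℝ) : ℂ) * mixed hA hB 1 j k)).re
      ≤ x * (|φ a - φ b| * w) := by
        refine (Complex.re_le_norm _).trans_eq ?_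
        rw [norm_mul, norm_star, norm_mul, Complex.norm_real, Real.norm_eq_abs]
    _ ≤ x * (|a - b| * ((ψ a + ψ b) / 2) * w) := by
        gcongr
        exact hφ a b
    _ = x * (|a - b| * w) * ((ψ a + ψ b) / 2) := by ring
    _ ≤ (σ / 2 * (|a - b| * w) ^ 2 + σ⁻¹ / 2 * x ^ 2) * ((ψ a + ψ b) / 2) := by gcongr
    _ = _ := by
        rw [norm_mul, Complex.norm_real, Real.norm_eq_abs]
        ring

theorem re_trace_mul_cfc_nonneg (hA : A.IsHermitian) {X : Matrix n n ℂ} (hX : X.PosSemidef)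
    {φ : ℝ → ℝ} (hφ : ∀ a, 0 ≤ φ a) : 0 ≤ (X * cfc φ A).trace.re := by
  rw [cfc_eq_mul_diagonal_mul_star hA, ← mul_assoc, Matrix.trace_mul_comm, ← mul_assoc,
    ← mul_assoc, Matrix.trace, Complex.re_sum]
  refine Finset.sum_nonneg fun j _ => ?_
  rw [Matrix.diag_apply, Matrix.mul_diagonal, mul_comm, Complex.re_ofReal_mul]
  exact mul_nonneg (hφ _) (Complex.nonneg_iff.1
    (hX.conjTranspose_mul_mul_same (hA.eigenvectorUnitary : Matrix n n ℂ)).diag_nonneg).1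

end TraceInequalities

section Regularity

open scoped Matrix.Norms.L2Operator

theorem norm_apply_le_l2_opNorm (A : Matrix n n ℂ) (i j : n) : ‖A i j‖ ≤ ‖A‖ := by
  have := (PiLp.norm_apply_le _ i).trans (A.l2_opNorm_mulVec (EuclideanSpace.single j 1))
  simpa using this

theorem norm_cfc_apply_le (A : Matrix n n ℂ) {φ : ℝ → ℝ} {b : ℝ} (hb : 0 ≤ b)
    (hφ : ∀ x, |φ x| ≤ b) (i j : n) : ‖cfc φ A i j‖ ≤ b :=
  (norm_apply_le_l2_opNorm _ i j).trans (norm_cfc_le hb fun x _ => hφ x)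

theorem exp_smul_eq_cfc (hA : A.IsHermitian) (t : ℝ) :
    NormedSpace.exp ((t : ℂ) • A) = cfc (fun x => Real.exp (t * x)) A := by
  rw [Complex.coe_smul,
    ← CFC.real_exp_eq_normedSpace_exp ((IsSelfAdjoint.all t).smul hA.isSelfAdjoint),
    ← cfc_comp_smul t Real.exp A Real.continuous_exp.continuousOn hA.isSelfAdjoint]
  rfl

theorem continuousOn_cfc_isHermitian {φ : ℝ → ℝ} (hφ : Continuous φ) :
    ContinuousOn (fun A : Matrix n n ℂ => cfc φ A) {A | A.IsHermitian} := by
  intro A hA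
  have bounded : ∀ᶠ B in 𝓝[{A | A.IsHermitian}] A,
      spectrum ℝ B ⊆ Metric.closedBall 0 ((‖A‖ + 1) * ‖(1 : Matrix n n ℂ)‖) := by
    have near : ∀ᶠ B in 𝓝 A, ‖B‖ < ‖A‖ + 1 :=
      continuous_norm.continuousAt.eventually_lt_const (lt_add_one _)
    filter_upwards [nhdsWithin_le_nhds near] with B hB
    refine (spectrum.subset_closedBall_norm_mul B).trans (Metric.closedBall_subset_closedBall ?_)
    gcongr
  exact continuousWithinAt_id.cfc (isCompact_closedBall _ _) φ hA bounded
    (eventually_mem_nhdsWithin.mono fun _ hB => Matrix.IsHermitian.isSelfAdjoint hB)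
    hφ.continuousOn

theorem measurable_cfc_apply {α : Type*} [MeasurableSpace α] {F : α → Matrix n n ℂ}
    (hF : ∀ i j, Measurable fun z => F z i j) (hH : ∀ z, (F z).IsHermitian) {φ : ℝ → ℝ}
    (hφ : Continuous φ) (i j : n) : Measurable fun z => cfc φ (F z) i j := by
  have continuous_entry : Continuous fun B : {B : n → n → ℂ // (Matrix.of B).IsHermitian} =>
      cfc φ (Matrix.of B.1) i j :=
    ((continuousOn_cfc_isHermitian hφ).comp_continuous (f := fun B : {B : n → n → ℂ //
      (Matrix.of B).IsHermitian} => Matrix.of B.1) continuous_subtype_val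
      fun B => B.2).matrix_elem i j
  exact continuous_entry.measurable.comp (Measurable.subtype_mk (h := hH)
    (measurable_pi_iff.2 fun i => measurable_pi_iff.2 fun j => hF i j))

end Regularity

variable {n : Type*} [Fintype n] [DecidableEq n] {A B : Matrix n n ℂ} {φ ψ : ℝ → ℝ}

section TraceFunctions

theorem re_trace_cfc_add (hA : A.IsHermitian) (φ ψ : ℝ → ℝ) :
    (cfc (fun x => φ x + ψ x) A).trace.re = (cfc φ A).trace.re + (cfc ψ A).trace.re := by
  simp only [re_trace_cfc hA, Finset.sum_add_distrib]

theorem re_trace_cfc_const_mul (hA : A.IsHermitian) (a : ℝ) (φ : ℝ → ℝ) :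
    (cfc (fun x => a * φ x) A).trace.re = a * (cfc φ A).trace.re := by
  simp only [re_trace_cfc hA, Finset.mul_sum]

theorem re_trace_cfc_const (hA : A.IsHermitian) (a : ℝ) :
    (cfc (fun _ => a) A).trace.re = Fintype.card n * a := by
  simp only [re_trace_cfc hA, Finset.sum_const, Finset.card_univ, nsmul_eq_mul]

theorem re_trace_cfc_mono (hA : A.IsHermitian) (hφψ : ∀ x, φ x ≤ ψ x) :
    (cfc φ A).trace.re ≤ (cfc ψ A).trace.re := by
  simp only [re_trace_cfc hA]
  gcongr
  exact hφψ _

theorem abs_re_trace_cfc_le (hA : A.IsHermitian) (hφψ : ∀ x, |φ x| ≤ ψ x) :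
    |(cfc φ A).trace.re| ≤ (cfc ψ A).trace.re := by
  simp only [re_trace_cfc hA]
  exact (Finset.abs_sum_le_sum_abs _ _).trans (Finset.sum_le_sum fun j _ => hφψ _)

theorem re_trace_cfc_pos [Nonempty n] (hA : A.IsHermitian) (hφ : ∀ x, 0 < φ x) :
    0 < (cfc φ A).trace.re := by
  rw [re_trace_cfc hA]
  exact Finset.sum_pos (fun j _ => hφ _) Finset.univ_nonempty

theorem re_trace_cfc_sq (hA : A.IsHermitian) : (cfc (fun x : ℝ => x ^ 2) A).trace.re =
    (A * A).trace.re := by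
  rw [cfc_pow_id A 2 hA.isSelfAdjoint, sq]

omit [DecidableEq n] in
theorem re_trace_mul_self_nonneg (hA : A.IsHermitian) : 0 ≤ (A * A).trace.re := by
  have trace_nonneg := (Matrix.posSemidef_conjTranspose_mul_self A).trace_nonneg
  rw [hA.eq] at trace_nonneg
  exact (Complex.nonneg_iff.1 trace_nonneg).1

open scoped Matrix.Norms.L2Operator in
theorem eigenvalues_le_norm_toEuclideanCLM (hA : A.IsHermitian) (j : n) :
    hA.eigenvalues j ≤ ‖Matrix.toEuclideanCLM (𝕜 := ℂ) A‖ := by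
  have : Nonempty n := ⟨j⟩
  exact (le_abs_self _).trans (spectrum.norm_le_norm_of_mem (hA.eigenvalues_mem_spectrum_real j))

theorem re_trace_cfc_le_card_mul (hA : A.IsHermitian) (hφ : Monotone φ) {v : ℝ}
    (hv : ‖Matrix.toEuclideanCLM (𝕜 := ℂ) A‖ ≤ v) :
    (cfc φ A).trace.re ≤ Fintype.card n * φ v := by
  rw [re_trace_cfc hA, ← nsmul_eq_mul]
  exact Finset.sum_le_card_nsmul _ _ _ fun j _ =>
    hφ ((eigenvalues_le_norm_toEuclideanCLM hA j).trans hv)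

theorem mul_re_trace_mul_cfc_exp_le (hA : A.IsHermitian) (hB : B.IsHermitian) (a ρ : ℝ)
    (g : ℝ → ℝ) :
    a * (A * cfc (fun y => Real.exp (g y)) B).trace.re ≤
      Real.exp (-ρ) * (cfc (fun x => Real.exp (a * x)) A).trace.re +
        ((cfc (fun y => g y * Real.exp (g y)) B).trace.re +
          (ρ - 1) * (cfc (fun y => Real.exp (g y)) B).trace.re) := by
  have young (x y : ℝ) : a * x * Real.exp (g y) ≤ Real.exp (-ρ) * Real.exp (a * x) +
      (g y * Real.exp (g y) + (ρ - 1) * Real.exp (g y)) := by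
    have one_add_le := mul_le_mul_of_nonneg_right (Real.add_one_le_exp (a * x - ρ - g y))
      (Real.exp_pos (g y)).le
    have exp_eq : Real.exp (a * x - ρ - g y) * Real.exp (g y) =
        Real.exp (-ρ) * Real.exp (a * x) := by
      rw [← Real.exp_add, ← Real.exp_add]
      ring_nf
    linarith
  have traces_le := re_trace_cfc_mul_cfc_le hA hB young
  rwa [cfc_const_mul_id a A hA.isSelfAdjoint, Matrix.smul_mul, Matrix.trace_smul,
    Complex.smul_re, smul_eq_mul, re_trace_cfc_const_mul hA, re_trace_cfc_add hB,
    re_trace_cfc_const_mul hB] at traces_le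

end TraceFunctions

section TracePairing

variable {n α : Type*} [Fintype n] [MeasurableSpace α] {ν : Measure α}

theorem re_trace_mul_eq_sum (X Y : Matrix n n ℂ) :
    (X * Y).trace.re = ∑ i, ∑ j, (X i j * Y j i).re := by
  simp only [Matrix.trace, Matrix.diag_apply, Matrix.mul_apply, Complex.re_sum]

theorem integrable_re_trace_mul {X Y : α → Matrix n n ℂ}
    (hX : ∀ i j, Integrable (fun z => X z i j) ν) (hY : ∀ i j, MemLp (fun z => Y z i j) ∞ ν) :
    Integrable (fun z => (X z * Y z).trace.re) ν := by
  simp only [re_trace_mul_eq_sum]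
  exact integrable_finsetSum _ fun i _ => integrable_finsetSum _ fun j _ =>
    ((hX i j).mul_of_top_left (hY j i)).re

theorem integral_re_trace_mul {X Y : α → Matrix n n ℂ}
    (hX : ∀ i j, Integrable (fun z => X z i j) ν) (hY : ∀ i j, MemLp (fun z => Y z i j) ∞ ν) :
    ∫ z, (X z * Y z).trace.re ∂ν = ∑ i, ∑ j, (∫ z, X z i j * Y z j i ∂ν).re := by
  have integrable : ∀ i j, Integrable (fun z => X z i j * Y z j i) ν := fun i j =>
    (hX i j).mul_of_top_left (hY j i)
  have integrable_re : ∀ i j, Integrable (fun z => (X z i j * Y z j i).re) ν := fun i j =>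
    (integrable i j).re
  simp only [re_trace_mul_eq_sum]
  rw [integral_finsetSum _ fun i _ => integrable_finsetSum _ fun j _ => integrable_re i j]
  refine Finset.sum_congr rfl fun i _ => ?_
  rw [integral_finsetSum _ fun j _ => integrable_re i j]
  exact Finset.sum_congr rfl fun j _ => integral_re (integrable i j)

theorem integral_re_trace_mul_compProd {η : Kernel α α} [IsMarkovKernel η]
    [IsProbabilityMeasure ν] {V Φ : α → Matrix n n ℂ} {X : α × α → Matrix n n ℂ}
    (hΦ : ∀ i j, MemLp (fun z => Φ z i j) ∞ ν)
    (hX : ∀ i j, Integrable (fun p => X p i j) (ν ⊗ₘ η))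
    (hV : ∀ i j, (fun z => V z i j) =ᵐ[ν] fun z => ∫ y, X (z, y) i j ∂η z) :
    ∫ p, (X p * Φ p.1).trace.re ∂(ν ⊗ₘ η) = ∫ z, (V z * Φ z).trace.re ∂ν := by
  have memLp_fst : ∀ i j, MemLp (fun p : α × α => Φ p.1 i j) ∞ (ν ⊗ₘ η) := fun i j =>
    (hΦ i j).comp_measurePreserving measurePreserving_fst_compProd
  rw [Measure.integral_compProd (integrable_re_trace_mul hX memLp_fst)]
  refine integral_congr_ae ?_
  filter_upwards [ae_all_iff.2 fun i => ae_all_iff.2 fun j => hV i j,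
    ae_all_iff.2 fun i => ae_all_iff.2 fun j => ((Measure.integrable_compProd_iff
      (hX i j).aestronglyMeasurable).1 (hX i j)).1] with z hVz hXz
  rw [integral_re_trace_mul hXz fun i j => memLp_const (Φ z i j), re_trace_mul_eq_sum]
  simp only [hVz, integral_mul_const]

/-- The functional `x ↦ ∫ x w dν` on `L₁(ν)`, for an essentially bounded function `w`. -/
noncomputable def lpPairing {w : α → ℂ} (hw : MemLp w ∞ ν) : Lp ℂ 1 ν →L[ℝ] ℂ :=
  L1.integralCLM ∘L
    ((ContinuousLinearMap.mul ℝ ℂ).holderL ν 1 ∞ 1).flip (hw.toLp w)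

theorem lpPairing_eq_integral {w f : α → ℂ} (hw : MemLp w ∞ ν) {x : Lp ℂ 1 ν} (hx : x =ᵐ[ν] f) :
    lpPairing hw x = ∫ z, f z * w z ∂ν := by
  rw [lpPairing, ContinuousLinearMap.comp_apply, ← L1.integral_eq, L1.integral_eq_integral]
  refine integral_congr_ae ?_
  filter_upwards [(ContinuousLinearMap.mul ℝ ℂ).coeFn_holder (r := 1) x (hw.toLp w),
    hw.coeFn_toLp, hx] with z hz hwz hxz
  rw [← hwz, ← hxz]
  exact hz

/-- The functional `X ↦ ∫ Re tr (X Φ) dν` on matrices with entries in `L₁(ν)`, for an essentially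
bounded matrix-valued function `Φ`. -/
noncomputable def tracePairing {Φ : α → Matrix n n ℂ} (hΦ : ∀ i j, MemLp (fun z => Φ z i j) ∞ ν) :
    (n → n → Lp ℂ 1 ν) →L[ℝ] ℝ :=
  ∑ i, ∑ j, Complex.reCLM ∘L lpPairing (hΦ j i) ∘L ContinuousLinearMap.proj j ∘L
    ContinuousLinearMap.proj i

theorem tracePairing_eq_integral {Φ X : α → Matrix n n ℂ}
    (hΦ : ∀ i j, MemLp (fun z => Φ z i j) ∞ ν) {x : n → n → Lp ℂ 1 ν}
    (hx : ∀ i j, x i j =ᵐ[ν] fun z => X z i j) :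
    tracePairing hΦ x = ∫ z, (X z * Φ z).trace.re ∂ν := by
  rw [integral_re_trace_mul (fun i j => (L1.integrable_coeFn (x i j)).congr (hx i j)) hΦ]
  simp only [tracePairing, _root_.sum_apply, ContinuousLinearMap.comp_apply,
    ContinuousLinearMap.proj_apply, Complex.reCLM_apply]
  exact Finset.sum_congr rfl fun i _ => Finset.sum_congr rfl fun j _ => by
    rw [lpPairing_eq_integral (hΦ j i) (hx i j)]

end TracePairing

variable {Ω n : Type*} [MeasurableSpace Ω] {κ : ℝ≥0 → Kernel Ω Ω} {μ : Measure Ω}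
  {𝒜 : StarSubalgebra ℂ (Ω → ℂ)} {d : ℕ}

section Symmetry

theorem semigroup_conj (t : ℝ≥0) (u : Ω → ℂ) : semigroup κ t (star u) = star (semigroup κ t u) :=
  funext fun _ => integral_conj

theorem generator_eq_of_tendsto {u : Ω → ℂ} {z : Ω} {a : ℂ}
    (ha : Tendsto (fun t : ℝ≥0 => diffQuot κ u t z) (𝓝[>] 0) (𝓝 a)) : generator κ u z = a := by
  have exists_limit : ∃ a : ℂ, Tendsto (fun t : ℝ≥0 => diffQuot κ u t z) (𝓝[>] 0) (𝓝 a) := ⟨a, ha⟩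
  rw [generator, dif_pos exists_limit]
  exact tendsto_nhds_unique exists_limit.choose_spec ha

theorem generator_eq_of_involutive {L : ℂ → ℂ} (hL : Continuous L) (involutive : L.Involutive)
    (map_zero : L 0 = 0) {u v : Ω → ℂ} {z : Ω}
    (huv : ∀ t, diffQuot κ v t z = L (diffQuot κ u t z)) :
    generator κ v z = L (generator κ u z) := by
  by_cases exists_limit : ∃ a : ℂ, Tendsto (fun t : ℝ≥0 => diffQuot κ u t z) (𝓝[>] 0) (𝓝 a)
  · obtain ⟨a, ha⟩ := exists_limit
    rw [generator_eq_of_tendsto ha]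
    refine generator_eq_of_tendsto ?_
    simp only [huv]
    exact (hL.tendsto a).comp ha
  · have no_limit : ¬∃ a : ℂ, Tendsto (fun t : ℝ≥0 => diffQuot κ v t z) (𝓝[>] 0) (𝓝 a) := by
      rintro ⟨a, ha⟩
      refine exists_limit ⟨L a, ((hL.tendsto a).comp ha).congr fun t => ?_⟩
      rw [Function.comp_apply, huv, involutive]
    rw [generator, generator, dif_neg exists_limit, dif_neg no_limit, map_zero]

theorem generator_conj (u : Ω → ℂ) : generator κ (star u) = star (generator κ u) :=
  funext fun _ => generator_eq_of_involutive continuous_star star_involutive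
    (star_zero _) fun t => by
      simp only [diffQuot, semigroup_conj, Pi.star_apply, star_div₀, star_sub, RCLike.star_def,
      Complex.conj_ofReal]

theorem generator_neg (u : Ω → ℂ) : generator κ (-u) = -generator κ u :=
  funext fun _ => generator_eq_of_involutive continuous_neg neg_involutive neg_zero fun t => by
    simp only [diffQuot, semigroup, Pi.neg_apply, integral_neg]
    ring

theorem carre_neg (f : Ω → Matrix (Fin d) (Fin d) ℂ) : carre κ (-f) (-f) = carre κ f f := by
  have matGenerator_neg : matGenerator κ (-f) = -matGenerator κ f :=
    funext fun z => Matrix.ext fun i j => congrFun (generator_neg fun y => f y i j) z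
  simp only [carre, matGenerator_neg, mul_neg, neg_mul, neg_neg]

end Symmetry

namespace ReversibleAlgebra

theorem evolve_star (h : ReversibleAlgebra κ μ 𝒜) (t : ℝ≥0) (u : 𝒜) :
    h.evolve t (star u) = star (h.evolve t u) :=
  Subtype.ext (semigroup_conj t (u : Ω → ℂ))

theorem gen_star (h : ReversibleAlgebra κ μ 𝒜) (u : 𝒜) : h.gen (star u) = star (h.gen u) :=
  Subtype.ext (generator_conj (u : Ω → ℂ))

theorem map_evolve_zero (h : ReversibleAlgebra κ μ 𝒜) (F : Matrix n n 𝒜) :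
    F.map (h.evolve 0) = F :=
  Matrix.ext fun i j => h.evolve_zero (F i j)

theorem isHermitian_map_evolve (h : ReversibleAlgebra κ μ 𝒜) (t : ℝ≥0) {F : Matrix n n 𝒜}
    (hF : F.IsHermitian) : (F.map (h.evolve t)).IsHermitian :=
  hF.map _ (h.evolve_star t)

end ReversibleAlgebra

variable [Fintype n]

section Eval

omit [MeasurableSpace Ω]

/-- The value at `z` of a matrix of suitable functions. -/
noncomputable def evalMatrix [DecidableEq n] (z : Ω) : Matrix n n 𝒜 →+* Matrix n n ℂ :=
  ((Pi.evalRingHom _ z).comp (SubringClass.subtype 𝒜)).mapMatrix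

variable [DecidableEq n]

theorem evalMatrix_apply (z : Ω) (F : Matrix n n 𝒜) (i j : n) :
    evalMatrix z F i j = (F i j : Ω → ℂ) z :=
  rfl

theorem evalMatrix_half_smul (F : Matrix n n 𝒜) (z : Ω) :
    evalMatrix z ((1 / 2 : ℝ) • F) = (1 / 2 : ℂ) • evalMatrix z F := by
  ext i j
  change (1 / 2 : ℝ) • (F i j : Ω → ℂ) z = (1 / 2 : ℂ) • (F i j : Ω → ℂ) z
  rw [Complex.real_smul, smul_eq_mul]
  norm_num

theorem isHermitian_evalMatrix {F : Matrix n n 𝒜} (hF : F.IsHermitian) (z : Ω) :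
    (evalMatrix z F).IsHermitian :=
  hF.map _ fun _ => rfl

theorem evalMatrix_sub_algebraMap (z : Ω) (F : Matrix n n 𝒜) (m : Matrix n n ℂ) :
    evalMatrix z (F - m.map (algebraMap ℂ 𝒜)) = evalMatrix z F - m := rfl

theorem IsSuitable.neg {f : Ω → Matrix (Fin d) (Fin d) ℂ} (hf : IsSuitable 𝒜 f) :
    IsSuitable 𝒜 (-f) :=
  ⟨fun z => (hf.1 z).neg, fun i j => 𝒜.neg_mem (hf.2 i j)⟩

theorem IsSuitable.exists_evalMatrix {f : Ω → Matrix (Fin d) (Fin d) ℂ} (hf : IsSuitable 𝒜 f) :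
    ∃ F : Matrix (Fin d) (Fin d) 𝒜, F.IsHermitian ∧ (fun z => evalMatrix z F) = f :=
  ⟨.of fun i j => ⟨fun z => f z i j, hf.2 i j⟩,
    .ext fun i j => Subtype.ext (funext fun z => (hf.1 z).apply i j), rfl⟩

theorem isSuitable_evalMatrix {F : Matrix (Fin d) (Fin d) 𝒜} (hF : F.IsHermitian) :
    IsSuitable 𝒜 fun z => evalMatrix z F :=
  ⟨isHermitian_evalMatrix hF, fun i j => (F i j).2⟩

end Eval

namespace ReversibleAlgebra

/-- The matrix carré du champ `Γ(F, G)` of matrices of suitable functions. -/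
noncomputable def carreMatrix (h : ReversibleAlgebra κ μ 𝒜) (F G : Matrix n n 𝒜) : Matrix n n 𝒜 :=
  (1 / 2 : ℝ) • ((F * G).map h.gen - F * G.map h.gen - F.map h.gen * G)

/-- The iterated matrix carré du champ `Γ₂(F, G)` of matrices of suitable functions. -/
noncomputable def carre₂Matrix (h : ReversibleAlgebra κ μ 𝒜) (F G : Matrix n n 𝒜) : Matrix n n 𝒜 :=
  (1 / 2 : ℝ) • ((h.carreMatrix F G).map h.gen - h.carreMatrix F (G.map h.gen) -
    h.carreMatrix (F.map h.gen) G)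

theorem isHermitian_carreMatrix (h : ReversibleAlgebra κ μ 𝒜) {F : Matrix n n 𝒜}
    (hF : F.IsHermitian) : (h.carreMatrix F F).IsHermitian := by
  have gen_sq : ((F * F).map h.gen).IsHermitian :=
    (show (F * F).IsHermitian by rw [Matrix.IsHermitian, Matrix.conjTranspose_mul, hF.eq]).map _
      h.gen_star
  have gen : (F.map h.gen).IsHermitian := hF.map _ h.gen_star
  simp only [Matrix.IsHermitian, carreMatrix, Matrix.conjTranspose_smul, Matrix.conjTranspose_sub,
    Matrix.conjTranspose_mul, gen_sq.eq, gen.eq, hF.eq, star_trivial, sub_right_comm]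

section Eval

theorem evalMatrix_map_gen (h : ReversibleAlgebra κ μ 𝒜) (F : Matrix (Fin d) (Fin d) 𝒜) :
    (fun z => evalMatrix z (F.map h.gen)) = matGenerator κ fun z => evalMatrix z F :=
  rfl

theorem evalMatrix_carreMatrix (h : ReversibleAlgebra κ μ 𝒜) (F G : Matrix (Fin d) (Fin d) 𝒜) :
    (fun z => evalMatrix z (h.carreMatrix F G)) =
      carre κ (fun z => evalMatrix z F) (fun z => evalMatrix z G) := by
  have product : (fun z => evalMatrix z F) * (fun z => evalMatrix z G) =
      fun z => evalMatrix z (F * G) :=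
    funext fun z => (map_mul (evalMatrix z) F G).symm
  rw [carre, product, ← evalMatrix_map_gen h, ← evalMatrix_map_gen h, ← evalMatrix_map_gen h]
  funext z
  simp only [carreMatrix, evalMatrix_half_smul, map_sub, map_mul (evalMatrix z)]
  rfl

theorem evalMatrix_carre₂Matrix (h : ReversibleAlgebra κ μ 𝒜) (F G : Matrix (Fin d) (Fin d) 𝒜) :
    (fun z => evalMatrix z (h.carre₂Matrix F G)) =
      carre₂ κ (fun z => evalMatrix z F) (fun z => evalMatrix z G) := by
  simp only [carre₂, ← evalMatrix_map_gen h, ← evalMatrix_carreMatrix h, carre₂Matrix,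
    evalMatrix_half_smul, map_sub]
  rfl

end Eval

variable [IsProbabilityMeasure μ]

theorem toLp_carreMatrix (h : ReversibleAlgebra κ μ 𝒜) (F G : Matrix n n 𝒜) (i j : n) :
    h.toLp one_le_two (h.carreMatrix F G i j) = ∑ k, h.gammaLp (F i k) (G k j) := by
  simp only [← toLp_gamma, gamma, carreMatrix, Matrix.smul_apply, Matrix.sub_apply,
    Matrix.map_apply, Matrix.mul_apply, map_smul, map_sub, map_sum, toLp_gen, ← Finset.smul_sum,
    Finset.sum_sub_distrib]

theorem toLp_carre₂Matrix (h : ReversibleAlgebra κ μ 𝒜) (F G : Matrix n n 𝒜) (i j : n) :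
    h.toLp one_le_two (h.carre₂Matrix F G i j) =
      ∑ k, h.toLp one_le_two (h.gamma₂ (F i k) (G k j)) := by
  have genLp_carreMatrix : h.genLp one_le_two (h.carreMatrix F G i j) =
      ∑ k, h.genLp one_le_two (h.gamma (F i k) (G k j)) := by
    rw [← map_sum]
    refine (h.hasGenerator_toLp one_le_two _).unique ?_
    rw [toLp_carreMatrix]
    simp only [← toLp_gamma, ← map_sum]
    exact h.hasGenerator_toLp one_le_two _
  simp only [carre₂Matrix, Matrix.smul_apply, Matrix.sub_apply, Matrix.map_apply, map_smul, map_sub,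
    toLp_gen, genLp_carreMatrix, toLp_carreMatrix, toLp_gamma₂, ← Finset.smul_sum,
    Finset.sum_sub_distrib]

end ReversibleAlgebra

namespace ReversibleAlgebra

variable {Ω n : Type*} [MeasurableSpace Ω] [Fintype n] [DecidableEq n] {κ : ℝ≥0 → Kernel Ω Ω}
  {μ : Measure Ω} {𝒜 : StarSubalgebra ℂ (Ω → ℂ)} {d : ℕ}

section Correlation

variable {Φ : Ω → Matrix n n ℂ}

/-- The correlation `𝔼 Re tr [F(Z_t) Φ(Z_0)]`, written with the transition operator `P_t`. -/
noncomputable def correlation (h : ReversibleAlgebra κ μ 𝒜) (t : ℝ≥0) (F : Matrix n n 𝒜)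
    (Φ : Ω → Matrix n n ℂ) : ℝ :=
  ∫ z, (evalMatrix z (F.map (h.evolve t)) * Φ z).trace.re ∂μ

theorem correlation_zero (h : ReversibleAlgebra κ μ 𝒜) (F : Matrix n n 𝒜) :
    h.correlation 0 F Φ = ∫ z, (evalMatrix z F * Φ z).trace.re ∂μ := by
  rw [correlation, map_evolve_zero]

variable [IsProbabilityMeasure μ]

theorem correlation_eq_tracePairing (h : ReversibleAlgebra κ μ 𝒜)
    (hΦ : ∀ i j, MemLp (fun z => Φ z i j) ∞ μ) (t : ℝ≥0) (F : Matrix n n 𝒜) :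
    h.correlation t F Φ = tracePairing hΦ fun i j =>
      lpSemigroup h.markovSemigroup h.invariant 1 t (h.toLp one_le_two (F i j)) := by
  refine (tracePairing_eq_integral hΦ fun i j => ?_).symm
  rw [← toLp_evolve]
  exact h.coeFn_toLp one_le_two _

theorem correlation_map_evolve (h : ReversibleAlgebra κ μ 𝒜)
    (hΦ : ∀ i j, MemLp (fun z => Φ z i j) ∞ μ) (s t : ℝ≥0) (F : Matrix n n 𝒜) :
    h.correlation s (F.map (h.evolve t)) Φ = h.correlation (s + t) F Φ := by
  simp only [h.correlation_eq_tracePairing hΦ, Matrix.map_apply, toLp_evolve,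
    (h.isContractionSemigroup 1).add_apply]

theorem integral_re_trace_compProd (h : ReversibleAlgebra κ μ 𝒜)
    (hΦ : ∀ i j, MemLp (fun z => Φ z i j) ∞ μ) (t : ℝ≥0) (F : Matrix n n 𝒜) :
    ∫ p, (evalMatrix p.2 F * Φ p.1).trace.re ∂(μ ⊗ₘ κ t) = h.correlation t F Φ :=
  haveI := h.isMarkovKernel t
  integral_re_trace_mul_compProd hΦ (X := fun p => evalMatrix p.2 F)
    (fun i j => (measurePreserving_snd_compProd (h.invariant t)).integrable_comp_of_integrable
      (h.integrable (F i j)))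
    fun _ _ => .rfl

theorem continuous_correlation (h : ReversibleAlgebra κ μ 𝒜)
    (hΦ : ∀ i j, MemLp (fun z => Φ z i j) ∞ μ) (F : Matrix n n 𝒜) :
    Continuous fun t => h.correlation t F Φ := by
  simp only [h.correlation_eq_tracePairing hΦ]
  exact (tracePairing hΦ).continuous.comp <| continuous_pi fun i => continuous_pi fun j =>
    h.continuous_lpSemigroup_toLp one_le_two (F i j)

end Correlation

section BakryEmery

variable [IsProbabilityMeasure μ] {Φ : Ω → Matrix (Fin d) (Fin d) ℂ} {c : ℝ}

theorem correlation_carreMatrix_le (h : ReversibleAlgebra κ μ 𝒜) (hBE : BakryEmery κ μ 𝒜 d c)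
    (hΦ : ∀ i j, MemLp (fun z => Φ z i j) ∞ μ)
    (hpos : ∀ z (X : Matrix (Fin d) (Fin d) ℂ), X.PosSemidef → 0 ≤ (X * Φ z).trace.re)
    (t : ℝ≥0) {F : Matrix (Fin d) (Fin d) 𝒜} (hF : F.IsHermitian) :
    h.correlation t (h.carreMatrix F F) Φ ≤ c * h.correlation t (h.carre₂Matrix F F) Φ := by
  have := h.isMarkovKernel t
  have snd := measurePreserving_snd_compProd (h.invariant t)
  have integrable : ∀ G : Matrix (Fin d) (Fin d) 𝒜,
      Integrable (fun p : Ω × Ω => (evalMatrix p.2 G * Φ p.1).trace.re) (μ ⊗ₘ κ t) := fun G =>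
    integrable_re_trace_mul
      (fun i j => snd.integrable_comp_of_integrable (h.integrable (G i j)))
      fun i j => (hΦ i j).comp_measurePreserving measurePreserving_fst_compProd
  simp only [← h.integral_re_trace_compProd hΦ, ← integral_const_mul]
  refine integral_mono_ae (integrable _) ((integrable _).const_mul c) ?_
  filter_upwards [snd.quasiMeasurePreserving.ae (hBE _ (isSuitable_evalMatrix hF))] with p hp
  rw [← h.evalMatrix_carreMatrix, ← h.evalMatrix_carre₂Matrix] at hp
  have trace_nonneg := hpos p.1 _ hp
  rwa [Matrix.sub_mul, Matrix.trace_sub, Matrix.smul_mul, Matrix.trace_smul, Complex.sub_re,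
    smul_eq_mul, Complex.re_ofReal_mul, sub_nonneg] at trace_nonneg

/-- The interpolation `s ↦ 𝔼 Re tr [(P_{t-s} Γ(P_s F)) Φ]`, the matrix form of `interpolation`. -/
noncomputable def traceInterpolation (h : ReversibleAlgebra κ μ 𝒜)
    (hΦ : ∀ i j, MemLp (fun z => Φ z i j) ∞ μ) (t : ℝ≥0) (F : Matrix (Fin d) (Fin d) 𝒜) (s : ℝ) :
    ℝ :=
  tracePairing hΦ fun i j => ∑ k, h.interpolation t (F i k) (F k j) s

theorem traceInterpolation_eq_correlation (h : ReversibleAlgebra κ μ 𝒜)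
    (hΦ : ∀ i j, MemLp (fun z => Φ z i j) ∞ μ) (t : ℝ≥0) (F : Matrix (Fin d) (Fin d) 𝒜) (s : ℝ) :
    h.traceInterpolation hΦ t F s = h.correlation (t - s).toNNReal
      (h.carreMatrix (F.map (h.evolve s.toNNReal)) (F.map (h.evolve s.toNNReal))) Φ := by
  simp only [traceInterpolation, interpolation, h.correlation_eq_tracePairing hΦ, toLp_carreMatrix,
    map_sum, Matrix.map_apply]

theorem continuous_traceInterpolation (h : ReversibleAlgebra κ μ 𝒜)
    (hΦ : ∀ i j, MemLp (fun z => Φ z i j) ∞ μ) (t : ℝ≥0) (F : Matrix (Fin d) (Fin d) 𝒜) :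
    Continuous (h.traceInterpolation hΦ t F) :=
  (tracePairing hΦ).continuous.comp <| continuous_pi fun i => continuous_pi fun j =>
    continuous_finsetSum _ fun k _ => h.continuous_interpolation t (F i k) (F k j)

theorem hasDerivWithinAt_traceInterpolation (h : ReversibleAlgebra κ μ 𝒜)
    (hΦ : ∀ i j, MemLp (fun z => Φ z i j) ∞ μ) {t : ℝ≥0} (F : Matrix (Fin d) (Fin d) 𝒜) {s : ℝ}
    (hs : 0 ≤ s) (hst : s < t) :
    HasDerivWithinAt (h.traceInterpolation hΦ t F) (-2 * h.correlation (t - s).toNNReal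
      (h.carre₂Matrix (F.map (h.evolve s.toNNReal)) (F.map (h.evolve s.toNNReal))) Φ)
      (Set.Ici s) s := by
  have deriv := (tracePairing hΦ).hasFDerivAt.comp_hasDerivWithinAt s
    (hasDerivWithinAt_pi.2 fun i => hasDerivWithinAt_pi.2 fun j => HasDerivWithinAt.fun_sum
      fun k (_ : k ∈ Finset.univ) => h.hasDerivWithinAt_interpolation (F i k) (F k j) hs hst)
  refine deriv.congr_deriv ?_
  simp only [h.correlation_eq_tracePairing hΦ, toLp_carre₂Matrix, Matrix.map_apply, map_smul,
    map_sum, ← Finset.smul_sum]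
  exact (tracePairing hΦ).map_smul (-2 : ℝ) _

theorem correlation_carreMatrix_map_evolve_le (h : ReversibleAlgebra κ μ 𝒜) (hc : 0 < c)
    (hBE : BakryEmery κ μ 𝒜 d c) (hΦ : ∀ i j, MemLp (fun z => Φ z i j) ∞ μ)
    (hpos : ∀ z (X : Matrix (Fin d) (Fin d) ℂ), X.PosSemidef → 0 ≤ (X * Φ z).trace.re)
    (t : ℝ≥0) {F : Matrix (Fin d) (Fin d) 𝒜} (hF : F.IsHermitian) :
    h.correlation 0 (h.carreMatrix (F.map (h.evolve t)) (F.map (h.evolve t))) Φ ≤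
      Real.exp (-(2 / c) * t) * h.correlation t (h.carreMatrix F F) Φ := by
  have gronwall := le_gronwallBound_of_liminf_deriv_right_le (K := -(2 / c)) (ε := 0)
    (h.continuous_traceInterpolation hΦ t F).continuousOn
    (fun s hs r hr => (h.hasDerivWithinAt_traceInterpolation hΦ F hs.1 hs.2).liminf_right_slope_le
      hr) le_rfl (fun s _ => ?_) t ⟨t.2, le_rfl⟩
  · rw [gronwallBound_ε0, traceInterpolation_eq_correlation, traceInterpolation_eq_correlation,
      sub_self, sub_zero, Real.toNNReal_zero, Real.toNNReal_coe,
      map_evolve_zero] at gronwall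
    rwa [mul_comm (Real.exp _)]
  · have criterion := h.correlation_carreMatrix_le hBE hΦ hpos (t - s).toNNReal
      (h.isHermitian_map_evolve s.toNNReal hF)
    rw [traceInterpolation_eq_correlation, add_zero, neg_mul, neg_mul, neg_le_neg_iff,
      div_mul_eq_mul_div, div_le_iff₀ hc, mul_right_comm, mul_assoc]
    linarith

end BakryEmery

end ReversibleAlgebra

namespace ReversibleAlgebra

variable {Ω n : Type*} [MeasurableSpace Ω] [Fintype n] [DecidableEq n] {κ : ℝ≥0 → Kernel Ω Ω}
  {μ : Measure Ω} {𝒜 : StarSubalgebra ℂ (Ω → ℂ)} {Φ : Ω → Matrix n n ℂ}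

theorem memLp_evalMatrix_increment [IsProbabilityMeasure μ] (h : ReversibleAlgebra κ μ 𝒜) (t : ℝ≥0)
    (F : Matrix n n 𝒜) (i j : n) :
    MemLp (fun p : Ω × Ω => (evalMatrix p.2 F - evalMatrix p.1 F) i j) 2 (μ ⊗ₘ κ t) :=
  h.memLp_increment t (F i j)

theorem integrable_evalMatrix_increment_sq [IsProbabilityMeasure μ] (h : ReversibleAlgebra κ μ 𝒜)
    (t : ℝ≥0) (F : Matrix n n 𝒜) (i j : n) :
    Integrable (fun p : Ω × Ω => ((evalMatrix p.2 F - evalMatrix p.1 F) *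
      (evalMatrix p.2 F - evalMatrix p.1 F)) i j) (μ ⊗ₘ κ t) := by
  simp only [Matrix.mul_apply]
  exact integrable_finsetSum _ fun k _ => (h.memLp_evalMatrix_increment t F i k).integrable_mul
    (h.memLp_evalMatrix_increment t F k j)

/-- The weighted energy `𝔼 Re tr [(F(Z_t) - F(Z_0))² Φ(Z_0)]` of an increment. -/
noncomputable def energy (_ : ReversibleAlgebra κ μ 𝒜) (t : ℝ≥0) (F : Matrix n n 𝒜)
    (Φ : Ω → Matrix n n ℂ) : ℝ :=
  ∫ p, ((evalMatrix p.2 F - evalMatrix p.1 F) * (evalMatrix p.2 F - evalMatrix p.1 F) *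
    Φ p.1).trace.re ∂(μ ⊗ₘ κ t)

variable [IsProbabilityMeasure μ]

/-- The conditional expectation of `(F(Z_t) - F(Z_0))²` given `Z_0`. -/
noncomputable def condIncrementMatrix (h : ReversibleAlgebra κ μ 𝒜) (t : ℝ≥0) (F : Matrix n n 𝒜) :
    Matrix n n 𝒜 :=
  Matrix.of fun i j => ∑ k, h.condIncrement t (F i k) (F k j)

theorem energy_eq_correlation (h : ReversibleAlgebra κ μ 𝒜)
    (hΦ : ∀ i j, MemLp (fun z => Φ z i j) ∞ μ) (t : ℝ≥0) (F : Matrix n n 𝒜) :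
    h.energy t F Φ = h.correlation 0 (h.condIncrementMatrix t F) Φ := by
  have := h.isMarkovKernel t
  rw [correlation_zero]
  refine integral_re_trace_mul_compProd hΦ (h.integrable_evalMatrix_increment_sq t F)
    fun i j => ?_
  have increment (k : n) := (h.memLp_increment t (F i k)).integrable_mul
    (h.memLp_increment t (F k j))
  filter_upwards [ae_all_iff.2 fun k => h.condIncrement_ae_eq t (F i k) (F k j),
    ae_all_iff.2 fun k => ((Measure.integrable_compProd_iff
      (increment k).aestronglyMeasurable).1 (increment k)).1] with z eval_eq integrable
  simp only [Matrix.mul_apply, Matrix.sub_apply, evalMatrix_apply, condIncrementMatrix,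
    Matrix.of_apply, AddSubmonoidClass.coe_finsetSum, Finset.sum_apply, eval_eq]
  exact (integral_finsetSum _ fun k _ => integrable k).symm

theorem tendsto_energy (h : ReversibleAlgebra κ μ 𝒜) (hΦ : ∀ i j, MemLp (fun z => Φ z i j) ∞ μ)
    (F : Matrix n n 𝒜) :
    Tendsto (fun t : ℝ≥0 => (2 * t : ℝ)⁻¹ * h.energy t F Φ) (𝓝[>] 0)
      (𝓝 (h.correlation 0 (h.carreMatrix F F) Φ)) := by
  simp only [h.energy_eq_correlation hΦ, h.correlation_eq_tracePairing hΦ,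
    (h.isContractionSemigroup 1).zero_apply, toLp_carreMatrix, condIncrementMatrix,
    Matrix.of_apply, map_sum]
  refine (((tracePairing hΦ).continuous.tendsto _).comp (tendsto_pi_nhds.2 fun i =>
    tendsto_pi_nhds.2 fun j => tendsto_finsetSum Finset.univ fun k _ =>
      h.tendsto_condIncrement (F i k) (F k j))).congr fun t => ?_
  simp only [Function.comp_apply, ← Finset.smul_sum]
  exact (tracePairing hΦ).map_smul (2 * t : ℝ)⁻¹ _

/-- The squared increment of `F`, weighted with `Φ` at both of its ends. -/
noncomputable def incrementWeight (_ : ReversibleAlgebra κ μ 𝒜) (F : Matrix n n 𝒜)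
    (Φ : Ω → Matrix n n ℂ) (p : Ω × Ω) : ℝ :=
  ((evalMatrix p.2 F - evalMatrix p.1 F) * (evalMatrix p.2 F - evalMatrix p.1 F) *
      Φ p.2).trace.re +
    ((evalMatrix p.2 F - evalMatrix p.1 F) * (evalMatrix p.2 F - evalMatrix p.1 F) *
      Φ p.1).trace.re

theorem integrable_re_trace_increment_sq_mul (h : ReversibleAlgebra κ μ 𝒜)
    (hΦ : ∀ i j, MemLp (fun z => Φ z i j) ∞ μ) (t : ℝ≥0) (F : Matrix n n 𝒜) {a : Ω × Ω → Ω}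
    (ha : MeasurePreserving a (μ ⊗ₘ κ t) μ) :
    Integrable (fun p => ((evalMatrix p.2 F - evalMatrix p.1 F) *
      (evalMatrix p.2 F - evalMatrix p.1 F) * Φ (a p)).trace.re) (μ ⊗ₘ κ t) :=
  integrable_re_trace_mul (h.integrable_evalMatrix_increment_sq t F)
    fun i j => (hΦ i j).comp_measurePreserving ha

theorem integrable_incrementWeight (h : ReversibleAlgebra κ μ 𝒜)
    (hΦ : ∀ i j, MemLp (fun z => Φ z i j) ∞ μ) (t : ℝ≥0) (F : Matrix n n 𝒜) :
    Integrable (h.incrementWeight F Φ) (μ ⊗ₘ κ t) :=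
  haveI := h.isMarkovKernel t
  (h.integrable_re_trace_increment_sq_mul hΦ t F
    (measurePreserving_snd_compProd (h.invariant t))).add
    (h.integrable_re_trace_increment_sq_mul hΦ t F measurePreserving_fst_compProd)

theorem integral_incrementWeight (h : ReversibleAlgebra κ μ 𝒜)
    (hΦ : ∀ i j, MemLp (fun z => Φ z i j) ∞ μ) (t : ℝ≥0) (F : Matrix n n 𝒜) :
    ∫ p, h.incrementWeight F Φ p ∂(μ ⊗ₘ κ t) = 2 * h.energy t F Φ := by
  have := h.isMarkovKernel t
  have snd_eq_fst : ∫ p, ((evalMatrix p.2 F - evalMatrix p.1 F) *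
      (evalMatrix p.2 F - evalMatrix p.1 F) * Φ p.2).trace.re ∂(μ ⊗ₘ κ t) = h.energy t F Φ := by
    rw [energy, ← (measurePreserving_swap_compProd (h.isReversible t)).integral_comp
      MeasurableEquiv.prodComm.measurableEmbedding]
    refine integral_congr_ae (ae_of_all _ fun p => ?_)
    simp only [Prod.fst_swap, Prod.snd_swap]
    rw [← neg_sub (evalMatrix p.1 F), neg_mul_neg]
  simp only [incrementWeight]
  rw [integral_add (h.integrable_re_trace_increment_sq_mul hΦ t F
    (measurePreserving_snd_compProd (h.invariant t)))
    (h.integrable_re_trace_increment_sq_mul hΦ t F measurePreserving_fst_compProd), snd_eq_fst,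
    two_mul, energy]

theorem two_mul_correlation_zero_sub (h : ReversibleAlgebra κ μ 𝒜)
    (hΦ : ∀ i j, MemLp (fun z => Φ z i j) ∞ μ) (t : ℝ≥0) (F : Matrix n n 𝒜) :
    2 * (h.correlation 0 F Φ - h.correlation t F Φ) =
      ∫ p, ((evalMatrix p.2 F - evalMatrix p.1 F) * (Φ p.2 - Φ p.1)).trace.re ∂(μ ⊗ₘ κ t) := by
  have := h.isMarkovKernel t
  have fst : MeasurePreserving Prod.fst (μ ⊗ₘ κ t) μ := measurePreserving_fst_compProd
  have snd := measurePreserving_snd_compProd (h.invariant t)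
  have swap := measurePreserving_swap_compProd (h.isReversible t)
  have integrable {a b : Ω × Ω → Ω} (ha : MeasurePreserving a (μ ⊗ₘ κ t) μ)
      (hb : MeasurePreserving b (μ ⊗ₘ κ t) μ) :
      Integrable (fun p => (evalMatrix (a p) F * Φ (b p)).trace.re) (μ ⊗ₘ κ t) :=
    integrable_re_trace_mul (fun i j => ha.integrable_comp_of_integrable (h.integrable (F i j)))
      fun i j => (hΦ i j).comp_measurePreserving hb
  have diagonal {a : Ω × Ω → Ω} (ha : MeasurePreserving a (μ ⊗ₘ κ t) μ) :
      ∫ p, (evalMatrix (a p) F * Φ (a p)).trace.re ∂(μ ⊗ₘ κ t) = h.correlation 0 F Φ := by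
    rw [correlation_zero]
    exact integral_comp_measurePreserving ha (integrable_re_trace_mul
      (fun i j => h.integrable (F i j)) hΦ).aestronglyMeasurable
  have off_diagonal : ∫ p, (evalMatrix p.1 F * Φ p.2).trace.re ∂(μ ⊗ₘ κ t) =
      h.correlation t F Φ := by
    rw [← h.integral_re_trace_compProd hΦ,
      ← swap.integral_comp MeasurableEquiv.prodComm.measurableEmbedding]
    rfl
  simp only [Matrix.sub_mul, Matrix.mul_sub, Matrix.trace_sub, Complex.sub_re]
  rw [integral_sub ((integrable snd snd).sub' (integrable fst snd))
      ((integrable snd fst).sub' (integrable fst fst)),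
    integral_sub (integrable snd snd) (integrable fst snd),
    integral_sub (integrable snd fst) (integrable fst fst), diagonal snd, diagonal fst,
    off_diagonal, h.integral_re_trace_compProd hΦ]
  ring

theorem correlation_zero_sub_le (h : ReversibleAlgebra κ μ 𝒜) {F G : Matrix n n 𝒜}
    (hF : F.IsHermitian) (hG : G.IsHermitian) {φ ψ : ℝ → ℝ} (hψ : ∀ a, 0 ≤ ψ a)
    (hφψ : ∀ a b, |φ a - φ b| ≤ |a - b| * ((ψ a + ψ b) / 2))
    (hΦ : ∀ i j, MemLp (fun z => cfc φ (evalMatrix z F) i j) ∞ μ)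
    (hΨ : ∀ i j, MemLp (fun z => cfc ψ (evalMatrix z F) i j) ∞ μ) (t : ℝ≥0) {σ : ℝ} (hσ : 0 < σ) :
    h.correlation 0 G (fun z => cfc φ (evalMatrix z F)) -
        h.correlation t G (fun z => cfc φ (evalMatrix z F)) ≤
      σ / 4 * h.energy t F (fun z => cfc ψ (evalMatrix z F)) +
        σ⁻¹ / 4 * h.energy t G fun z => cfc ψ (evalMatrix z F) := by
  have := h.isMarkovKernel t
  have fst : MeasurePreserving Prod.fst (μ ⊗ₘ κ t) μ := measurePreserving_fst_compProd
  have snd := measurePreserving_snd_compProd (h.invariant t)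
  have mean_value : ∫ p, ((evalMatrix p.2 G - evalMatrix p.1 G) *
        (cfc φ (evalMatrix p.2 F) - cfc φ (evalMatrix p.1 F))).trace.re ∂(μ ⊗ₘ κ t) ≤
      ∫ p, (σ / 4 * h.incrementWeight F (fun z => cfc ψ (evalMatrix z F)) p +
        σ⁻¹ / 4 * h.incrementWeight G (fun z => cfc ψ (evalMatrix z F)) p) ∂(μ ⊗ₘ κ t) := by
    refine integral_mono (integrable_re_trace_mul (fun i j =>
      (h.memLp_evalMatrix_increment t G i j).integrable one_le_two) fun i j =>
        ((hΦ i j).comp_measurePreserving snd).sub ((hΦ i j).comp_measurePreserving fst))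
      (((h.integrable_incrementWeight hΨ t F).const_mul _).add
        ((h.integrable_incrementWeight hΨ t G).const_mul _)) fun p => ?_
    exact re_trace_mul_cfc_sub_cfc_le (isHermitian_evalMatrix hF p.2)
      (isHermitian_evalMatrix hF p.1)
      ((isHermitian_evalMatrix hG p.2).sub (isHermitian_evalMatrix hG p.1)) hψ hφψ hσ
  rw [← h.two_mul_correlation_zero_sub hΦ,
    integral_add ((h.integrable_incrementWeight hΨ t F).const_mul _)
      ((h.integrable_incrementWeight hΨ t G).const_mul _), integral_const_mul,
    integral_const_mul, h.integral_incrementWeight hΨ, h.integral_incrementWeight hΨ] at mean_value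
  linarith

end ReversibleAlgebra

section Ergodicity

variable {Ω : Type*} [MeasurableSpace Ω] {κ : ℝ≥0 → Kernel Ω Ω} {μ : Measure Ω}
  [IsProbabilityMeasure μ]

theorem IsErgodic.tendsto_eLpNorm_complex (herg : IsErgodic κ μ) (hκ : IsMarkovSemigroup κ)
    (hμ : ∀ t, (κ t).Invariant μ) {f : Ω → ℂ} (hf : MemLp f 2 μ) :
    Tendsto (fun t => eLpNorm (fun z => semigroup κ t f z - ∫ y, f y ∂μ) 2 μ) atTop (𝓝 0) := by
  have sum_tendsto := (herg _ hf.re).add (herg _ hf.im)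
  rw [add_zero] at sum_tendsto
  refine tendsto_of_tendsto_of_tendsto_of_le_of_le tendsto_const_nhds sum_tendsto
    (fun t => zero_le) fun t => ?_
  have := hκ.markov t
  have hf_int : Integrable f μ := hf.integrable one_le_two
  have memLp {g : Ω → ℝ} (hg : MemLp g 2 μ) :
      MemLp (fun z => semigroup κ t g z - ∫ y, g y ∂μ) 2 μ :=
    (memLp_integral_kernel (hμ t) one_le_two hg).sub (memLp_const _)
  refine le_trans (eLpNorm_mono_ae_real (g := fun z =>
    ‖semigroup κ t (fun y => (f y).re) z - ∫ y, (f y).re ∂μ‖ +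
      ‖semigroup κ t (fun y => (f y).im) z - ∫ y, (f y).im ∂μ‖) ?_)
    ((eLpNorm_add_le (memLp hf.re).norm.1 (memLp hf.im).norm.1 one_le_two).trans_eq ?_)
  · filter_upwards [ae_integrable_of_invariant (hμ t) hf_int] with z hz
    refine (Complex.norm_le_abs_re_add_abs_im _).trans_eq ?_
    have re_eq : ∀ {ν : Measure Ω}, Integrable f ν → (∫ y, f y ∂ν).re = ∫ y, (f y).re ∂ν :=
      fun h => (integral_re h).symm
    have im_eq : ∀ {ν : Measure Ω}, Integrable f ν → (∫ y, f y ∂ν).im = ∫ y, (f y).im ∂ν :=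
      fun h => (integral_im h).symm
    simp only [semigroup, Complex.sub_re, Complex.sub_im, re_eq hz, re_eq hf_int, im_eq hz,
      im_eq hf_int, Real.norm_eq_abs]
  · rw [eLpNorm_norm, eLpNorm_norm]

namespace ReversibleAlgebra

variable {n : Type*} [Fintype n] [DecidableEq n] {𝒜 : StarSubalgebra ℂ (Ω → ℂ)}
  {Φ : Ω → Matrix n n ℂ}

theorem tendsto_lpSemigroup_toLp (h : ReversibleAlgebra κ μ 𝒜) (herg : IsErgodic κ μ) (u : 𝒜) :
    Tendsto (fun t => lpSemigroup h.markovSemigroup h.invariant 1 t (h.toLp one_le_two u)) atTop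
      (𝓝 (h.toLp one_le_two (algebraMap ℂ 𝒜 (∫ z, (u : Ω → ℂ) z ∂μ)))) := by
  simp only [← toLp_evolve]
  refine (Lp.tendsto_Lp_iff_tendsto_eLpNorm'' _ (fun t => h.memLp one_le_two (h.evolve t u)) _
    (h.memLp one_le_two _)).2 ?_
  refine tendsto_of_tendsto_of_tendsto_of_le_of_le tendsto_const_nhds
    (herg.tendsto_eLpNorm_complex h.markovSemigroup h.invariant (h.memLp le_rfl u))
    (fun t => zero_le) fun t => ?_
  exact eLpNorm_le_eLpNorm_of_exponent_le one_le_two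
    ((h.memLp le_rfl (h.evolve t u)).sub (memLp_const _)).1

theorem tendsto_correlation (h : ReversibleAlgebra κ μ 𝒜) (herg : IsErgodic κ μ)
    (hΦ : ∀ i j, MemLp (fun z => Φ z i j) ∞ μ) {F : Matrix n n 𝒜}
    (hF : ∀ i j, ∫ z, (F i j : Ω → ℂ) z ∂μ = 0) :
    Tendsto (fun t => h.correlation t F Φ) atTop (𝓝 0) := by
  simp only [h.correlation_eq_tracePairing hΦ]
  refine ((tracePairing hΦ).continuous.tendsto' 0 0 (map_zero _)).comp (tendsto_pi_nhds.2 fun i =>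
    tendsto_pi_nhds.2 fun j => ?_)
  have entry_tendsto := h.tendsto_lpSemigroup_toLp herg (F i j)
  rwa [hF, map_zero, map_zero] at entry_tendsto

end ReversibleAlgebra

end Ergodicity

namespace ReversibleAlgebra

section Covariance

variable {Ω n : Type*} [MeasurableSpace Ω] [Fintype n] [DecidableEq n] {κ : ℝ≥0 → Kernel Ω Ω}
  {μ : Measure Ω} [IsProbabilityMeasure μ] {𝒜 : StarSubalgebra ℂ (Ω → ℂ)} {φ ψ : ℝ → ℝ}

theorem frequently_slope_neg_correlation_lt (h : ReversibleAlgebra κ μ 𝒜) {F : Matrix n n 𝒜}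
    (hF : F.IsHermitian) (hψ : ∀ a, 0 ≤ ψ a)
    (hφψ : ∀ a b, |φ a - φ b| ≤ |a - b| * ((ψ a + ψ b) / 2))
    (hΦ : ∀ i j, MemLp (fun z => cfc φ (evalMatrix z F) i j) ∞ μ)
    (hΨ : ∀ i j, MemLp (fun z => cfc ψ (evalMatrix z F) i j) ∞ μ) {s σ r : ℝ} (hs : 0 ≤ s)
    (hσ : 0 < σ)
    (hr : σ / 2 * h.correlation 0 (h.carreMatrix F F) (fun z => cfc ψ (evalMatrix z F)) +
      σ⁻¹ / 2 * h.correlation 0 (h.carreMatrix (F.map (h.evolve s.toNNReal))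
        (F.map (h.evolve s.toNNReal))) (fun z => cfc ψ (evalMatrix z F)) < r) :
    ∃ᶠ y in 𝓝[>] s,
      slope (fun s => -h.correlation s.toNNReal F fun z => cfc φ (evalMatrix z F)) s y < r := by
  set G := F.map (h.evolve s.toNNReal)
  have energy_tendsto := (((h.tendsto_energy hΨ F).const_mul (σ / 2)).add
    ((h.tendsto_energy hΨ G).const_mul (σ⁻¹ / 2))).comp (tendsto_toNNReal_sub_nhdsGT s)
  refine Eventually.frequently ?_
  filter_upwards [energy_tendsto.eventually_lt_const hr, self_mem_nhdsWithin] with y energy_lt hsy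
  refine lt_of_le_of_lt ?_ energy_lt
  have hsy : 0 < y - s := sub_pos.2 hsy
  have toNNReal_eq : (y - s).toNNReal + s.toNNReal = y.toNNReal := by
    rw [← Real.toNNReal_add hsy.le hs, sub_add_cancel]
  have increment_le := h.correlation_zero_sub_le hF (h.isHermitian_map_evolve s.toNNReal hF) hψ hφψ
    hΦ hΨ (y - s).toNNReal hσ
  rw [h.correlation_map_evolve hΦ, h.correlation_map_evolve hΦ, zero_add, toNNReal_eq]
    at increment_le
  simp only [Function.comp_apply, Real.coe_toNNReal _ hsy.le]
  rw [slope_def_field, neg_sub_neg, div_le_iff₀ hsy]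
  refine increment_le.trans_eq ?_
  field_simp
  ring

variable {d : ℕ} {F : Matrix (Fin d) (Fin d) 𝒜} {c B : ℝ}

theorem half_mul_correlation_carreMatrix_add_le (h : ReversibleAlgebra κ μ 𝒜) (hc : 0 < c)
    (hBE : BakryEmery κ μ 𝒜 d c) (hF : F.IsHermitian) (hψ : ∀ a, 0 ≤ ψ a)
    (hΨ : ∀ i j, MemLp (fun z => cfc ψ (evalMatrix z F) i j) ∞ μ)
    (hB : ∀ t, h.correlation t (h.carreMatrix F F) (fun z => cfc ψ (evalMatrix z F)) ≤ B)
    (s : ℝ≥0) :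
    Real.exp (-s / c) / 2 * h.correlation 0 (h.carreMatrix F F)
        (fun z => cfc ψ (evalMatrix z F)) +
      (Real.exp (-s / c))⁻¹ / 2 * h.correlation 0 (h.carreMatrix (F.map (h.evolve s))
        (F.map (h.evolve s))) (fun z => cfc ψ (evalMatrix z F)) ≤ B * Real.exp (-s / c) := by
  have contraction := (h.correlation_carreMatrix_map_evolve_le hc hBE hΨ (fun z X hX =>
    re_trace_mul_cfc_nonneg (isHermitian_evalMatrix hF z) hX hψ) s hF).trans
    (mul_le_mul_of_nonneg_left (hB s) (Real.exp_nonneg _))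
  have exp_sq : Real.exp (-(2 / c) * s) = Real.exp (-s / c) * Real.exp (-s / c) := by
    rw [← Real.exp_add]
    ring_nf
  rw [exp_sq] at contraction
  calc _ ≤ Real.exp (-s / c) / 2 * B +
      (Real.exp (-s / c))⁻¹ / 2 * (Real.exp (-s / c) * Real.exp (-s / c) * B) := by
        gcongr
        exact hB 0
    _ = B * Real.exp (-s / c) := by
        field_simp
        ring

theorem correlation_zero_sub_le_one_sub_exp (h : ReversibleAlgebra κ μ 𝒜) (hc : 0 < c)
    (hBE : BakryEmery κ μ 𝒜 d c) (hF : F.IsHermitian) (hψ : ∀ a, 0 ≤ ψ a)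
    (hφψ : ∀ a b, |φ a - φ b| ≤ |a - b| * ((ψ a + ψ b) / 2))
    (hΦ : ∀ i j, MemLp (fun z => cfc φ (evalMatrix z F) i j) ∞ μ)
    (hΨ : ∀ i j, MemLp (fun z => cfc ψ (evalMatrix z F) i j) ∞ μ)
    (hB : ∀ t, h.correlation t (h.carreMatrix F F) (fun z => cfc ψ (evalMatrix z F)) ≤ B)
    (t : ℝ≥0) :
    h.correlation 0 F (fun z => cfc φ (evalMatrix z F)) -
        h.correlation t F (fun z => cfc φ (evalMatrix z F)) ≤
      c * B * (1 - Real.exp (-t / c)) := by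
  set D : ℝ → ℝ := fun s => -h.correlation s.toNNReal F fun z => cfc φ (evalMatrix z F)
  have hasDerivAt_bound (s : ℝ) : HasDerivAt (fun s => D 0 + c * B * (1 - Real.exp (-s / c)))
      (B * Real.exp (-s / c)) s := by
    have exponent : HasDerivAt (fun s : ℝ => -s / c) (-1 / c) s := (hasDerivAt_id s).neg.div_const c
    refine (((exponent.exp.const_sub 1).const_mul (c * B)).const_add (D 0)).congr_deriv ?_
    field_simp
  have D_le := image_le_of_liminf_slope_right_le_deriv_boundary (f := D)
    ((h.continuous_correlation hΦ F).comp continuous_real_toNNReal).neg.continuousOn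
    (by simp only [neg_zero, zero_div, Real.exp_zero, sub_self, mul_zero, add_zero, le_refl])
    (fun s _ => (hasDerivAt_bound s).continuousAt.continuousWithinAt)
    (fun s _ => (hasDerivAt_bound s).hasDerivWithinAt)
    (fun s hs r hr => h.frequently_slope_neg_correlation_lt hF hψ hφψ hΦ hΨ hs.1
      (Real.exp_pos (-s / c)) (lt_of_le_of_lt ?_ hr))
    (Set.right_mem_Icc.2 t.coe_nonneg)
  · simp only [D, Real.toNNReal_zero, Real.toNNReal_coe] at D_le
    linarith
  · have half_add_le := h.half_mul_correlation_carreMatrix_add_le hc hBE hF hψ hΨ hB s.toNNReal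
    rwa [Real.coe_toNNReal s hs.1] at half_add_le

theorem correlation_zero_le (h : ReversibleAlgebra κ μ 𝒜) (herg : IsErgodic κ μ) (hc : 0 < c)
    (hBE : BakryEmery κ μ 𝒜 d c) (hF : F.IsHermitian)
    (hF_mean : ∀ i j, ∫ z, (F i j : Ω → ℂ) z ∂μ = 0) (hψ : ∀ a, 0 ≤ ψ a)
    (hφψ : ∀ a b, |φ a - φ b| ≤ |a - b| * ((ψ a + ψ b) / 2))
    (hΦ : ∀ i j, MemLp (fun z => cfc φ (evalMatrix z F) i j) ∞ μ)
    (hΨ : ∀ i j, MemLp (fun z => cfc ψ (evalMatrix z F) i j) ∞ μ)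
    (hB : ∀ t, h.correlation t (h.carreMatrix F F) (fun z => cfc ψ (evalMatrix z F)) ≤ B) :
    h.correlation 0 F (fun z => cfc φ (evalMatrix z F)) ≤ c * B := by
  have exp_tendsto : Tendsto (fun t : ℝ≥0 => Real.exp (-t / c)) atTop (𝓝 0) := by
    simp only [neg_div]
    exact Real.tendsto_exp_neg_atTop_nhds_zero.comp
      ((NNReal.tendsto_coe_atTop.2 tendsto_id).atTop_div_const hc)
  have limit_le := le_of_tendsto_of_tendsto'
    ((h.tendsto_correlation herg hΦ hF_mean).const_sub _)
    ((exp_tendsto.const_sub 1).const_mul (c * B))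
    (h.correlation_zero_sub_le_one_sub_exp hc hBE hF hψ hφψ hΦ hΨ hB)
  rwa [sub_zero, sub_zero, mul_one] at limit_le

end Covariance

end ReversibleAlgebra

section TruncatedExponential

theorem exp_sub_one_le {t : ℝ} (ht : 0 ≤ t) : Real.exp t - 1 ≤ t * ((Real.exp t + 1) / 2) := by
  let gap : ℝ → ℝ := fun s => s * ((Real.exp s + 1) / 2) - Real.exp s
  have hasDerivAt_gap (s : ℝ) : HasDerivAt gap ((1 - Real.exp s + s * Real.exp s) / 2) s := by
    refine (((hasDerivAt_id s).mul (((Real.hasDerivAt_exp s).add_const 1).div_const 2)).sub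
      (Real.hasDerivAt_exp s)).congr_deriv ?_
    simp only [id]
    ring
  have gap_monotone : Monotone gap := by
    refine monotone_of_deriv_nonneg (fun s => (hasDerivAt_gap s).differentiableAt) fun s => ?_
    rw [(hasDerivAt_gap s).deriv]
    have tangent := mul_le_mul_of_nonneg_right (Real.add_one_le_exp (-s)) (Real.exp_pos s).le
    rw [← Real.exp_add, neg_add_cancel, Real.exp_zero] at tangent
    linarith
  have gap_le := gap_monotone ht
  simp only [gap, Real.exp_zero] at gap_le
  linarith

theorem abs_exp_sub_exp_le (x y : ℝ) :
    |Real.exp x - Real.exp y| ≤ |x - y| * ((Real.exp x + Real.exp y) / 2) := by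
  wlog hxy : y ≤ x generalizing x y
  · rw [abs_sub_comm, abs_sub_comm x, add_comm]
    exact this y x (le_of_not_ge hxy)
  have exp_x : Real.exp x = Real.exp (x - y) * Real.exp y := by rw [← Real.exp_add, sub_add_cancel]
  have scaled := mul_le_mul_of_nonneg_right (exp_sub_one_le (sub_nonneg.2 hxy)) (Real.exp_pos y).le
  rw [abs_of_nonneg (sub_nonneg.2 (Real.exp_le_exp.2 hxy)), abs_of_nonneg (sub_nonneg.2 hxy), exp_x]
  linarith

/-- The exponential `x ↦ exp (θ x)` frozen from `x = N` on. For `θ ≥ 0` it is bounded, so that it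
yields bounded weights even where `f` is unbounded. -/
noncomputable def truncExp (θ N x : ℝ) : ℝ := Real.exp (θ * min x N)

variable {θ N : ℝ}

theorem continuous_truncExp (θ N : ℝ) : Continuous (truncExp θ N) := by
  unfold truncExp; fun_prop

theorem truncExp_pos (θ N x : ℝ) : 0 < truncExp θ N x := Real.exp_pos _

theorem truncExp_zero (N x : ℝ) : truncExp 0 N x = 1 := by rw [truncExp, zero_mul, Real.exp_zero]

theorem abs_truncExp_le (hθ : 0 ≤ θ) (N x : ℝ) : |truncExp θ N x| ≤ Real.exp (θ * N) := by
  rw [abs_of_pos (truncExp_pos θ N x), truncExp]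
  gcongr
  exact min_le_right x N

theorem abs_truncExp_sub_le (hθ : 0 ≤ θ) (N a b : ℝ) :
    |truncExp θ N a - truncExp θ N b| ≤
      |a - b| * ((θ * truncExp θ N a + θ * truncExp θ N b) / 2) := by
  have exponent_le : |θ * min a N - θ * min b N| ≤ θ * |a - b| := by
    rw [← mul_sub, abs_mul, abs_of_nonneg hθ]
    refine mul_le_mul_of_nonneg_left ?_ hθ
    simpa only [sub_self, abs_zero, max_eq_left (abs_nonneg (a - b))] using
      abs_min_sub_min_le_max a N b N
  calc |truncExp θ N a - truncExp θ N b|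
      ≤ |θ * min a N - θ * min b N| * ((truncExp θ N a + truncExp θ N b) / 2) :=
        abs_exp_sub_exp_le _ _
    _ ≤ θ * |a - b| * ((truncExp θ N a + truncExp θ N b) / 2) := by
        gcongr
        linarith [truncExp_pos θ N a, truncExp_pos θ N b]
    _ = _ := by ring

theorem abs_min_mul_truncExp_le (hθ : 0 ≤ θ) (hN : 0 ≤ N) (x : ℝ) :
    |min x N * truncExp θ N x| ≤ Real.exp (θ * N) * (1 + x ^ 2) := by
  have abs_min_le : |min x N| ≤ 1 + x ^ 2 := by
    rw [abs_le]
    exact ⟨le_min (by nlinarith [sq_nonneg (x + 1)]) (by nlinarith [sq_nonneg x]),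
      (min_le_left x N).trans (by nlinarith [sq_nonneg (x - 1)])⟩
  rw [abs_mul, mul_comm]
  gcongr
  exact abs_truncExp_le hθ N x

theorem hasDerivAt_truncExp (θ N x : ℝ) :
    HasDerivAt (fun θ => truncExp θ N x) (min x N * truncExp θ N x) θ :=
  (((hasDerivAt_id θ).mul_const (min x N)).exp).congr_deriv (by
    rw [one_mul, mul_comm, truncExp, id])

theorem tendsto_truncExp_natCast (θ x : ℝ) :
    Tendsto (fun k : ℕ => truncExp θ k x) atTop (𝓝 (Real.exp (θ * x))) := by
  refine tendsto_const_nhds.congr' ?_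
  filter_upwards [tendsto_natCast_atTop_atTop.eventually_ge_atTop x] with k hk
  rw [truncExp, min_eq_left hk]

end TruncatedExponential

section LogarithmicDifferentialInequality

variable {a T : ℝ}

theorem one_sub_sqrt_le {u : ℝ} (hu : 0 < u) (hu_le : u ≤ 1) :
    1 - Real.sqrt u ≤ (1 - u) / (2 * u) := by
  obtain ⟨s, hs, rfl⟩ : ∃ s, 0 < s ∧ s ^ 2 = u := ⟨_, Real.sqrt_pos.2 hu, Real.sq_sqrt hu.le⟩
  have hs_le : s ≤ 1 := by nlinarith
  rw [Real.sqrt_sq hs.le, le_div_iff₀ (by positivity)]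
  nlinarith [mul_nonneg (mul_nonneg hs.le hs.le) (sub_nonneg.2 hs_le),
    mul_nonneg hs.le (sub_nonneg.2 hs_le)]

theorem hasDerivAt_sqrt_one_sub_mul_sq {θ : ℝ} (hθ : 0 < 1 - a * θ ^ 2) :
    HasDerivAt (fun θ => Real.sqrt (1 - a * θ ^ 2)) (-(a * θ) / Real.sqrt (1 - a * θ ^ 2)) θ := by
  have hasDerivAt_inner : HasDerivAt (fun θ : ℝ => 1 - a * θ ^ 2) (-(a * (2 * θ))) θ := by
    simpa using ((hasDerivAt_pow 2 θ).const_mul a).const_sub 1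
  refine (hasDerivAt_inner.sqrt hθ.ne').congr_deriv ?_
  have := (Real.sqrt_pos.2 hθ).ne'
  field_simp

theorem hasDerivAt_div_sqrt_one_sub_mul_sq {y : ℝ → ℝ} {y' θ : ℝ} (hy : HasDerivAt y y' θ)
    (hθ : 0 < 1 - a * θ ^ 2) :
    HasDerivAt (fun θ => y θ / Real.sqrt (1 - a * θ ^ 2))
      (((1 - a * θ ^ 2) * y' + a * θ * y θ) / Real.sqrt (1 - a * θ ^ 2) ^ 3) θ := by
  have sqrt_ne := (Real.sqrt_pos.2 hθ).ne'
  refine (hy.div (hasDerivAt_sqrt_one_sub_mul_sq hθ) sqrt_ne).congr_deriv ?_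
  nth_rw 4 [← Real.sq_sqrt hθ.le]
  field_simp
  ring

theorem le_sqrt_mul_of_deriv_le {y y' : ℝ → ℝ} (hT : 0 ≤ T) (ha : 0 ≤ a) (haT : a * T ^ 2 < 1)
    (hy_cont : ContinuousOn y (Set.Icc 0 T)) (hy : ∀ θ ∈ Set.Ioo 0 T, HasDerivAt y (y' θ) θ)
    (hy_le : ∀ θ ∈ Set.Ioo 0 T, (1 - a * θ ^ 2) * y' θ + a * θ * y θ ≤ 0) :
    y T ≤ Real.sqrt (1 - a * T ^ 2) * y 0 := by
  have radicand_pos : ∀ θ ∈ Set.Icc 0 T, 0 < 1 - a * θ ^ 2 := fun θ hθ => by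
    have : a * θ ^ 2 ≤ a * T ^ 2 := by gcongr; exacts [hθ.1, hθ.2]
    linarith
  have quotient_antitone :
      AntitoneOn (fun θ => y θ / Real.sqrt (1 - a * θ ^ 2)) (Set.Icc 0 T) := by
    refine antitoneOn_of_hasDerivWithinAt_nonpos (convex_Icc 0 T)
      (f' := fun θ => ((1 - a * θ ^ 2) * y' θ + a * θ * y θ) / Real.sqrt (1 - a * θ ^ 2) ^ 3)
      (hy_cont.div (by fun_prop) fun θ hθ => (Real.sqrt_pos.2 (radicand_pos θ hθ)).ne')
      (fun θ hθ => ?_) fun θ hθ => ?_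
    · rw [interior_Icc] at hθ
      exact (hasDerivAt_div_sqrt_one_sub_mul_sq (hy θ hθ)
        (radicand_pos θ (Set.Ioo_subset_Icc_self hθ))).hasDerivWithinAt
    · rw [interior_Icc] at hθ
      exact div_nonpos_of_nonpos_of_nonneg (hy_le θ hθ) (by positivity)
  have quotient_le : y T / Real.sqrt (1 - a * T ^ 2) ≤ y 0 := by
    simpa using quotient_antitone (Set.left_mem_Icc.2 hT) (Set.right_mem_Icc.2 hT) hT
  rwa [div_le_iff₀' (Real.sqrt_pos.2 (radicand_pos T (Set.right_mem_Icc.2 hT)))] at quotient_le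

end LogarithmicDifferentialInequality

section TraceMoments

variable {Ω n : Type*} [MeasurableSpace Ω] [Fintype n] {μ : Measure Ω}

/-- Random Hermitian matrices with measurable, square-integrable entries. -/
structure IsHermitianL2 (μ : Measure Ω) (f : Ω → Matrix n n ℂ) : Prop where
  isHermitian : ∀ z, (f z).IsHermitian
  measurable : ∀ i j, Measurable fun z => f z i j
  memLp : ∀ i j, MemLp (fun z => f z i j) 2 μ

variable [DecidableEq n]

/-- The trace moment `𝔼 tr φ(f)`, where `φ(f)` is given by the functional calculus. -/
noncomputable def traceMoment (μ : Measure Ω) (φ : ℝ → ℝ) (f : Ω → Matrix n n ℂ) : ℝ :=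
  ∫ z, (cfc φ (f z)).trace.re ∂μ

variable {f : Ω → Matrix n n ℂ} {φ : ℝ → ℝ} {θ N : ℝ}

theorem traceMoment_pos [Nonempty n] [NeZero μ] (hf : ∀ z, (f z).IsHermitian) (hφ : ∀ x, 0 < φ x)
    (hint : Integrable (fun z => (cfc φ (f z)).trace.re) μ) : 0 < traceMoment μ φ f := by
  have trace_pos (z : Ω) : 0 < (cfc φ (f z)).trace.re := re_trace_cfc_pos (hf z) hφ
  rw [traceMoment, integral_pos_iff_support_of_nonneg (fun z => (trace_pos z).le) hint,
    Set.eq_univ_of_forall (s := Function.support _) fun z => (trace_pos z).ne']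
  exact Measure.measure_univ_pos.2 (NeZero.ne μ)

namespace IsHermitianL2

theorem measurable_re_trace_cfc (hf : IsHermitianL2 μ f) (hφ : Continuous φ) :
    Measurable fun z => (cfc φ (f z)).trace.re := by
  simp only [Matrix.trace, Matrix.diag_apply, Complex.re_sum]
  exact Finset.measurable_fun_sum _ fun i _ =>
    Complex.measurable_re.comp (measurable_cfc_apply hf.measurable hf.isHermitian hφ i i)

theorem memLp_cfc_apply [IsFiniteMeasure μ] (hf : IsHermitianL2 μ f) (hφ : Continuous φ) {b : ℝ}
    (hφb : ∀ x, |φ x| ≤ b) (i j : n) : MemLp (fun z => cfc φ (f z) i j) ∞ μ :=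
  memLp_top_of_bound (measurable_cfc_apply hf.measurable hf.isHermitian hφ i j).aestronglyMeasurable
    b (ae_of_all _ fun z => norm_cfc_apply_le (f z) ((abs_nonneg _).trans (hφb 0)) hφb i j)

theorem integrable_re_trace_cfc_one_add_sq [IsFiniteMeasure μ] (hf : IsHermitianL2 μ f) (a : ℝ) :
    Integrable (fun z => (cfc (fun x : ℝ => a * (1 + x ^ 2)) (f z)).trace.re) μ := by
  simp only [re_trace_cfc_const_mul (hf.isHermitian _), re_trace_cfc_add (hf.isHermitian _),
    re_trace_cfc_const (hf.isHermitian _), re_trace_cfc_sq (hf.isHermitian _), re_trace_mul_eq_sum]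
  exact ((integrable_const _).add (integrable_finsetSum _ fun i _ =>
    integrable_finsetSum _ fun j _ =>
      ((hf.memLp i j).integrable_mul (hf.memLp j i)).re)).const_mul a

theorem integrable_re_trace_cfc [IsFiniteMeasure μ] (hf : IsHermitianL2 μ f) (hφ : Continuous φ)
    {a : ℝ} (ha : ∀ x, |φ x| ≤ a * (1 + x ^ 2)) :
    Integrable (fun z => (cfc φ (f z)).trace.re) μ :=
  (hf.integrable_re_trace_cfc_one_add_sq a).mono'
    (hf.measurable_re_trace_cfc hφ).aestronglyMeasurable
    (ae_of_all _ fun z => abs_re_trace_cfc_le (hf.isHermitian z) ha)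

theorem integrable_re_trace_cfc_truncExp [IsFiniteMeasure μ] (hf : IsHermitianL2 μ f)
    (hθ : 0 ≤ θ) (N : ℝ) : Integrable (fun z => (cfc (truncExp θ N) (f z)).trace.re) μ :=
  hf.integrable_re_trace_cfc (continuous_truncExp θ N) fun x => (abs_truncExp_le hθ N x).trans
    (le_mul_of_one_le_right (Real.exp_pos _).le (le_add_of_nonneg_right (sq_nonneg x)))

theorem integrable_re_trace_cfc_min_mul_truncExp [IsFiniteMeasure μ] (hf : IsHermitianL2 μ f)
    (hθ : 0 ≤ θ) (hN : 0 ≤ N) :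
    Integrable (fun z => (cfc (fun x => min x N * truncExp θ N x) (f z)).trace.re) μ :=
  hf.integrable_re_trace_cfc ((continuous_id.min continuous_const).mul (continuous_truncExp θ N))
    (abs_min_mul_truncExp_le hθ hN)

theorem traceMoment_truncExp_pos [Nonempty n] [IsFiniteMeasure μ] [NeZero μ]
    (hf : IsHermitianL2 μ f) (hθ : 0 ≤ θ) (N : ℝ) : 0 < traceMoment μ (truncExp θ N) f :=
  traceMoment_pos hf.isHermitian (truncExp_pos θ N) (hf.integrable_re_trace_cfc_truncExp hθ N)

theorem traceMoment_truncExp_zero [IsProbabilityMeasure μ] (hf : IsHermitianL2 μ f) (N : ℝ) :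
    traceMoment μ (truncExp 0 N) f = Fintype.card n := by
  simp only [traceMoment, funext (truncExp_zero N), re_trace_cfc_const (hf.isHermitian _), mul_one,
    integral_const, probReal_univ, one_smul]

theorem hasDerivAt_traceMoment_truncExp [IsFiniteMeasure μ] (hf : IsHermitianL2 μ f) (hθ : 0 < θ)
    (hN : 0 ≤ N) :
    HasDerivAt (fun θ => traceMoment μ (truncExp θ N) f)
      (traceMoment μ (fun x => min x N * truncExp θ N x) f) θ := by
  refine (hasDerivAt_integral_of_dominated_loc_of_deriv_le (s := Metric.ball θ θ)
    (F' := fun θ z => (cfc (fun x => min x N * truncExp θ N x) (f z)).trace.re)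
    (Metric.ball_mem_nhds θ hθ)
    (Eventually.of_forall fun θ =>
      (hf.measurable_re_trace_cfc (continuous_truncExp θ N)).aestronglyMeasurable)
    (hf.integrable_re_trace_cfc_truncExp hθ.le N)
    (hf.integrable_re_trace_cfc_min_mul_truncExp hθ.le hN).1 (ae_of_all _ fun z τ hτ => ?_)
    (hf.integrable_re_trace_cfc_one_add_sq (Real.exp (2 * θ * N))) (ae_of_all _ fun z τ _ => ?_)).2
  · rw [Metric.mem_ball, Real.dist_eq, abs_lt] at hτ
    refine abs_re_trace_cfc_le (hf.isHermitian z) fun x =>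
      (abs_min_mul_truncExp_le (by linarith) hN x).trans ?_
    gcongr
    linarith
  · simp only [re_trace_cfc (hf.isHermitian z)]
    exact HasDerivAt.fun_sum fun j _ => hasDerivAt_truncExp τ N _

theorem continuousOn_traceMoment_truncExp [IsFiniteMeasure μ] (hf : IsHermitianL2 μ f)
    (hN : 0 ≤ N) (T : ℝ) :
    ContinuousOn (fun θ => traceMoment μ (truncExp θ N) f) (Set.Icc 0 T) := by
  refine continuousOn_of_dominated (bound := fun _ => Fintype.card n * Real.exp (T * N))
    (fun θ _ => (hf.measurable_re_trace_cfc (continuous_truncExp θ N)).aestronglyMeasurable)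
    (fun θ hθ => ae_of_all _ fun z => ?_) (integrable_const _) (ae_of_all _ fun z => ?_)
  · rw [← re_trace_cfc_const (hf.isHermitian z)]
    refine abs_re_trace_cfc_le (hf.isHermitian z) fun x => (abs_truncExp_le hθ.1 N x).trans ?_
    gcongr
    exact hθ.2
  · simp only [re_trace_cfc (hf.isHermitian z)]
    exact (continuous_finsetSum _ fun j _ => continuous_iff_continuousAt.2 fun θ =>
      (hasDerivAt_truncExp θ N _).continuousAt).continuousOn

end IsHermitianL2

end TraceMoments

namespace ReversibleAlgebra

section EntropicBound

variable {Ω n : Type*} [MeasurableSpace Ω] [Fintype n] [DecidableEq n] {κ : ℝ≥0 → Kernel Ω Ω}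
  {μ : Measure Ω} {𝒜 : StarSubalgebra ℂ (Ω → ℂ)} {F G : Matrix n n 𝒜} {β : ℝ} {g : ℝ → ℝ}

theorem correlation_cfc_const_mul (h : ReversibleAlgebra κ μ 𝒜) (t : ℝ≥0) (F G : Matrix n n 𝒜)
    (a : ℝ) {φ : ℝ → ℝ} (hφ : Continuous φ) :
    h.correlation t F (fun z => cfc (fun x => a * φ x) (evalMatrix z G)) =
      a * h.correlation t F (fun z => cfc φ (evalMatrix z G)) := by
  rw [correlation, correlation, ← integral_const_mul]
  refine integral_congr_ae (ae_of_all _ fun z => ?_)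
  simp only [cfc_const_mul a φ _ hφ.continuousOn, Matrix.mul_smul, Matrix.trace_smul,
    Complex.smul_re, smul_eq_mul]

variable [IsProbabilityMeasure μ]

theorem isHermitianL2_evalMatrix (h : ReversibleAlgebra κ μ 𝒜) (hF : F.IsHermitian) :
    IsHermitianL2 μ fun z => evalMatrix z F where
  isHermitian := isHermitian_evalMatrix hF
  measurable i j := h.measurable (F i j)
  memLp i j := h.memLp le_rfl (F i j)

theorem mul_correlation_cfc_exp_le (h : ReversibleAlgebra κ μ 𝒜) (hF : F.IsHermitian)
    (hG : G.IsHermitian)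
    (hΦ : ∀ i j, MemLp (fun z => cfc (fun x => Real.exp (g x)) (evalMatrix z F) i j) ∞ μ)
    (hint : Integrable (fun z => (cfc (fun x => Real.exp (g x)) (evalMatrix z F)).trace.re) μ)
    (hint_mul :
      Integrable (fun z => (cfc (fun x => g x * Real.exp (g x)) (evalMatrix z F)).trace.re) μ)
    (hint_exp : Integrable (fun z => (cfc (fun x => Real.exp (β * x)) (evalMatrix z G)).trace.re) μ)
    (ρ : ℝ) (t : ℝ≥0) :
    β * h.correlation t G (fun z => cfc (fun x => Real.exp (g x)) (evalMatrix z F)) ≤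
      Real.exp (-ρ) * traceMoment μ (fun x => Real.exp (β * x)) (fun z => evalMatrix z G) +
        (traceMoment μ (fun x => g x * Real.exp (g x)) (fun z => evalMatrix z F) +
          (ρ - 1) * traceMoment μ (fun x => Real.exp (g x)) fun z => evalMatrix z F) := by
  have := h.isMarkovKernel t
  have fst := measurePreserving_fst_compProd (μ := μ) (η := κ t)
  have snd := measurePreserving_snd_compProd (h.invariant t)
  have int_G := (snd.integrable_comp_of_integrable hint_exp).const_mul (Real.exp (-ρ))
  have int_mul := fst.integrable_comp_of_integrable hint_mul
  have int_F := (fst.integrable_comp_of_integrable hint).const_mul (ρ - 1)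
  have int_GF : Integrable (fun p : Ω × Ω =>
      (evalMatrix p.2 G * cfc (fun x => Real.exp (g x)) (evalMatrix p.1 F)).trace.re) (μ ⊗ₘ κ t) :=
    integrable_re_trace_mul (X := fun p : Ω × Ω => evalMatrix p.2 G)
      (fun i j => snd.integrable_comp_of_integrable (h.integrable (G i j)))
      fun i j => (hΦ i j).comp_measurePreserving fst
  have integral_le := integral_mono (int_GF.const_mul β) (int_G.add (int_mul.add int_F)) fun p =>
    mul_re_trace_mul_cfc_exp_le (isHermitian_evalMatrix hG p.2) (isHermitian_evalMatrix hF p.1)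
      β ρ g
  rw [integral_const_mul, h.integral_re_trace_compProd hΦ] at integral_le
  refine integral_le.trans_eq ?_
  rw [integral_add' int_G (int_mul.add int_F), integral_add' int_mul int_F, integral_const_mul,
    integral_const_mul]
  exact congrArg₂ _
    (congrArg _ (integral_comp_measurePreserving snd hint_exp.aestronglyMeasurable))
    (congrArg₂ _ (integral_comp_measurePreserving fst hint_mul.aestronglyMeasurable)
      (congrArg _ (integral_comp_measurePreserving fst hint.aestronglyMeasurable)))

end EntropicBound

end ReversibleAlgebra

namespace ReversibleAlgebra

section EntropicBound

variable {Ω n : Type*} [MeasurableSpace Ω] [Fintype n] [DecidableEq n] {κ : ℝ≥0 → Kernel Ω Ω}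
  {μ : Measure Ω} [IsProbabilityMeasure μ] {𝒜 : StarSubalgebra ℂ (Ω → ℂ)} {F G : Matrix n n 𝒜}
  {β : ℝ} {g : ℝ → ℝ}

theorem mul_correlation_cfc_exp_le_log [Nonempty n] (h : ReversibleAlgebra κ μ 𝒜)
    (hF : F.IsHermitian) (hG : G.IsHermitian)
    (hΦ : ∀ i j, MemLp (fun z => cfc (fun x => Real.exp (g x)) (evalMatrix z F) i j) ∞ μ)
    (hint : Integrable (fun z => (cfc (fun x => Real.exp (g x)) (evalMatrix z F)).trace.re) μ)
    (hint_mul :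
      Integrable (fun z => (cfc (fun x => g x * Real.exp (g x)) (evalMatrix z F)).trace.re) μ)
    (hint_exp : Integrable (fun z => (cfc (fun x => Real.exp (β * x)) (evalMatrix z G)).trace.re) μ)
    (t : ℝ≥0) :
    β * h.correlation t G (fun z => cfc (fun x => Real.exp (g x)) (evalMatrix z F)) ≤
      traceMoment μ (fun x => g x * Real.exp (g x)) (fun z => evalMatrix z F) +
        traceMoment μ (fun x => Real.exp (g x)) (fun z => evalMatrix z F) *
          (Real.log (traceMoment μ (fun x => Real.exp (β * x)) fun z => evalMatrix z G) -
            Real.log (traceMoment μ (fun x => Real.exp (g x)) fun z => evalMatrix z F)) := by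
  have moment_pos := traceMoment_pos (isHermitian_evalMatrix hF) (fun x => Real.exp_pos (g x)) hint
  have moment_exp_pos :=
    traceMoment_pos (isHermitian_evalMatrix hG) (fun x => Real.exp_pos (β * x)) hint_exp
  -- The multiplier at which the two entropic terms balance.
  refine (h.mul_correlation_cfc_exp_le hF hG hΦ hint hint_mul hint_exp
    (Real.log (traceMoment μ (fun x => Real.exp (β * x)) fun z => evalMatrix z G) -
      Real.log (traceMoment μ (fun x => Real.exp (g x)) fun z => evalMatrix z F)) t).trans_eq ?_
  rw [neg_sub, Real.exp_sub, Real.exp_log moment_pos, Real.exp_log moment_exp_pos,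
    div_mul_cancel₀ _ moment_exp_pos.ne']
  ring

theorem traceMoment_id_carreMatrix_nonneg (h : ReversibleAlgebra κ μ 𝒜) (hF : F.IsHermitian) :
    0 ≤ traceMoment μ (fun x => x) fun z => evalMatrix z (h.carreMatrix F F) := by
  have hΦ : ∀ i j, MemLp (fun _ : Ω => (1 : Matrix n n ℂ) i j) ∞ μ := fun i j => memLp_const _
  have correlation_nonneg : 0 ≤ h.correlation 0 (h.carreMatrix F F) fun _ => 1 := by
    refine ge_of_tendsto' (h.tendsto_energy hΦ F) fun t => mul_nonneg (by positivity)
      (integral_nonneg fun p => ?_)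
    simp only [mul_one]
    exact re_trace_mul_self_nonneg
      ((isHermitian_evalMatrix hF p.2).sub (isHermitian_evalMatrix hF p.1))
  refine correlation_nonneg.trans_eq ?_
  rw [correlation_zero, traceMoment]
  refine integral_congr_ae (ae_of_all _ fun z => ?_)
  simp only [mul_one,
    cfc_id' ℝ _ (isHermitian_evalMatrix (h.isHermitian_carreMatrix hF) z).isSelfAdjoint]

theorem card_le_traceMoment_exp_carreMatrix (h : ReversibleAlgebra κ μ 𝒜) (hF : F.IsHermitian)
    (hβ : 0 ≤ β)
    (hint : Integrable
      (fun z => (cfc (fun x => Real.exp (β * x)) (evalMatrix z (h.carreMatrix F F))).trace.re) μ) :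
    Fintype.card n ≤
      traceMoment μ (fun x => Real.exp (β * x)) fun z => evalMatrix z (h.carreMatrix F F) := by
  have hΓ := isHermitian_evalMatrix (h.isHermitian_carreMatrix hF)
  have int_Γ : Integrable
      (fun z => (cfc (fun x : ℝ => x) (evalMatrix z (h.carreMatrix F F))).trace.re) μ :=
    (h.isHermitianL2_evalMatrix (h.isHermitian_carreMatrix hF)).integrable_re_trace_cfc
      (φ := fun x => x) (a := 1) continuous_id fun x => by
        rw [abs_le]
        constructor <;> nlinarith [sq_nonneg (x + 1), sq_nonneg (x - 1)]
  calc (Fintype.card n : ℝ)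
      ≤ Fintype.card n + β * traceMoment μ (fun x => x) fun z => evalMatrix z (h.carreMatrix F F) :=
        le_add_of_nonneg_right (mul_nonneg hβ (h.traceMoment_id_carreMatrix_nonneg hF))
    _ = ∫ z, Fintype.card n +
          β * (cfc (fun x => x) (evalMatrix z (h.carreMatrix F F))).trace.re ∂μ := by
        rw [integral_add (integrable_const _) (int_Γ.const_mul β), integral_const_mul,
          integral_const, probReal_univ, one_smul, traceMoment]
    _ ≤ _ := by
        refine integral_mono ((integrable_const _).add (int_Γ.const_mul β)) hint fun z => ?_
        simp only
        rw [← re_trace_cfc_const_mul (hΓ z), ← mul_one (Fintype.card n : ℝ),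
          ← re_trace_cfc_const (hΓ z), ← re_trace_cfc_add (hΓ z)]
        exact re_trace_cfc_mono (hΓ z) fun x => by linarith [Real.add_one_le_exp (β * x)]

end EntropicBound

section DifferentialInequality

variable {Ω : Type*} [MeasurableSpace Ω] {κ : ℝ≥0 → Kernel Ω Ω} {μ : Measure Ω}
  [IsProbabilityMeasure μ] {𝒜 : StarSubalgebra ℂ (Ω → ℂ)} {d : ℕ}
  {F : Matrix (Fin d) (Fin d) 𝒜} {c β θ N : ℝ}

theorem traceMoment_min_mul_truncExp_le_correlation (h : ReversibleAlgebra κ μ 𝒜)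
    (hF : F.IsHermitian) (hθ : 0 ≤ θ) (hN : 0 ≤ N) :
    traceMoment μ (fun x => min x N * truncExp θ N x) (fun z => evalMatrix z F) ≤
      h.correlation 0 F fun z => cfc (truncExp θ N) (evalMatrix z F) := by
  have hf := h.isHermitianL2_evalMatrix hF
  rw [correlation_zero]
  refine integral_mono (hf.integrable_re_trace_cfc_min_mul_truncExp hθ hN)
    (integrable_re_trace_mul (fun i j => h.integrable (F i j))
      (hf.memLp_cfc_apply (continuous_truncExp θ N) (abs_truncExp_le hθ N))) fun z => ?_
  simp only [re_trace_mul_cfc_self (hf.isHermitian z)]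
  exact re_trace_cfc_mono (hf.isHermitian z) fun x =>
    mul_le_mul_of_nonneg_right (min_le_left x N) (truncExp_pos θ N x).le

variable [NeZero d]

theorem traceMoment_min_mul_truncExp_le (h : ReversibleAlgebra κ μ 𝒜) (herg : IsErgodic κ μ)
    (hc : 0 < c) (hBE : BakryEmery κ μ 𝒜 d c) (hF : F.IsHermitian)
    (hF_mean : ∀ i j, ∫ z, (F i j : Ω → ℂ) z ∂μ = 0) (hβ : 0 < β)
    (hint : Integrable
      (fun z => (cfc (fun x => Real.exp (β * x)) (evalMatrix z (h.carreMatrix F F))).trace.re) μ)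
    (hθ : 0 ≤ θ) (hN : 0 ≤ N) :
    traceMoment μ (fun x => min x N * truncExp θ N x) (fun z => evalMatrix z F) ≤
      c * (θ * (β⁻¹ *
        (θ * traceMoment μ (fun x => min x N * truncExp θ N x) (fun z => evalMatrix z F) +
          traceMoment μ (truncExp θ N) (fun z => evalMatrix z F) *
            (Real.log (traceMoment μ (fun x => Real.exp (β * x))
                fun z => evalMatrix z (h.carreMatrix F F)) -
              Real.log (traceMoment μ (truncExp θ N) fun z => evalMatrix z F))))) := by
  have hf := h.isHermitianL2_evalMatrix hF
  have hφ := hf.memLp_cfc_apply (continuous_truncExp θ N) (abs_truncExp_le hθ N)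
  have exponent_trace : ∀ z,
      (cfc (fun x => θ * min x N * Real.exp (θ * min x N)) (evalMatrix z F)).trace.re =
        θ * (cfc (fun x => min x N * truncExp θ N x) (evalMatrix z F)).trace.re := fun z => by
    rw [← re_trace_cfc_const_mul (hf.isHermitian z)]
    simp only [truncExp, mul_assoc]
  have hint_mul : Integrable (fun z =>
      (cfc (fun x => θ * min x N * Real.exp (θ * min x N)) (evalMatrix z F)).trace.re) μ := by
    simp only [exponent_trace]
    exact (hf.integrable_re_trace_cfc_min_mul_truncExp hθ hN).const_mul θ
  refine (h.traceMoment_min_mul_truncExp_le_correlation hF hθ hN).trans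
    (h.correlation_zero_le herg hc hBE hF hF_mean
      (fun x => mul_nonneg hθ (truncExp_pos θ N x).le) (abs_truncExp_sub_le hθ N) hφ
      (hf.memLp_cfc_apply (φ := fun x => θ * truncExp θ N x) (b := |θ| * Real.exp (θ * N))
        (continuous_const.mul (continuous_truncExp θ N)) fun x => ?_) fun t => ?_)
  · rw [abs_mul]
    exact mul_le_mul_of_nonneg_left (abs_truncExp_le hθ N x) (abs_nonneg θ)
  · rw [h.correlation_cfc_const_mul t _ _ _ (continuous_truncExp θ N)]
    refine mul_le_mul_of_nonneg_left ?_ hθ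
    have entropic_bound := h.mul_correlation_cfc_exp_le_log hF (h.isHermitian_carreMatrix hF) hφ
      (hf.integrable_re_trace_cfc_truncExp hθ N) hint_mul hint t
    rw [traceMoment, integral_congr_ae (ae_of_all _ exponent_trace), integral_const_mul]
      at entropic_bound
    exact (le_inv_mul_iff₀ hβ).2 entropic_bound

theorem log_traceMoment_truncExp_le (h : ReversibleAlgebra κ μ 𝒜) (herg : IsErgodic κ μ)
    (hc : 0 < c) (hBE : BakryEmery κ μ 𝒜 d c) (hF : F.IsHermitian)
    (hF_mean : ∀ i j, ∫ z, (F i j : Ω → ℂ) z ∂μ = 0) (hβ : 0 < β)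
    (hint : Integrable
      (fun z => (cfc (fun x => Real.exp (β * x)) (evalMatrix z (h.carreMatrix F F))).trace.re) μ)
    (hθ : 0 ≤ θ) (hθ_lt : c / β * θ ^ 2 < 1) (hN : 0 ≤ N) :
    Real.log (traceMoment μ (truncExp θ N) fun z => evalMatrix z F) - Real.log d ≤
      c / β * θ ^ 2 / (2 * (1 - c / β * θ ^ 2)) *
        (Real.log (traceMoment μ (fun x => Real.exp (β * x))
          fun z => evalMatrix z (h.carreMatrix F F)) - Real.log d) := by
  have hf := h.isHermitianL2_evalMatrix hF
  set logZ := Real.log (traceMoment μ (fun x => Real.exp (β * x))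
    fun z => evalMatrix z (h.carreMatrix F F))
  have log_le : Real.log d ≤ logZ := by
    refine Real.log_le_log (Nat.cast_pos.2 (NeZero.pos d)) ?_
    simpa only [Fintype.card_fin] using h.card_le_traceMoment_exp_carreMatrix hF hβ.le hint
  have ode := le_sqrt_mul_of_deriv_le hθ (div_pos hc hβ).le hθ_lt
    (y := fun θ => Real.log (traceMoment μ (truncExp θ N) fun z => evalMatrix z F) - logZ)
    (((hf.continuousOn_traceMoment_truncExp hN θ).log fun t ht =>
      (hf.traceMoment_truncExp_pos ht.1 N).ne').sub continuousOn_const)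
    (fun t ht => ((hf.hasDerivAt_traceMoment_truncExp ht.1 hN).log
      (hf.traceMoment_truncExp_pos ht.1.le N).ne').sub_const logZ)
    fun t ht => by
      have moment_pos := hf.traceMoment_truncExp_pos ht.1.le N
      have moment_le :=
        h.traceMoment_min_mul_truncExp_le herg hc hBE hF hF_mean hβ hint ht.1.le hN
      rw [← mul_div_assoc, div_add' _ _ _ moment_pos.ne']
      refine div_nonpos_of_nonpos_of_nonneg ?_ moment_pos.le
      rw [div_eq_mul_inv c β]
      linarith
  simp only [hf.traceMoment_truncExp_zero, Fintype.card_fin] at ode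
  have sqrt_le := mul_le_mul_of_nonneg_right
    (one_sub_sqrt_le (sub_pos.2 hθ_lt) (sub_le_self 1 (by positivity))) (sub_nonneg.2 log_le)
  rw [sub_sub_cancel] at sqrt_le
  linarith

end DifferentialInequality

end ReversibleAlgebra

namespace ReversibleAlgebra

section Centering

variable {Ω n : Type*} [MeasurableSpace Ω] [Fintype n] [DecidableEq n] {κ : ℝ≥0 → Kernel Ω Ω}
  {μ : Measure Ω} [IsProbabilityMeasure μ] {𝒜 : StarSubalgebra ℂ (Ω → ℂ)}

theorem gammaLp_eq_zero (h : ReversibleAlgebra κ μ 𝒜) {u v : 𝒜}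
    (huv : ∀ z y, ((u : Ω → ℂ) y - (u : Ω → ℂ) z) * ((v : Ω → ℂ) y - (v : Ω → ℂ) z) = 0) :
    h.gammaLp u v = 0 := by
  refine tendsto_nhds_unique (h.tendsto_condIncrement u v) (tendsto_const_nhds.congr fun t => ?_)
  have condIncrement_ae_eq_zero : (h.condIncrement t u v : Ω → ℂ) =ᵐ[μ] 0 := by
    filter_upwards [h.condIncrement_ae_eq t u v] with z hz
    simp only [hz, huv, integral_zero, Pi.zero_apply]
  rw [Lp.ext ((h.coeFn_toLp one_le_two _).trans
    (condIncrement_ae_eq_zero.trans (Lp.coeFn_zero ℂ 1 μ).symm)), smul_zero]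

theorem gammaLp_algebraMap_left (h : ReversibleAlgebra κ μ 𝒜) (a : ℂ) (v : 𝒜) :
    h.gammaLp (algebraMap ℂ 𝒜 a) v = 0 :=
  h.gammaLp_eq_zero fun _ _ => mul_eq_zero_of_left (sub_self a) _

theorem gammaLp_algebraMap_right (h : ReversibleAlgebra κ μ 𝒜) (u : 𝒜) (a : ℂ) :
    h.gammaLp u (algebraMap ℂ 𝒜 a) = 0 :=
  h.gammaLp_eq_zero fun _ _ => mul_eq_zero_of_right _ (sub_self a)

theorem ae_evalMatrix_eq (h : ReversibleAlgebra κ μ 𝒜) {F G : Matrix n n 𝒜}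
    (hFG : ∀ i j, h.toLp one_le_two (F i j) = h.toLp one_le_two (G i j)) :
    ∀ᵐ z ∂μ, evalMatrix z F = evalMatrix z G := by
  have entry_ae_eq : ∀ i j, ∀ᵐ z ∂μ, (F i j : Ω → ℂ) z = (G i j : Ω → ℂ) z := fun i j => by
    have coeFn_toLp := h.coeFn_toLp one_le_two (F i j)
    rw [hFG] at coeFn_toLp
    exact coeFn_toLp.symm.trans (h.coeFn_toLp one_le_two _)
  filter_upwards [ae_all_iff.2 fun i => ae_all_iff.2 (entry_ae_eq i)] with z hz
  exact Matrix.ext hz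

theorem ae_evalMatrix_carreMatrix_sub_algebraMap (h : ReversibleAlgebra κ μ 𝒜)
    (F : Matrix n n 𝒜) (m : Matrix n n ℂ) :
    ∀ᵐ z ∂μ, evalMatrix z (h.carreMatrix (F - m.map (algebraMap ℂ 𝒜))
      (F - m.map (algebraMap ℂ 𝒜))) = evalMatrix z (h.carreMatrix F F) :=
  h.ae_evalMatrix_eq fun i j => by
    simp only [toLp_carreMatrix, Matrix.sub_apply, Matrix.map_apply, map_sub,
      LinearMap.sub_apply, gammaLp_algebraMap_left, gammaLp_algebraMap_right, sub_zero]

end Centering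

end ReversibleAlgebra

section Mean

variable {Ω : Type*} [MeasurableSpace Ω] {μ : Measure Ω} {d : ℕ} {𝒜 : StarSubalgebra ℂ (Ω → ℂ)}
  {f : Ω → Matrix (Fin d) (Fin d) ℂ}

theorem isHermitian_matMean (hf : ∀ z, (f z).IsHermitian) : (matMean μ f).IsHermitian := by
  ext i j
  simp only [Matrix.conjTranspose_apply, matMean, Matrix.of_apply]
  rw [← starRingEnd_apply, ← integral_conj]
  exact integral_congr_ae (ae_of_all _ fun z => (hf z).apply i j)

theorem matMean_neg : matMean μ (-f) = -matMean μ f := by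
  ext i j
  simp only [matMean, Matrix.of_apply, Pi.neg_apply, Matrix.neg_apply, integral_neg]

theorem logTraceMgf_neg (θ : ℝ) : logTraceMgf μ (-f) (-θ) = logTraceMgf μ f θ := by
  simp only [logTraceMgf, matMean_neg, Pi.neg_apply, Complex.ofReal_neg, ← neg_sub', neg_smul_neg]

end Mean

section ExpMoment

variable {Ω : Type*} [MeasurableSpace Ω] {μ : Measure Ω} {d : ℕ}
  {f : Ω → Matrix (Fin d) (Fin d) ℂ} {θ b : ℝ}

theorem expMoment_smul_congr_ae {g : Ω → Matrix (Fin d) (Fin d) ℂ} (hfg : ∀ᵐ z ∂μ, f z = g z)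
    (θ : ℝ) : expMoment μ (fun z => (θ : ℂ) • f z) = expMoment μ fun z => (θ : ℂ) • g z := by
  refine lintegral_congr_ae ?_
  filter_upwards [hfg] with z hz
  rw [hz]

theorem expMoment_smul_eq_lintegral (hf : ∀ z, (f z).IsHermitian) (θ : ℝ) :
    expMoment μ (fun z => (θ : ℂ) • f z) =
      ∫⁻ z, ENNReal.ofReal ((cfc (fun x => Real.exp (θ * x)) (f z)).trace.re / d) ∂μ := by
  simp only [expMoment, normTrace, exp_smul_eq_cfc (hf _)]

theorem tendsto_lintegral_truncExp (hf : IsHermitianL2 μ f) (hθ : 0 ≤ θ) :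
    Tendsto (fun k : ℕ => ∫⁻ z, ENNReal.ofReal ((cfc (truncExp θ k) (f z)).trace.re / d) ∂μ)
      atTop (𝓝 (expMoment μ fun z => (θ : ℂ) • f z)) := by
  rw [expMoment_smul_eq_lintegral hf.isHermitian]
  refine lintegral_tendsto_of_tendsto_of_monotone
    (fun k => ((hf.measurable_re_trace_cfc
      (continuous_truncExp θ k)).div_const _).ennreal_ofReal.aemeasurable)
    (ae_of_all _ fun z k l hkl => ENNReal.ofReal_le_ofReal ?_)
    (ae_of_all _ fun z => ENNReal.tendsto_ofReal (Tendsto.div_const ?_ _))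
  · refine div_le_div_of_nonneg_right (re_trace_cfc_mono (hf.isHermitian z) fun x => ?_)
      d.cast_nonneg
    exact Real.exp_le_exp.2 (mul_le_mul_of_nonneg_left
      (min_le_min_left x (Nat.cast_le.2 hkl)) hθ)
  · simp only [re_trace_cfc (hf.isHermitian z)]
    exact tendsto_finsetSum _ fun j _ => tendsto_truncExp_natCast θ _

variable [NeZero d]

theorem expMoment_zero_smul [IsProbabilityMeasure μ] (f : Ω → Matrix (Fin d) (Fin d) ℂ) :
    expMoment μ (fun z => ((0 : ℝ) : ℂ) • f z) = 1 := by
  have card_ne : (d : ℝ) ≠ 0 := NeZero.ne _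
  simp [expMoment, normTrace, card_ne]

theorem re_trace_cfc_exp_div_nonneg {A : Matrix (Fin d) (Fin d) ℂ} (hA : A.IsHermitian) (θ : ℝ) :
    0 ≤ (cfc (fun x => Real.exp (θ * x)) A).trace.re / d :=
  div_nonneg (re_trace_cfc_pos hA fun x => Real.exp_pos (θ * x)).le d.cast_nonneg

theorem integrable_re_trace_cfc_exp_of_expMoment_ne_top (hf : IsHermitianL2 μ f)
    (hfin : expMoment μ (fun z => (θ : ℂ) • f z) ≠ ∞) :
    Integrable (fun z => (cfc (fun x => Real.exp (θ * x)) (f z)).trace.re) μ := by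
  have card_ne : (d : ℝ) ≠ 0 := NeZero.ne _
  have meas := hf.measurable_re_trace_cfc (φ := fun x => Real.exp (θ * x)) (by fun_prop)
  rw [expMoment_smul_eq_lintegral hf.isHermitian, lintegral_ofReal_ne_top_iff_integrable
    (meas.div_const _).aestronglyMeasurable
    (ae_of_all _ fun z => re_trace_cfc_exp_div_nonneg (hf.isHermitian z) θ)] at hfin
  simpa only [div_mul_cancel₀ _ card_ne] using hfin.mul_const (d : ℝ)

theorem expMoment_smul_eq_ofReal (hf : ∀ z, (f z).IsHermitian)
    (hint : Integrable (fun z => (cfc (fun x => Real.exp (θ * x)) (f z)).trace.re) μ) :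
    expMoment μ (fun z => (θ : ℂ) • f z) =
      ENNReal.ofReal (traceMoment μ (fun x => Real.exp (θ * x)) f / d) := by
  rw [expMoment_smul_eq_lintegral hf, traceMoment, ← integral_div,
    ofReal_integral_eq_lintegral_ofReal (hint.div_const _)
      (ae_of_all _ fun z => re_trace_cfc_exp_div_nonneg (hf z) θ)]

theorem expMoment_smul_le [IsFiniteMeasure μ] [NeZero μ] (hf : IsHermitianL2 μ f) (hθ : 0 ≤ θ)
    (hb : ∀ k : ℕ, Real.log (traceMoment μ (truncExp θ k) f) - Real.log d ≤ b) :
    expMoment μ (fun z => (θ : ℂ) • f z) ≤ ENNReal.ofReal (Real.exp b) := by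
  refine le_of_tendsto' (tendsto_lintegral_truncExp hf hθ) fun k => ?_
  have card_pos : (0 : ℝ) < d := Nat.cast_pos.2 (NeZero.pos d)
  have moment_pos := hf.traceMoment_truncExp_pos hθ k
  rw [← ofReal_integral_eq_lintegral_ofReal
    ((hf.integrable_re_trace_cfc_truncExp hθ k).div_const _)
    (ae_of_all _ fun z => div_nonneg
      (re_trace_cfc_pos (hf.isHermitian z) (truncExp_pos θ k)).le card_pos.le), integral_div]
  refine ENNReal.ofReal_le_ofReal ((Real.log_le_iff_le_exp (div_pos moment_pos card_pos)).1 ?_)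
  exact (Real.log_div moment_pos.ne' card_pos.ne').trans_le (hb k)

theorem expMoment_smul_le_of_norm_le [IsProbabilityMeasure μ] (hf : ∀ z, (f z).IsHermitian)
    (hθ : 0 ≤ θ) (hb : ∀ᵐ z ∂μ, ‖Matrix.toEuclideanCLM (𝕜 := ℂ) (f z)‖ ≤ b) :
    expMoment μ (fun z => (θ : ℂ) • f z) ≤ ENNReal.ofReal (Real.exp (θ * b)) := by
  have card_pos : (0 : ℝ) < d := Nat.cast_pos.2 (NeZero.pos d)
  rw [expMoment_smul_eq_lintegral hf]
  calc _ ≤ ∫⁻ _, ENNReal.ofReal (Real.exp (θ * b)) ∂μ := by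
        refine lintegral_mono_ae ?_
        filter_upwards [hb] with z hz
        rw [← mul_div_cancel_left₀ (Real.exp (θ * b)) card_pos.ne']
        have monotone_exp : Monotone fun x => Real.exp (θ * x) :=
          fun x y hxy => Real.exp_le_exp.2 (mul_le_mul_of_nonneg_left hxy hθ)
        gcongr
        simpa only [Fintype.card_fin] using re_trace_cfc_le_card_mul (hf z) monotone_exp hz
    _ = ENNReal.ofReal (Real.exp (θ * b)) := by rw [lintegral_const, measure_univ, mul_one]

end ExpMoment

namespace ReversibleAlgebra

variable {Ω : Type*} [MeasurableSpace Ω] {κ : ℝ≥0 → Kernel Ω Ω} {μ : Measure Ω}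
  [IsProbabilityMeasure μ] {𝒜 : StarSubalgebra ℂ (Ω → ℂ)} {d : ℕ} [NeZero d]
  {F : Matrix (Fin d) (Fin d) 𝒜} {c β θ : ℝ}

theorem log_expMoment_le (h : ReversibleAlgebra κ μ 𝒜) (herg : IsErgodic κ μ)
    (hc : 0 < c) (hBE : BakryEmery κ μ 𝒜 d c) (hF : F.IsHermitian)
    (hF_mean : ∀ i j, ∫ z, (F i j : Ω → ℂ) z ∂μ = 0) (hβ : 0 < β) (hθ : 0 ≤ θ)
    (hθ_lt : c * θ ^ 2 / β < 1)
    (hfin : expMoment μ (fun z => (β : ℂ) • evalMatrix z (h.carreMatrix F F)) ≠ ∞) :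
    ENNReal.log (expMoment μ fun z => (θ : ℂ) • evalMatrix z F) ≤
      ((c * θ ^ 2 / (2 * (1 - c * θ ^ 2 / β)) : ℝ) : EReal) * (((β⁻¹ : ℝ) : EReal) *
        ENNReal.log (expMoment μ fun z => (β : ℂ) • evalMatrix z (h.carreMatrix F F))) := by
  have card_pos : (0 : ℝ) < d := Nat.cast_pos.2 (NeZero.pos d)
  have hΓ := h.isHermitianL2_evalMatrix (h.isHermitian_carreMatrix hF)
  have hint := integrable_re_trace_cfc_exp_of_expMoment_ne_top hΓ hfin
  have moment_pos := traceMoment_pos hΓ.isHermitian (fun x => Real.exp_pos (β * x)) hint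
  have expMoment_le := expMoment_smul_le (h.isHermitianL2_evalMatrix hF) hθ fun k =>
    h.log_traceMoment_truncExp_le herg hc hBE hF hF_mean hβ hint hθ
      (by rwa [div_mul_eq_mul_div]) k.cast_nonneg
  rw [expMoment_smul_eq_ofReal hΓ.isHermitian hint,
    ENNReal.log_ofReal_of_pos (div_pos moment_pos card_pos), ← EReal.coe_mul, ← EReal.coe_mul]
  refine (ENNReal.log_monotone expMoment_le).trans ?_
  rw [ENNReal.log_ofReal_of_pos (Real.exp_pos _), Real.log_exp,
    Real.log_div moment_pos.ne' card_pos.ne', EReal.coe_le_coe_iff, div_mul_eq_mul_div]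
  exact le_of_eq (by ring)

end ReversibleAlgebra

namespace ReversibleAlgebra

variable {Ω : Type*} [MeasurableSpace Ω] {κ : ℝ≥0 → Kernel Ω Ω} {μ : Measure Ω}
  [IsProbabilityMeasure μ] {𝒜 : StarSubalgebra ℂ (Ω → ℂ)} {d : ℕ} [NeZero d]
  {f : Ω → Matrix (Fin d) (Fin d) ℂ} {F : Matrix (Fin d) (Fin d) 𝒜} {c β θ : ℝ}

theorem logTraceMgf_evalMatrix_le_of_nonneg (h : ReversibleAlgebra κ μ 𝒜) (herg : IsErgodic κ μ)
    (hc : 0 < c) (hBE : BakryEmery κ μ 𝒜 d c) (hF : F.IsHermitian) (hβ : 0 < β) (hθ : 0 ≤ θ)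
    (hθ_lt : c * θ ^ 2 / β < 1)
    (hfin : expMoment μ (fun z => (β : ℂ) • evalMatrix z (h.carreMatrix F F)) ≠ ∞) :
    logTraceMgf μ (fun z => evalMatrix z F) θ ≤
      ((c * θ ^ 2 / (2 * (1 - c * θ ^ 2 / β)) : ℝ) : EReal) * (((β⁻¹ : ℝ) : EReal) *
        ENNReal.log (expMoment μ fun z => (β : ℂ) • evalMatrix z (h.carreMatrix F F))) := by
  set m := matMean μ fun z => evalMatrix z F
  set F₀ := F - m.map (algebraMap ℂ 𝒜)
  have isHermitian_F₀ : F₀.IsHermitian :=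
    hF.sub ((isHermitian_matMean (isHermitian_evalMatrix hF)).map _ fun a => algebraMap_star_comm a)
  have mean_F₀ : ∀ i j, ∫ z, (F₀ i j : Ω → ℂ) z ∂μ = 0 := fun i j =>
    calc ∫ z, (F₀ i j : Ω → ℂ) z ∂μ = ∫ z, ((F i j : Ω → ℂ) z - m i j) ∂μ := rfl
      _ = (∫ z, (F i j : Ω → ℂ) z ∂μ) - m i j := by
        rw [integral_sub (h.integrable _) (integrable_const _), integral_const, probReal_univ,
          one_smul]
      _ = 0 := sub_self _
  have expMoment_carre :=
    expMoment_smul_congr_ae (h.ae_evalMatrix_carreMatrix_sub_algebraMap F m) β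
  have := h.log_expMoment_le herg hc hBE isHermitian_F₀ mean_F₀ hβ hθ hθ_lt
    (expMoment_carre.trans_ne hfin)
  simpa only [logTraceMgf, expMoment_carre, F₀, evalMatrix_sub_algebraMap] using this

theorem logTraceMgf_le (h : ReversibleAlgebra κ μ 𝒜) (herg : IsErgodic κ μ)
    (hc : 0 < c) (hBE : BakryEmery κ μ 𝒜 d c) (hf : IsSuitable 𝒜 f) (hβ : 0 < β)
    (hθ_lt : c * θ ^ 2 / β < 1) :
    logTraceMgf μ f θ ≤
      ((c * θ ^ 2 / (2 * (1 - c * θ ^ 2 / β)) : ℝ) : EReal) * expMean κ μ f β := by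
  wlog hθ : 0 ≤ θ generalizing θ f
  · have := this hf.neg (θ := -θ) (by rwa [neg_sq]) (neg_nonneg.2 (not_le.1 hθ).le)
    rwa [logTraceMgf_neg, neg_sq, expMean, carre_neg, ← expMean] at this
  obtain ⟨F, hF, rfl⟩ := hf.exists_evalMatrix
  rw [expMean, ← h.evalMatrix_carreMatrix F F]
  by_cases hfin : expMoment μ (fun z => (β : ℂ) • evalMatrix z (h.carreMatrix F F)) = ∞
  · rcases hθ.eq_or_lt with rfl | hθ
    · rw [logTraceMgf, expMoment_zero_smul]
      simp
    · have factor_pos : 0 < c * θ ^ 2 / (2 * (1 - c * θ ^ 2 / β)) := by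
        have := sub_pos.2 hθ_lt
        positivity
      rw [hfin, ENNReal.log_top, EReal.coe_mul_top_of_pos (inv_pos.2 hβ),
        EReal.coe_mul_top_of_pos factor_pos]
      exact le_top
  · exact h.logTraceMgf_evalMatrix_le_of_nonneg herg hc hBE hF hβ hθ hθ_lt hfin

theorem expMean_le_varianceProxy (h : ReversibleAlgebra κ μ 𝒜) (hf : IsSuitable 𝒜 f) (hβ : 0 < β)
    (hv : varianceProxy κ μ f < ∞) :
    expMean κ μ f β ≤ ((varianceProxy κ μ f).toReal : EReal) := by
  set v := (varianceProxy κ μ f).toReal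
  have isHermitian_carre : ∀ z, (carre κ f f z).IsHermitian := by
    obtain ⟨F, hF, rfl⟩ := hf.exists_evalMatrix
    rw [← h.evalMatrix_carreMatrix F F]
    exact isHermitian_evalMatrix (h.isHermitian_carreMatrix hF)
  have norm_carre_le : ∀ᵐ z ∂μ, ‖Matrix.toEuclideanCLM (𝕜 := ℂ) (carre κ f f z)‖ ≤ v := by
    filter_upwards [ae_le_eLpNormEssSup (f := fun z =>
      ‖Matrix.toEuclideanCLM (𝕜 := ℂ) (carre κ f f z)‖) (μ := μ)] with z hz
    rw [← eLpNorm_exponent_top, ← ofReal_norm, norm_norm] at hz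
    exact (ENNReal.ofReal_le_iff_le_toReal hv.ne).1 hz
  have log_expMoment_le : ENNReal.log (expMoment μ fun z => (β : ℂ) • carre κ f f z) ≤
      ((β * v : ℝ) : EReal) := by
    refine (ENNReal.log_monotone
      (expMoment_smul_le_of_norm_le isHermitian_carre hβ.le norm_carre_le)).trans_eq ?_
    rw [ENNReal.log_ofReal_of_pos (Real.exp_pos _), Real.log_exp]
  calc expMean κ μ f β ≤ ((β⁻¹ : ℝ) : EReal) * ((β * v : ℝ) : EReal) :=
        mul_le_mul_of_nonneg_left log_expMoment_le (EReal.coe_nonneg.2 (inv_nonneg.2 hβ.le))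
    _ = (v : EReal) := by rw [← EReal.coe_mul, inv_mul_cancel_left₀ hβ.ne']

theorem logTraceMgf_le_varianceProxy (h : ReversibleAlgebra κ μ 𝒜) (herg : IsErgodic κ μ)
    (hc : 0 < c) (hBE : BakryEmery κ μ 𝒜 d c) (hf : IsSuitable 𝒜 f)
    (hv : varianceProxy κ μ f < ∞) (θ : ℝ) :
    logTraceMgf μ f θ ≤ ((c * (varianceProxy κ μ f).toReal * θ ^ 2 / 2 : ℝ) : EReal) := by
  set v := (varianceProxy κ μ f).toReal
  have ratio_tendsto : Tendsto (fun β : ℝ => c * θ ^ 2 / β) atTop (𝓝 0) :=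
    tendsto_const_nhds.div_atTop tendsto_id
  have bound_tendsto : Tendsto (fun β : ℝ => c * θ ^ 2 / (2 * (1 - c * θ ^ 2 / β)) * v) atTop
      (𝓝 (c * v * θ ^ 2 / 2)) := by
    have := ((tendsto_const_nhds (x := c * θ ^ 2)).div
      ((ratio_tendsto.const_sub 1).const_mul 2) (by norm_num)).mul_const v
    rwa [show c * θ ^ 2 / (2 * (1 - 0)) * v = c * v * θ ^ 2 / 2 by ring] at this
  refine ge_of_tendsto ((continuous_coe_real_ereal.tendsto _).comp bound_tendsto) ?_
  filter_upwards [ratio_tendsto.eventually_lt_const one_pos, eventually_gt_atTop 0]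
    with β ratio_lt hβ
  have := sub_pos.2 ratio_lt
  calc logTraceMgf μ f θ
      ≤ ((c * θ ^ 2 / (2 * (1 - c * θ ^ 2 / β)) : ℝ) : EReal) * expMean κ μ f β :=
        h.logTraceMgf_le herg hc hBE hf hβ ratio_lt
    _ ≤ ((c * θ ^ 2 / (2 * (1 - c * θ ^ 2 / β)) : ℝ) : EReal) * (v : EReal) :=
        mul_le_mul_of_nonneg_left (h.expMean_le_varianceProxy hf hβ hv)
          (EReal.coe_nonneg.2 (by positivity))
    _ = _ := (EReal.coe_mul _ _).symm

end ReversibleAlgebra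

theorem mainTheorem3_general {Ω : Type*} [MeasurableSpace Ω] (μ : Measure Ω)
    [IsProbabilityMeasure μ] (κ : ℝ≥0 → Kernel Ω Ω) (hκ : IsMarkovSemigroup κ)
    (hrev : IsReversible κ μ) (herg : IsErgodic κ μ)
    (𝒜 : StarSubalgebra ℂ (Ω → ℂ)) (h𝒜 : IsSuitableAlgebra κ μ 𝒜)
    (d : ℕ) (hd : 0 < d) (c : ℝ) (hc : 0 < c) (hBE : BakryEmery κ μ 𝒜 d c)
    (f : Ω → Matrix (Fin d) (Fin d) ℂ) (hf : IsSuitable 𝒜 f) :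
    (∀ β : ℝ, 0 < β → ∀ θ : ℝ, -Real.sqrt (β / c) < θ → θ < Real.sqrt (β / c) →
      logTraceMgf μ f θ ≤
        ((c * θ ^ 2 / (2 * (1 - c * θ ^ 2 / β)) : ℝ) : EReal) * expMean κ μ f β) ∧
    (varianceProxy κ μ f < ∞ → ∀ θ : ℝ,
      logTraceMgf μ f θ ≤ ((c * (varianceProxy κ μ f).toReal * θ ^ 2 / 2 : ℝ) : EReal)) := by
  have : NeZero d := ⟨hd.ne'⟩
  have h : ReversibleAlgebra κ μ 𝒜 := ⟨hκ, hrev, h𝒜⟩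
  refine ⟨fun β hβ θ neg_lt lt => h.logTraceMgf_le herg hc hBE hf hβ ?_,
    h.logTraceMgf_le_varianceProxy herg hc hBE hf⟩
  have sq_lt : θ ^ 2 < β / c := by
    rw [← Real.sq_sqrt (div_pos hβ hc).le]
    exact sq_lt_sq' neg_lt lt
  rw [div_lt_one hβ]
  exact (lt_div_iff₀' hc).1 sq_lt

end MatrixMarkov

theorem mainTheorem3 {Ω : Type*} [TopologicalSpace Ω] [PolishSpace Ω] [MeasurableSpace Ω]
    [BorelSpace Ω] (μ : Measure Ω) [IsProbabilityMeasure μ]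
    (κ : ℝ≥0 → Kernel Ω Ω) (hκ : MatrixMarkov.IsMarkovSemigroup κ)
    (hstat : MatrixMarkov.IsStationary κ μ) (hrev : MatrixMarkov.IsReversible κ μ)
    (herg : MatrixMarkov.IsErgodic κ μ)
    (𝒜 : StarSubalgebra ℂ (Ω → ℂ)) (h𝒜 : MatrixMarkov.IsSuitableAlgebra κ μ 𝒜)
    (d : ℕ) (hd : 0 < d) (c : ℝ) (hc : 0 < c) (hBE : MatrixMarkov.BakryEmery κ μ 𝒜 d c)
    (f : Ω → Matrix (Fin d) (Fin d) ℂ) (hf : MatrixMarkov.IsSuitable 𝒜 f) :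
    (∀ β : ℝ, 0 < β → ∀ θ : ℝ, -Real.sqrt (β / c) < θ → θ < Real.sqrt (β / c) →
      MatrixMarkov.logTraceMgf μ f θ ≤
        ((c * θ ^ 2 / (2 * (1 - c * θ ^ 2 / β)) : ℝ) : EReal) * MatrixMarkov.expMean κ μ f β) ∧
    (MatrixMarkov.varianceProxy κ μ f < ∞ → ∀ θ : ℝ,
      MatrixMarkov.logTraceMgf μ f θ ≤
        ((c * (MatrixMarkov.varianceProxy κ μ f).toReal * θ ^ 2 / 2 : ℝ) : EReal)) :=
  MatrixMarkov.mainTheorem3_general μ κ hκ hrev herg 𝒜 h𝒜 d hd c hc hBE f hf
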